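/- Setting. Let $(\Omega,\mathcal F,\mathbf P)$ be a probability space, $T>0$, $W$ a standard $d$-dimensional Brownian motion on $[0,T]$, and $\mathbb F=(\mathcal F(t))_{t\in[0,T]}$ its augmented filtration. Let $r\ge 0$, $\bar\delta>0$, let $\Sigma=\sigma\sigma'\in\mathbb R^{d\times d}$ be positive definite and $\Lambda\in\mathbb R^{d\times d}$ diagonal and positive definite, put $B:=\Lambda^{-1}\Sigma/(2\bar\delta)$, and let $\mathcal I=\{1,\dots,N\}$ be the set of investors, all with risk tolerance $\bar\delta$. Let $\mathcal H^2$ (resp. $\mathcal H^\infty$) be the class of optional vector-valued processes $X$ on $[0,T]$ with $\mathbb E\int_0^T\|X(t)\|_2^2\,dt<\infty$ (resp. $\operatorname{ess\,sup}_{\omega}\operatorname{ess\,sup}_{t}\|X(t)\|_2<\infty$). Let $\mathcal A$ be the class of $X\in\mathcal H^\infty$ with $dX(t)=a^X(t)\,dt+dM^X(t)$, $X(T)=0$, where $a^X\in\mathcal H^\infty$ and $M^X$ is a continuous $\mathbb F$-martingale in $\mathcal H^\infty$. Let $\mathcal W_{\mathcal A}$ be the class of optional $X$ with $dX(t)=\dot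 X(t)\,dt$, $X(0)=0$, $\dot X\in\mathcal A$. Let $\nu,\zeta_m\in\mathcal H^\infty$ $(m\in\mathcal I)$ and $\psi\in\mathcal W_{\mathcal A}$ be given $\mathbb R^d$-valued processes, with $a^{\dot\psi}$ the drift of $\dot\psi$. For a matrix $D$ and a process $\xi$ of matching dimension, a solution of the linear FBSDE with data $(D,\xi)$ is a triple $(X,\dot X,M)$ with $X,\dot X\in\mathcal H^2$, $M$ a continuous square integrable $\mathbb F$-martingale, and $$dX(t)=\dot X(t)\,dt,\quad X(0)=0,\qquad d\dot X(t)=dM(t)+D\big(X(t)-\xi(t)\big)dt+r\dot X(t)\,dt,\quad \dot X(T)=0.$$ The frictional Nash system is the coupled system for $(\phi_m,\dot\phi_m,M_m)_{m\in\mathcal I}$ which requires that, for each $m\in\mathcal I$, $(\phi_m,\dot\phi_m,M_m)$ solves the linear FBSDE with data $(B,\mathbb{TP}_m)$, where $$\mathbb{TP}_m:=\frac{\sum_{i\ne m}\big(\bar\delta\Sigma^{-1}\nu-\phi_i\big)-\psi-(N-1)\zeta_m}{N+1}+\frac{2\bar\delta\,\Sigma^{-1}\Lambda}{N+1}\big(a^{\dot\psi}-r\dot\psi\big).$$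 Lemma. (1) The frictional Nash system has a solution with $\phi_m\in\mathcal W_{\mathcal A}$, $\dot\phi_m\in\mathcal A$ and $M_m\in\mathcal H^\infty$ for all $m\in\mathcal I$, and it is unique: every solution of the system (in particular every one with all $\phi_m\in\mathcal W_{\mathcal A}$) has, up to indistinguishability, the same $\phi_m$ and $\dot\phi_m$ and the same increments of $M_m$. (2) Let $C\in\mathbb R^{N\times N}$ have entries $1$ on the diagonal and $\frac1{N+1}$ off the diagonal. All (complex) eigenvalues of $C\otimes B\in\mathbb R^{dN\times dN}$ are real and positive. (3) Let $Z$ be the $\mathbb R^{dN}$-valued process with blocks $Z_m=B\,\dfrac{(N-1)\bar\delta\Sigma^{-1}\nu-\psi-(N-1)\zeta_m+2\bar\delta\Sigma^{-1}\Lambda(a^{\dot\psi}-r\dot\psi)}{N+1}$. Then $(C\otimes B)^{-1}Z\in\mathcal H^\infty$, and $(\phi_m,\dot\phi_m,M_m)_{m\in\mathcal I}$ solves the frictional Nash system if and only if the stacked $\mathbb R^{dN}$-valued triple $(\phi,\dot\phi,M)$ solves the linear FBSDE with data $\big(C\otimes B,(C\otimes B)^{-1}Z\big)$. -/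

import Mathlib

open MeasureTheory ProbabilityTheory Filter Topology
open scoped Matrix Kronecker ENNReal

noncomputable section

namespace FrictionalNash

/-- The time interval `[0, T]`. -/
abbrev TimeInt (T : ℝ) : Type := ↥(Set.Icc (0 : ℝ) T)

/-- Lebesgue measure `dt` on `[0, T]`. -/
def leb (T : ℝ) : Measure (TimeInt T) := (volume : Measure ℝ).comap Subtype.val

/-- `W` is a standard `d`-dimensional Brownian motion on `[0, T]`: it starts at `0`, has
independent increments, `W t - W s` is a centred Gaussian vector with covariance `(t - s) I_d`,
and its paths are almost surely continuous. -/
structure IsBrownianMotion {Ω : Type*} {mΩ : MeasurableSpace Ω} (P : Measure Ω) {T : ℝ} {d : ℕ}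
    (W : TimeInt T → Ω → EuclideanSpace ℝ (Fin d)) : Prop where
  measurable : ∀ t, Measurable (W t)
  init : ∀ t : TimeInt T, (t : ℝ) = 0 → ∀ᵐ ω ∂P, W t ω = 0
  indep : HasIndepIncrements W P
  law : ∀ s t : TimeInt T, s ≤ t →
    HasLaw (fun ω (i : Fin d) => W t ω i - W s ω i)
      (Measure.pi fun _ : Fin d => gaussianReal 0 (Real.toNNReal ((t : ℝ) - (s : ℝ)))) P
  continuous : ∀ᵐ ω ∂P, Continuous fun t => W t ω

/-- The augmented filtration generated by `W`: the σ-algebra at time `t` is generated by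
`W s`, `s ≤ t`, and all `P`-null events. -/
def augmentedFiltration {Ω : Type*} {mΩ : MeasurableSpace Ω} (P : Measure Ω) {T : ℝ} {d : ℕ}
    (W : TimeInt T → Ω → EuclideanSpace ℝ (Fin d)) (hW : ∀ t, Measurable (W t)) :
    Filtration (TimeInt T) mΩ where
  seq t := (⨆ s ≤ t, MeasurableSpace.comap (W s) inferInstance) ⊔
    MeasurableSpace.generateFrom {A : Set Ω | MeasurableSet A ∧ P A = 0}
  mono' _ _ hst := sup_le_sup_right (biSup_mono fun _ hu => le_trans hu hst) _
  le' _ := sup_le (iSup₂_le fun s _ => (hW s).comap_le)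
    (MeasurableSpace.generateFrom_le fun _ hA => hA.1)

/-- A real process all of whose paths are right-continuous with left limits. -/
def IsCadlag {Ω : Type*} {T : ℝ} (X : TimeInt T → Ω → ℝ) : Prop :=
  ∀ ω t, ContinuousWithinAt (fun s => X s ω) (Set.Ici t) t ∧
    ∃ l : ℝ, Tendsto (fun s => X s ω) (𝓝[<] t) (𝓝 l)

/-- The optional σ-algebra on `[0, T] × Ω`, generated by the adapted càdlàg processes. -/
def optionalSigma {Ω : Type*} {mΩ : MeasurableSpace Ω} {T : ℝ}
    (F : Filtration (TimeInt T) mΩ) : MeasurableSpace (TimeInt T × Ω) :=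
  ⨆ X : {X : TimeInt T → Ω → ℝ // Adapted F X ∧ IsCadlag X},
    MeasurableSpace.comap (fun p => X.1 p.1 p.2) inferInstance

/-- Optional vector-valued processes. -/
def IsOptional {Ω : Type*} {mΩ : MeasurableSpace Ω} {T : ℝ} (F : Filtration (TimeInt T) mΩ)
    {ι : Type*} [Fintype ι] (X : TimeInt T → Ω → EuclideanSpace ℝ ι) : Prop :=
  Measurable[optionalSigma F] fun p : TimeInt T × Ω => X p.1 p.2

/-- The class `H²`: optional with `E ∫_0^T ‖X(t)‖² dt < ∞`. -/
structure MemH2 {Ω : Type*} {mΩ : MeasurableSpace Ω} (P : Measure Ω) {T : ℝ}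
    (F : Filtration (TimeInt T) mΩ) {ι : Type*} [Fintype ι]
    (X : TimeInt T → Ω → EuclideanSpace ℝ ι) : Prop where
  optional : IsOptional F X
  finite : ∫⁻ ω, ∫⁻ t, ‖X t ω‖ₑ ^ 2 ∂(leb T) ∂P < ∞

/-- The class `H^∞`: optional with `ess sup_ω ess sup_t ‖X(t)‖ < ∞`. -/
structure MemHInf {Ω : Type*} {mΩ : MeasurableSpace Ω} (P : Measure Ω) {T : ℝ}
    (F : Filtration (TimeInt T) mΩ) {ι : Type*} [Fintype ι]
    (X : TimeInt T → Ω → EuclideanSpace ℝ ι) : Prop where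
  optional : IsOptional F X
  finite : essSup (fun ω => essSup (fun t => ‖X t ω‖ₑ) (leb T)) P < ∞

/-- `X` belongs to `𝒜`, with drift `a = a^X` and martingale part `M = M^X`:
`dX = a dt + dM`, `X(T) = 0`, `a ∈ H^∞`, and `M` is a continuous martingale in `H^∞`. -/
structure IsADecomposition {Ω : Type*} {mΩ : MeasurableSpace Ω} (P : Measure Ω) {T : ℝ}
    (F : Filtration (TimeInt T) mΩ) {ι : Type*} [Fintype ι]
    (X a M : TimeInt T → Ω → EuclideanSpace ℝ ι) : Prop where
  memX : MemHInf P F X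
  mem_drift : MemHInf P F a
  memM : MemHInf P F M
  martingale : Martingale M F P
  continuous : ∀ᵐ ω ∂P, Continuous fun t => M t ω
  dynamics : ∀ᵐ ω ∂P, ∀ s t : TimeInt T, s ≤ t →
    X t ω - X s ω = (∫ u in Set.Ioc s t, a u ω ∂(leb T)) + (M t ω - M s ω)
  terminal : ∀ᵐ ω ∂P, ∀ t : TimeInt T, (t : ℝ) = T → X t ω = 0

/-- The class `𝒜`. -/
def MemA {Ω : Type*} {mΩ : MeasurableSpace Ω} (P : Measure Ω) {T : ℝ}
    (F : Filtration (TimeInt T) mΩ) {ι : Type*} [Fintype ι]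
    (X : TimeInt T → Ω → EuclideanSpace ℝ ι) : Prop :=
  ∃ a M, IsADecomposition P F X a M

/-- `dX = Ẋ dt` and `X(0) = 0`. -/
structure HasRate {Ω : Type*} {mΩ : MeasurableSpace Ω} (P : Measure Ω) {T : ℝ}
    {ι : Type*} [Fintype ι] (X Xdot : TimeInt T → Ω → EuclideanSpace ℝ ι) : Prop where
  dynamics : ∀ᵐ ω ∂P, ∀ s t : TimeInt T, s ≤ t →
    X t ω - X s ω = ∫ u in Set.Ioc s t, Xdot u ω ∂(leb T)
  init : ∀ᵐ ω ∂P, ∀ t : TimeInt T, (t : ℝ) = 0 → X t ω = 0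

/-- The class `𝒲_𝒜` of (optional) processes with `dX = Ẋ dt`, `X(0) = 0`, `Ẋ ∈ 𝒜`. -/
def MemWA {Ω : Type*} {mΩ : MeasurableSpace Ω} (P : Measure Ω) {T : ℝ}
    (F : Filtration (TimeInt T) mΩ) {ι : Type*} [Fintype ι]
    (X : TimeInt T → Ω → EuclideanSpace ℝ ι) : Prop :=
  IsOptional F X ∧ ∃ Xdot, HasRate P X Xdot ∧ MemA P F Xdot

/-- `(X, Ẋ, M)` solves the linear FBSDE with coefficient matrix `B`, target `ξ` and rate `r`:
`dX = Ẋ dt`, `X(0) = 0`, `dẊ = dM + B (X - ξ) dt + r Ẋ dt`, `Ẋ(T) = 0`, where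
`X, Ẋ ∈ H²` and the martingale `M`, which is part of the solution, is continuous and
square integrable. -/
structure IsFBSDESolution {Ω : Type*} {mΩ : MeasurableSpace Ω} (P : Measure Ω) {T : ℝ}
    (F : Filtration (TimeInt T) mΩ) {ι : Type*} [Fintype ι] [DecidableEq ι]
    (r : ℝ) (B : Matrix ι ι ℝ) (ξ X Xdot M : TimeInt T → Ω → EuclideanSpace ℝ ι) : Prop where
  memX : MemH2 P F X
  memXdot : MemH2 P F Xdot
  martingale : Martingale M F P
  sq_integrable : ∀ t, MemLp (M t) 2 P
  continuous : ∀ᵐ ω ∂P, Continuous fun t => M t ω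
  forward : HasRate P X Xdot
  backward : ∀ᵐ ω ∂P, ∀ s t : TimeInt T, s ≤ t →
    Xdot t ω - Xdot s ω = (M t ω - M s ω) +
      ∫ u in Set.Ioc s t,
        (Matrix.toEuclideanLin B (X u ω - ξ u ω) + r • Xdot u ω) ∂(leb T)
  terminal : ∀ᵐ ω ∂P, ∀ t : TimeInt T, (t : ℝ) = T → Xdot t ω = 0

/-- `B = Λ⁻¹ Σ / (2 δ)`. -/
def matB {d : ℕ} (δ : ℝ) (Sig Lam : Matrix (Fin d) (Fin d) ℝ) : Matrix (Fin d) (Fin d) ℝ :=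
  (2 * δ)⁻¹ • (Lam⁻¹ * Sig)

/-- The `N × N` matrix with `1` on the diagonal and `1 / (N + 1)` off the diagonal. -/
def matC (N : ℕ) : Matrix (Fin N) (Fin N) ℝ :=
  Matrix.of fun i j => if i = j then 1 else 1 / ((N : ℝ) + 1)

/-- The target of investor `m`, given the demands `φ` of all investors:
`(∑_{i ≠ m} (δ Σ⁻¹ ν - φ_i) - ψ - (N - 1) ζ_m) / (N + 1) + 2 δ Σ⁻¹ Λ (a - r ψ̇) / (N + 1)`. -/
def target {Ω : Type*} {T : ℝ} {d N : ℕ} (r δ : ℝ) (Sig Lam : Matrix (Fin d) (Fin d) ℝ)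
    (ν ψ ψdot a : TimeInt T → Ω → EuclideanSpace ℝ (Fin d))
    (ζ φ : Fin N → TimeInt T → Ω → EuclideanSpace ℝ (Fin d)) (m : Fin N) :
    TimeInt T → Ω → EuclideanSpace ℝ (Fin d) := fun t ω =>
  ((N : ℝ) + 1)⁻¹ •
      ((∑ i ∈ Finset.univ.erase m, (δ • Matrix.toEuclideanLin Sig⁻¹ (ν t ω) - φ i t ω))
        - ψ t ω - ((N : ℝ) - 1) • ζ m t ω)
    + (2 * δ / ((N : ℝ) + 1)) •
      Matrix.toEuclideanLin (Sig⁻¹ * Lam) (a t ω - r • ψdot t ω)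

/-- `(φ_m, φ̇_m, M_m)_m` solves the coupled system of linear FBSDEs of all investors:
for each `m`, it solves the FBSDE with matrix `B` and target depending on the demands of the
other investors. -/
def IsNashSystemSolution {Ω : Type*} {mΩ : MeasurableSpace Ω} (P : Measure Ω) {T : ℝ}
    (F : Filtration (TimeInt T) mΩ) {d N : ℕ} (r δ : ℝ) (Sig Lam : Matrix (Fin d) (Fin d) ℝ)
    (ν ψ ψdot a : TimeInt T → Ω → EuclideanSpace ℝ (Fin d))
    (ζ φ φdot M : Fin N → TimeInt T → Ω → EuclideanSpace ℝ (Fin d)) : Prop :=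
  ∀ m, IsFBSDESolution P F r (matB δ Sig Lam) (target r δ Sig Lam ν ψ ψdot a ζ φ m)
    (φ m) (φdot m) (M m)

/-- The `ℝ^{dN}`-valued process obtained by stacking `N` processes in `ℝ^d`. -/
def stack {Ω : Type*} {T : ℝ} {d N : ℕ}
    (φ : Fin N → TimeInt T → Ω → EuclideanSpace ℝ (Fin d)) :
    TimeInt T → Ω → EuclideanSpace ℝ (Fin N × Fin d) :=
  fun t ω => WithLp.toLp 2 fun p => φ p.1 t ω p.2

/-- The exogenous part of the stacked drift: block `m` is
`B ((N - 1) δ Σ⁻¹ ν - ψ - (N - 1) ζ_m + 2 δ Σ⁻¹ Λ (a - r ψ̇)) / (N + 1)`. -/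
def exoZ {Ω : Type*} {T : ℝ} {d N : ℕ} (r δ : ℝ) (Sig Lam : Matrix (Fin d) (Fin d) ℝ)
    (ν ψ ψdot a : TimeInt T → Ω → EuclideanSpace ℝ (Fin d))
    (ζ : Fin N → TimeInt T → Ω → EuclideanSpace ℝ (Fin d)) :
    TimeInt T → Ω → EuclideanSpace ℝ (Fin N × Fin d) :=
  stack fun m t ω => Matrix.toEuclideanLin (matB δ Sig Lam)
    (((N : ℝ) + 1)⁻¹ • ((((N : ℝ) - 1) * δ) • Matrix.toEuclideanLin Sig⁻¹ (ν t ω) - ψ t ω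
      - ((N : ℝ) - 1) • ζ m t ω
      + (2 * δ) • Matrix.toEuclideanLin (Sig⁻¹ * Lam) (a t ω - r • ψdot t ω)))

end FrictionalNash

end

/-! Inserting the targets into the system gives B (φ_m - TP_m) = ∑ᵢ C_mi B φ_i - Z_m, so the coupled
equations are the blocks of one linear FBSDE with matrix C ⊗ B (`toEuclideanLin_sub_target`,
`isNashSystemSolution_iff`). Here C is the sum of a positive multiple of the identity and a rank one
positive semidefinite matrix, and Λ⁻¹ is a positive diagonal matrix, so C ⊗ B is a positive diagonal
matrix times the positive definite matrix C ⊗ Σ. Conjugating with the square root of the diagonal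
factor makes it symmetric positive definite. Hence it is diagonalizable over ℝ with positive
eigenvalues (`exists_diagonalization_kronecker`), and in eigencoordinates the system splits into
scalar FBSDEs dx = v dt, dv = dm + k (x - ξ) dt + r v dt with k > 0.

A scalar equation is solved with a positive h such that h'' = r h' + k h and h'(T) = 0. Let I(t) =
∫₀ᵗ k e^(-ru) h ξ du and N(t) = E[I(T) | F(t)]. Then v = (h'/h) x + c with c = (e^(rt)/h) (N - I), a
linear random ODE for x, and the martingale part is ∫ (e^(rt)/h) dN, defined by parts because the
integrand is deterministic and smooth. Bounded ξ gives bounded x, v and m (`path_solution`,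
`exists_scalar_solution`). For uniqueness, the difference of two solutions is integrated over an
event of F(t). The martingale disappears, a deterministic ODE on [t, T] remains, and a Wronskian
gives h v = h' x almost surely. Thus x/h is constant and x(0) = 0 forces x = 0 (`backward_ode`,
`scalar_solution_unique`).

The martingale N has to be continuous. No stochastic integral representation is used: the η in L²
for which E[η | F(t)] has a continuous version form a closed subspace, by Doob's maximal inequality.
It contains the cosines of linear functionals of finitely many values of W, by independence of
increments. A variable orthogonal to it is orthogonal to all these cosines, so its conditional
expectations vanish, so it lies in the subspace itself and is zero
(`hasContinuousVersion_of_memLp_two`). -/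

noncomputable section

namespace FrictionalNash

variable {Ω : Type*} {mΩ : MeasurableSpace Ω} {P : Measure Ω} {T : ℝ}

/-! ### Continuous versions of martingales -/

/-- The points `j T / 2 ^ m`, truncated at `T`. -/
def dyadicGrid (hT : 0 ≤ T) (m j : ℕ) : TimeInt T := Set.projIcc 0 T hT (T * j / 2 ^ m)

lemma dyadicGrid_monotone (hT : 0 ≤ T) (m : ℕ) : Monotone (dyadicGrid hT m) := by
  intro i j hij
  refine Set.monotone_projIcc hT ?_
  gcongr

lemma dyadicGrid_succ (hT : 0 ≤ T) (m j : ℕ) :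
    dyadicGrid hT (m + 1) (2 * j) = dyadicGrid hT m j := by
  unfold dyadicGrid
  congr 1
  push_cast
  rw [pow_succ]
  field_simp

lemma dyadicGrid_last (hT : 0 ≤ T) (m : ℕ) : dyadicGrid hT m (2 ^ m) = ⟨T, hT, le_rfl⟩ := by
  unfold dyadicGrid
  have : T * ((2 ^ m : ℕ) : ℝ) / 2 ^ m = T := by push_cast; field_simp
  rw [this, Set.projIcc_right]

lemma exists_dyadicGrid_tendsto (hT : 0 < T) (t : TimeInt T) :
    ∃ j : ℕ → ℕ, (∀ m, j m ≤ 2 ^ m) ∧ Tendsto (fun m => dyadicGrid hT.le m (j m)) atTop (𝓝 t) := by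
  refine ⟨fun m => ⌊(t / T : ℝ) * 2 ^ m⌋₊, fun m => ?_, ?_⟩
  · have h1 : (t / T : ℝ) ≤ 1 := by rw [div_le_one hT]; exact t.2.2
    have : (t / T : ℝ) * 2 ^ m ≤ ((2 ^ m : ℕ) : ℝ) := by
      push_cast
      have : (0 : ℝ) < 2 ^ m := by positivity
      nlinarith
    exact Nat.floor_le_of_le this
  · have h0 : (0 : ℝ) ≤ t / T := div_nonneg t.2.1 hT.le
    have h1 : Tendsto (fun m : ℕ => ((⌊(t / T : ℝ) * 2 ^ m⌋₊ : ℝ)) / 2 ^ m) atTop (𝓝 (t / T)) :=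
      (tendsto_nat_floor_mul_div_atTop h0).comp
        (tendsto_pow_atTop_atTop_of_one_lt (one_lt_two : (1 : ℝ) < 2))
    have h2 : Tendsto (fun m : ℕ => T * ((⌊(t / T : ℝ) * 2 ^ m⌋₊ : ℝ)) / 2 ^ m) atTop (𝓝 (t : ℝ)) := by
      have := h1.const_mul T
      rw [mul_div_cancel₀ _ hT.ne'] at this
      simpa [mul_div_assoc] using this
    have h3 := ((continuous_projIcc (h := hT.le)).tendsto (t : ℝ)).comp h2
    rw [Set.projIcc_val] at h3
    exact h3

/-- Sampling along deterministic increasing times produces the discrete martingale that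
`maximal_ineq` needs. -/
lemma martingale_comp_monotone {N : TimeInt T → Ω → ℝ} {F : Filtration (TimeInt T) mΩ}
    (hN : Martingale N F P) {τ : ℕ → TimeInt T} (hτ : Monotone τ) :
    Martingale (fun n => N (τ n))
      { seq := fun n => F (τ n), mono' := fun _ _ h => F.mono (hτ h), le' := fun _ => F.le _ } P :=
  ⟨fun n => hN.1 (τ n), fun _ _ h => hN.2 _ _ (hτ h)⟩

/-- Doob's maximal inequality for continuous martingales. -/
theorem maximal_ineq_continuous [IsProbabilityMeasure P] (hT : 0 < T)
    {F : Filtration (TimeInt T) mΩ} {N : TimeInt T → Ω → ℝ} (hN : Martingale N F P)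
    (hc : ∀ ω, Continuous fun t => N t ω) (ε : NNReal) :
    ε * P {ω | ∃ t, (ε : ℝ) < |N t ω|} ≤ ENNReal.ofReal (∫ ω, |N ⟨T, hT.le, le_rfl⟩ ω| ∂P) := by
  -- The grids are nested, so these events increase. By continuity a strict exceedance at any time
  -- is inherited by a nearby grid point, so their union covers the event in question.
  set E : ℕ → Set Ω := fun m => {ω | ∃ j ≤ 2 ^ m, (ε : ℝ) ≤ |N (dyadicGrid hT.le m j) ω|}
    with hE
  have hmono : Monotone E := by
    refine monotone_nat_of_le_succ fun m ω => ?_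
    rintro ⟨j, hj, h⟩
    refine ⟨2 * j, by rw [pow_succ]; omega, ?_⟩
    rwa [dyadicGrid_succ]
  have hsub : {ω | ∃ t, (ε : ℝ) < |N t ω|} ⊆ ⋃ m, E m := by
    rintro ω ⟨t, ht⟩
    obtain ⟨j, hj, hlim⟩ := exists_dyadicGrid_tendsto hT t
    have h1 : Tendsto (fun m => |N (dyadicGrid hT.le m (j m)) ω|) atTop (𝓝 |N t ω|) :=
      (((hc ω).abs).tendsto t).comp hlim
    obtain ⟨m, hm⟩ := (h1.eventually (lt_mem_nhds ht)).exists
    exact Set.mem_iUnion.2 ⟨m, j m, hj m, hm.le⟩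
  have hbound : ∀ m, ε * P (E m) ≤ ENNReal.ofReal (∫ ω, |N ⟨T, hT.le, le_rfl⟩ ω| ∂P) := by
    intro m
    have hmart := martingale_comp_monotone hN (dyadicGrid_monotone hT.le m)
    -- The supremum of N and -N is |N|, a nonnegative submartingale.
    have hs := hmart.submartingale.sup hmart.neg.submartingale
    have := maximal_ineq hs (fun n ω => by
      simpa using le_total 0 (N (dyadicGrid hT.le m n) ω)) (ε := ε) (2 ^ m)
    refine le_trans (le_of_eq ?_) (this.trans ?_)
    · congr 2
      ext ω
      simp [hE, Finset.le_sup'_iff, abs]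
    · refine ENNReal.ofReal_le_ofReal ?_
      have h2 : (fun ω => ((fun n => N (dyadicGrid hT.le m n)) ⊔
          -fun n => N (dyadicGrid hT.le m n)) (2 ^ m) ω) =
          fun ω => |N ⟨T, hT.le, le_rfl⟩ ω| := by
        funext ω
        simp [dyadicGrid_last, abs]
      rw [h2]
      exact setIntegral_le_integral (hN.integrable _).abs (ae_of_all _ fun ω => abs_nonneg _)
  calc ε * P {ω | ∃ t, (ε : ℝ) < |N t ω|} ≤ ε * P (⋃ m, E m) := by gcongr
    _ = ε * ⨆ m, P (E m) := by rw [hmono.measure_iUnion]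
    _ = ⨆ m, ε * P (E m) := ENNReal.mul_iSup ..
    _ ≤ _ := iSup_le hbound

/-- `E[η | F t]` has an adapted version all of whose paths are continuous. -/
def HasContinuousVersion (P : Measure Ω) (F : Filtration (TimeInt T) mΩ) (η : Ω → ℝ) : Prop :=
  ∃ N : TimeInt T → Ω → ℝ, (∀ ω, Continuous fun t => N t ω) ∧
    (∀ t, StronglyMeasurable[F t] (N t)) ∧ ∀ t, N t =ᵐ[P] P[η|F t]

/-- The filtration contains all null events. -/
def IsNullComplete (P : Measure Ω) (F : Filtration (TimeInt T) mΩ) : Prop :=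
  ∀ t A, MeasurableSet A → P A = 0 → MeasurableSet[F t] A

lemma HasContinuousVersion.congr {F : Filtration (TimeInt T) mΩ} {η η' : Ω → ℝ}
    (h : HasContinuousVersion P F η) (hη : η =ᵐ[P] η') : HasContinuousVersion P F η' := by
  obtain ⟨N, h1, h2, h3⟩ := h
  exact ⟨N, h1, h2, fun t => (h3 t).trans (condExp_congr_ae hη)⟩

lemma martingale_of_ae_eq_condExp [IsProbabilityMeasure P] {F : Filtration (TimeInt T) mΩ}
    {η : Ω → ℝ} {N : TimeInt T → Ω → ℝ}
    (h2 : ∀ t, StronglyMeasurable[F t] (N t)) (h3 : ∀ t, N t =ᵐ[P] P[η|F t]) :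
    Martingale N F P :=
  (martingale_condExp η F P).congr h2 fun t => (h3 t).symm

lemma HasContinuousVersion.add {F : Filtration (TimeInt T) mΩ} {η η' : Ω → ℝ}
    (h : HasContinuousVersion P F η) (h' : HasContinuousVersion P F η')
    (hi : Integrable η P) (hi' : Integrable η' P) : HasContinuousVersion P F (η + η') := by
  obtain ⟨N, h1, h2, h3⟩ := h
  obtain ⟨N', h1', h2', h3'⟩ := h'
  exact ⟨fun t => N t + N' t, fun ω => (h1 ω).add (h1' ω), fun t => (h2 t).add (h2' t),
    fun t => ((h3 t).add (h3' t)).trans (condExp_add hi hi' _).symm⟩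

lemma HasContinuousVersion.smul {F : Filtration (TimeInt T) mΩ} {η : Ω → ℝ}
    (h : HasContinuousVersion P F η) (c : ℝ) : HasContinuousVersion P F (c • η) := by
  obtain ⟨N, h1, h2, h3⟩ := h
  exact ⟨fun t => c • N t, fun ω => (h1 ω).const_smul c, fun t => (h2 t).const_smul c,
    fun t => ((h3 t).const_smul c).trans (condExp_smul c _ _).symm⟩

/-- Limits in `L¹` preserve the existence of continuous versions. -/
theorem HasContinuousVersion.of_tendsto [IsProbabilityMeasure P] (hT : 0 < T)
    {F : Filtration (TimeInt T) mΩ} (hF : IsNullComplete P F) {η : Ω → ℝ} {f : ℕ → Ω → ℝ}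
    (hη : Integrable η P) (hf : ∀ n, Integrable (f n) P)
    (hv : ∀ n, HasContinuousVersion P F (f n))
    (hlim : ∀ n, ∫ ω, |f n ω - η ω| ∂P ≤ (1 / 4) ^ n) : HasContinuousVersion P F η := by
  choose N hc hm he using hv
  set top : TimeInt T := ⟨T, hT.le, le_rfl⟩
  have hmart : ∀ n, Martingale (N n) F P := fun n => martingale_of_ae_eq_condExp (hm n) (he n)
  -- the increments are uniformly small
  have hsmall : ∀ n, P {ω | ∃ t, ((1 / 2 : NNReal) ^ n : NNReal) < |N (n + 1) t ω - N n t ω|} ≤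
      2 * (1 / 2 : ℝ≥0∞) ^ n := by
    intro n
    have h1 := maximal_ineq_continuous hT ((hmart (n + 1)).sub (hmart n))
      (fun ω => (hc (n + 1) ω).sub (hc n ω)) ((1 / 2 : NNReal) ^ n)
    have h2 : ∫ ω, |(N (n + 1) - N n) top ω| ∂P ≤ 2 * (1 / 4) ^ n := by
      have h3 : (fun ω => (N (n + 1) - N n) top ω) =ᵐ[P] P[f (n + 1) - f n|F top] := by
        filter_upwards [he (n + 1) top, he n top,
          condExp_sub (hf (n + 1)) (hf n) (F top)] with ω a b c
        simp [a, b, c]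
      calc ∫ ω, |(N (n + 1) - N n) top ω| ∂P = ∫ ω, |(P[f (n + 1) - f n|F top]) ω| ∂P :=
            integral_congr_ae (h3.fun_comp abs)
        _ ≤ ∫ ω, |(f (n + 1) - f n) ω| ∂P := integral_abs_condExp_le _
        _ ≤ ∫ ω, (|f (n + 1) ω - η ω| + |f n ω - η ω|) ∂P := by
            refine integral_mono ((hf _).sub (hf _)).abs
              (((hf _).sub hη).abs.add ((hf _).sub hη).abs) fun ω => ?_
            have := abs_sub (f (n + 1) ω - η ω) (f n ω - η ω)
            simpa using this
        _ = ∫ ω, |f (n + 1) ω - η ω| ∂P + ∫ ω, |f n ω - η ω| ∂P :=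
            integral_add ((hf _).sub hη).abs ((hf _).sub hη).abs
        _ ≤ (1 / 4) ^ (n + 1) + (1 / 4) ^ n := add_le_add (hlim _) (hlim _)
        _ ≤ 2 * (1 / 4) ^ n := by
            have : (0 : ℝ) < (1 / 4) ^ n := by positivity
            rw [pow_succ]; linarith
    -- Dividing 2 · 4⁻ⁿ by the threshold 2⁻ⁿ still leaves a summable bound, which is what
    -- Borel–Cantelli requires; this is the reason for the rate 1/4 in `hlim`.
    have h4 : ENNReal.ofReal (2 * (1 / 4) ^ n) =
        (((1 / 2 : NNReal) ^ n : NNReal) : ℝ≥0∞) * (2 * (1 / 2 : ℝ≥0∞) ^ n) := by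
      have e1 : (1 / 2 : ℝ≥0∞) = ((1 / 2 : NNReal) : ℝ≥0∞) := by simp
      have e2 : (2 : ℝ≥0∞) = ((2 : NNReal) : ℝ≥0∞) := by simp
      rw [e1, e2, ← ENNReal.coe_pow, ← ENNReal.coe_mul, ← ENNReal.coe_mul,
        ENNReal.ofReal, ENNReal.coe_inj]
      ext
      rw [Real.coe_toNNReal _ (by positivity)]
      push_cast
      rw [show (1 / 4 : ℝ) = (1 / 2) * (1 / 2) by norm_num, mul_pow]
      ring
    have h5 := h1.trans (ENNReal.ofReal_le_ofReal h2)
    rw [h4] at h5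
    refine (ENNReal.mul_le_mul_iff_right (by simp) ENNReal.coe_ne_top).1 h5
  have hsum : ∑' n, P {ω | ∃ t, ((1 / 2 : NNReal) ^ n : NNReal) < |N (n + 1) t ω - N n t ω|}
      ≠ ∞ := by
    refine ne_top_of_le_ne_top ?_ (ENNReal.tsum_le_tsum hsmall)
    rw [ENNReal.tsum_mul_left, ENNReal.tsum_geometric]
    simpa using ENNReal.mul_ne_top ENNReal.ofNat_ne_top ENNReal.ofNat_ne_top
  have hae := ae_eventually_notMem hsum
  -- a measurable full event on which the convergence is uniform
  obtain ⟨B, hBsub, hBm, hB0⟩ := exists_measurable_superset_of_null (ae_iff.1 hae)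
  have hgood : ∀ ω ∉ B, ∃ g : TimeInt T → ℝ, TendstoUniformly (fun n t => N n t ω) g atTop := by
    intro ω hω
    have h1 : ∀ᶠ n in atTop,
        ω ∉ {ω | ∃ t, ((1 / 2 : NNReal) ^ n : NNReal) < |N (n + 1) t ω - N n t ω|} := by
      by_contra h
      exact hω (hBsub h)
    obtain ⟨n₀, hn₀⟩ := eventually_atTop.1 h1
    have h2 : ∀ n ≥ n₀, ∀ t, |N (n + 1) t ω - N n t ω| ≤ (1 / 2) ^ n := by
      intro n hn t
      have := hn₀ n hn
      simp only [Set.mem_ofPred_eq, not_exists, not_lt] at this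
      simpa using this t
    -- Weierstrass test for the telescoping series of increments from index n₀ on.
    have hu : TendstoUniformly
        (fun k t => ∑ i ∈ Finset.range k, (N (n₀ + i + 1) t ω - N (n₀ + i) t ω))
        (fun t => ∑' i, (N (n₀ + i + 1) t ω - N (n₀ + i) t ω)) atTop := by
      refine tendstoUniformly_tsum_nat (u := fun i => (1 / 2) ^ (n₀ + i)) ?_ ?_
      · simp_rw [pow_add]
        exact (summable_geometric_of_lt_one (by norm_num) (by norm_num)).mul_left _
      · intro i t
        exact h2 (n₀ + i) (by omega) t
    refine ⟨fun t => N n₀ t ω + ∑' i, (N (n₀ + i + 1) t ω - N (n₀ + i) t ω), ?_⟩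
    rw [Metric.tendstoUniformly_iff] at hu ⊢
    intro ε hε
    obtain ⟨K, hK⟩ := eventually_atTop.1 (hu ε hε)
    refine eventually_atTop.2 ⟨n₀ + K, fun n hn t => ?_⟩
    have h3 := hK (n - n₀) (by omega) t
    have h4 : ∑ i ∈ Finset.range (n - n₀), (N (n₀ + i + 1) t ω - N (n₀ + i) t ω) =
        N n t ω - N n₀ t ω := by
      have := Finset.sum_range_sub (fun i => N (n₀ + i) t ω) (n - n₀)
      rw [show n₀ + (n - n₀) = n by omega] at this
      simpa [add_assoc] using this
    rw [h4, Real.dist_eq] at h3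
    rw [Real.dist_eq]
    convert h3 using 2
    ring
  choose! g hg using hgood
  classical
  set Z : TimeInt T → Ω → ℝ := fun t ω => if ω ∈ B then 0 else g ω t with hZ
  -- The exceptional event is null, so it belongs to every F t and setting the limit to zero there
  -- does not destroy adaptedness.
  have hBF : ∀ t, MeasurableSet[F t] B := fun t => hF t B hBm hB0
  have hNZ : ∀ t ω, Tendsto (fun n => Bᶜ.indicator (N n t) ω) atTop (𝓝 (Z t ω)) := by
    intro t ω
    by_cases hω : ω ∈ B
    · simp [hZ, hω]
    · simpa [hZ, hω] using (hg ω hω).tendsto_at t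
  refine ⟨Z, fun ω => ?_, fun t => ?_, fun t => ?_⟩
  · by_cases hω : ω ∈ B
    · simpa [hZ, hω] using continuous_const
    · simpa [hZ, hω] using (hg ω hω).continuous (Frequently.of_forall fun n => hc n ω)
  · refine stronglyMeasurable_of_tendsto (f := fun n => Bᶜ.indicator (N n t)) atTop
      (fun n => (hm n t).indicator (hBF t).compl) ?_
    exact tendsto_pi_nhds.2 (hNZ t)
  -- Conditional expectation is an L¹ contraction, so P[f n|F t] converges in L¹ and a subsequence
  -- converges almost surely; its limit must agree with the uniform one.
  · have hL : Tendsto (fun n => eLpNorm (P[f n|F t] - P[η|F t]) 1 P) atTop (𝓝 0) := by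
      have hb : ∀ n, eLpNorm (P[f n|F t] - P[η|F t]) 1 P ≤ ENNReal.ofReal ((1 / 4) ^ n) := by
        intro n
        calc eLpNorm (P[f n|F t] - P[η|F t]) 1 P = eLpNorm (P[f n - η|F t]) 1 P :=
              eLpNorm_congr_ae (condExp_sub (hf n) hη _).symm
          _ ≤ eLpNorm (f n - η) 1 P := eLpNorm_condExp_le_eLpNorm _ le_rfl
          _ = ENNReal.ofReal (∫ ω, |f n ω - η ω| ∂P) := by
              have hi : Integrable (fun ω => |f n ω - η ω|) P := ((hf n).sub hη).abs
              rw [eLpNorm_one_eq_lintegral_enorm,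
                ofReal_integral_eq_lintegral_ofReal hi (ae_of_all _ fun _ => abs_nonneg _)]
              refine lintegral_congr fun ω => ?_
              rw [← Real.enorm_abs, Real.enorm_of_nonneg (abs_nonneg _)]; rfl
          _ ≤ _ := ENNReal.ofReal_le_ofReal (hlim n)
      refine tendsto_of_tendsto_of_tendsto_of_le_of_le tendsto_const_nhds ?_
        (fun _ => zero_le) hb
      have : Tendsto (fun n : ℕ => (1 / 4 : ℝ) ^ n) atTop (𝓝 0) :=
        tendsto_pow_atTop_nhds_zero_of_lt_one (by norm_num) (by norm_num)
      simpa using ENNReal.tendsto_ofReal this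
    have hTM : TendstoInMeasure P (fun n => P[f n|F t]) atTop (P[η|F t]) :=
      tendstoInMeasure_of_tendsto_eLpNorm one_ne_zero
        (fun n => integrable_condExp.aestronglyMeasurable) integrable_condExp.aestronglyMeasurable
        hL
    obtain ⟨ns, hns, hlim'⟩ := hTM.exists_seq_tendsto_ae
    have hBae : ∀ᵐ ω ∂P, ω ∉ B := by
      rw [ae_iff]; simpa using hB0
    have hall : ∀ᵐ ω ∂P, ∀ n, N n t ω = (P[f n|F t]) ω := ae_all_iff.2 fun n => he n t
    filter_upwards [hlim', hBae, hall] with ω h1 h2 h3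
    refine tendsto_nhds_unique ((hNZ t ω).comp hns.tendsto_atTop) (h1.congr fun i => ?_)
    simp [h2, h3]

section BrownianMotion

variable {d : ℕ}

/-! ### Independence of the past and the increments of Brownian motion -/

/-- Independence of increments is applied along monotone sequences indexed by ℕ. The sorted list of
U is therefore continued constantly after its last element, and `pos` turns comparisons of times
into comparisons of indices. -/
lemma exists_monotone_enumeration {α : Type*} [LinearOrder α] (U : Finset α) {b : α}
    (hb : b ∈ U) (hbot : ∀ a ∈ U, b ≤ a) :
    ∃ (τ : ℕ → α) (pos : α → ℕ), Monotone τ ∧ τ 0 = b ∧ (∀ u ∈ U, τ (pos u) = u) ∧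
      ∀ u ∈ U, ∀ v ∈ U, u ≤ v → pos u ≤ pos v := by
  have hcard : 0 < U.card := Finset.card_pos.2 ⟨b, hb⟩
  set τ : ℕ → α := fun k => U.orderEmbOfFin rfl ⟨min k (U.card - 1), by omega⟩ with hτ
  have hmono : Monotone τ := by
    intro i j hij
    refine (U.orderEmbOfFin rfl).monotone ?_
    simp only [Fin.mk_le_mk]
    omega
  have hex : ∀ u ∈ U, ∃ k, τ k = u := by
    intro u hu
    have : u ∈ Set.range (U.orderEmbOfFin rfl) := by rw [Finset.range_orderEmbOfFin]; exact hu
    obtain ⟨i, hi⟩ := this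
    refine ⟨i, ?_⟩
    rw [← hi]
    simp only [hτ]
    congr 1
    ext
    have := i.2
    simp only
    omega
  choose! pos hpos using hex
  refine ⟨τ, pos, hmono, ?_, hpos, fun u hu v hv huv => ?_⟩
  · refine le_antisymm ?_ (hbot _ (Finset.orderEmbOfFin_mem _ _ _))
    calc τ 0 ≤ τ (pos b) := hmono (Nat.zero_le _)
      _ = b := hpos b hb
  · rcases huv.lt_or_eq with h | h
    · by_contra hlt
      have := hmono (not_le.1 hlt).le
      rw [hpos u hu, hpos v hv] at this
      exact absurd h (not_lt.2 this)
    · rw [h]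

lemma measurable_comap_process {S E : Type*} [MeasurableSpace E] (X : S → Ω → E) (s : S) :
    Measurable[MeasurableSpace.comap (fun ω s => X s ω) inferInstance] (X s) :=
  fun A hA => ⟨(fun x => x s) ⁻¹' A, measurable_pi_apply s hA, rfl⟩

/-- It suffices to treat finitely many times on each side. Together with 0 and t they form a sorted
grid. The past values are sums of grid increments before t, the later differences W s - W t are sums
of grid increments after t, and these two blocks of increments are independent. -/
lemma indepFun_past_increments [IsProbabilityMeasure P] (hT : 0 ≤ T)
    {W : TimeInt T → Ω → EuclideanSpace ℝ (Fin d)} (hW : IsBrownianMotion P W) (t : TimeInt T) :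
    IndepFun (fun ω (s : Set.Iic t) => W s ω) (fun ω (s : Set.Ici t) => W s ω - W t ω) P := by
  refine IndepFun.process_indepFun_process (fun s => hW.measurable s)
    (fun s => (hW.measurable s).sub (hW.measurable t)) fun I J => ?_
  classical
  set z : TimeInt T := ⟨0, le_rfl, hT⟩ with hz
  set U : Finset (TimeInt T) := I.image Subtype.val ∪ J.image Subtype.val ∪ {z, t} with hU
  have hzU : z ∈ U := by simp [hU]
  have htU : t ∈ U := by simp [hU]
  have hIU : ∀ i : I, (i.1.1 : TimeInt T) ∈ U := fun i => by
    simp only [hU, Finset.mem_union, Finset.mem_image]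
    exact Or.inl (Or.inl ⟨i.1, i.2, rfl⟩)
  have hJU : ∀ j : J, (j.1.1 : TimeInt T) ∈ U := fun j => by
    simp only [hU, Finset.mem_union, Finset.mem_image]
    exact Or.inl (Or.inr ⟨j.1, j.2, rfl⟩)
  obtain ⟨τ, pos, hmono, hτ0, hpos, hposmono⟩ :=
    exists_monotone_enumeration U hzU (fun a _ => a.2.1)
  set Δ : ℕ → Ω → EuclideanSpace ℝ (Fin d) := fun k ω => W (τ (k + 1)) ω - W (τ k) ω with hΔ
  have hΔm : ∀ k, Measurable (Δ k) := fun k => (hW.measurable _).sub (hW.measurable _)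
  have hind : iIndepFun Δ P := hW.indep.nat hmono
  set n : ℕ := Finset.univ.sup fun j : J => pos j.1.1 with hn
  have key := hind.indepFun_finset (Finset.range (pos t)) (Finset.Ico (pos t) n)
    (by
      rw [Finset.disjoint_left]
      intro a ha hb
      simp only [Finset.mem_range, Finset.mem_Ico] at ha hb
      omega) hΔm
  have key2 := key.comp
    (φ := fun (x : Finset.range (pos t) → EuclideanSpace ℝ (Fin d)) (i : I) =>
      ∑ k : Finset.range (pos t), if k.1 < pos i.1.1 then x k else 0)
    (ψ := fun (x : Finset.Ico (pos t) n → EuclideanSpace ℝ (Fin d)) (j : J) =>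
      ∑ k : Finset.Ico (pos t) n, if k.1 < pos j.1.1 then x k else 0)
    (measurable_pi_lambda _ fun i => Finset.measurable_sum _ fun k _ => by
      split_ifs
      · exact measurable_pi_apply k
      · exact measurable_const)
    (measurable_pi_lambda _ fun i => Finset.measurable_sum _ fun k _ => by
      split_ifs
      · exact measurable_pi_apply k
      · exact measurable_const)
  refine key2.congr ?_ ?_
  -- The time 0 was put in the grid because W starts at 0, so that W itself, and not only its
  -- differences, is a sum of increments.
  · filter_upwards [hW.init z rfl] with ω hω
    funext i
    simp only [Function.comp]
    rw [Finset.sum_coe_sort (Finset.range (pos t))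
      (fun k => if k < pos i.1.1 then Δ k ω else 0), ← Finset.sum_filter]
    have hle : pos i.1.1 ≤ pos t := hposmono _ (hIU i) _ htU i.1.2
    have : (Finset.range (pos t)).filter (fun k => k < pos i.1.1) = Finset.range (pos i.1.1) := by
      ext k
      simp only [Finset.mem_filter, Finset.mem_range]
      omega
    rw [this, Finset.sum_range_sub (fun k => W (τ k) ω), hτ0, hω, hpos _ (hIU i), sub_zero]
  · refine Eventually.of_forall fun ω => ?_
    funext j
    simp only [Function.comp]
    rw [Finset.sum_coe_sort (Finset.Ico (pos t) n)
      (fun k => if k < pos j.1.1 then Δ k ω else 0), ← Finset.sum_filter]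
    have hle : pos t ≤ pos j.1.1 := hposmono _ htU _ (hJU j) j.1.2
    have hle' : pos j.1.1 ≤ n := Finset.le_sup (f := fun j : J => pos j.1.1) (Finset.mem_univ j)
    have : (Finset.Ico (pos t) n).filter (fun k => k < pos j.1.1) =
        Finset.Ico (pos t) (pos j.1.1) := by
      ext k
      simp only [Finset.mem_filter, Finset.mem_Ico]
      omega
    rw [this, Finset.sum_Ico_eq_sub _ hle, Finset.sum_range_sub (fun k => W (τ k) ω),
      Finset.sum_range_sub (fun k => W (τ k) ω), hpos _ (hJU j), hpos _ htU]
    abel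

/-- The sets that agree almost everywhere with an event of the raw past form a σ-algebra. It
contains the raw past and also the null events, which agree almost everywhere with ∅. -/
lemma augmentedFiltration_le_eventuallyMeasurable (P : Measure Ω)
    {W : TimeInt T → Ω → EuclideanSpace ℝ (Fin d)} (hW : ∀ t, Measurable (W t)) (t : TimeInt T) :
    augmentedFiltration P W hW t ≤ eventuallyMeasurableSpace
      (MeasurableSpace.comap (fun ω (s : Set.Iic t) => W s ω) inferInstance) (ae P) := by
  refine sup_le (iSup₂_le fun s hs => ?_) (MeasurableSpace.generateFrom_le fun A hA => ?_)
  · refine le_trans ?_ le_eventuallyMeasurableSpace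
    rw [← measurable_iff_comap_le]
    exact measurable_comap_process (fun (s : Set.Iic t) => W s) ⟨s, hs⟩
  · exact ⟨∅, @MeasurableSet.empty _ (_), ae_eq_empty.2 hA.2⟩

lemma isNullComplete_augmentedFiltration (P : Measure Ω)
    {W : TimeInt T → Ω → EuclideanSpace ℝ (Fin d)} (hW : ∀ t, Measurable (W t)) :
    IsNullComplete P (augmentedFiltration P W hW) := by
  intro t A hA hA0
  exact (le_sup_right : _ ≤ augmentedFiltration P W hW t) _
    (MeasurableSpace.measurableSet_generateFrom ⟨hA, hA0⟩)

lemma measurable_augmentedFiltration (P : Measure Ω)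
    {W : TimeInt T → Ω → EuclideanSpace ℝ (Fin d)} (hW : ∀ t, Measurable (W t)) {s t : TimeInt T}
    (hst : s ≤ t) : Measurable[augmentedFiltration P W hW t] (W s) := by
  rw [measurable_iff_comap_le]
  exact le_trans (le_iSup₂_of_le s hst le_rfl) le_sup_left

/-- Replacing an event of the augmented σ-algebra by an almost equal event of the raw past changes
no probability, so augmentation preserves independence. -/
lemma indep_increments_augmentedFiltration [IsProbabilityMeasure P] (hT : 0 ≤ T)
    {W : TimeInt T → Ω → EuclideanSpace ℝ (Fin d)} (hW : IsBrownianMotion P W) (t : TimeInt T) :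
    Indep (MeasurableSpace.comap (fun ω (s : Set.Ici t) => W s ω - W t ω) inferInstance)
      (augmentedFiltration P W hW.measurable t) P := by
  have h := (IndepFun_iff_Indep _ _ _).1 (indepFun_past_increments hT hW t)
  rw [Indep_iff] at h ⊢
  intro A B hA hB
  obtain ⟨B', hB', hBB'⟩ := augmentedFiltration_le_eventuallyMeasurable P hW.measurable t B hB
  rw [measure_congr ((EventuallyEq.refl _ A).inter hBB'), measure_congr hBB', Set.inter_comm,
    h B' A hB' hA, mul_comm]

/-! ### The representation property of the Brownian filtration -/

/-- A modification of Brownian motion all of whose paths are continuous. -/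
lemma exists_continuous_modification
    {W : TimeInt T → Ω → EuclideanSpace ℝ (Fin d)} (hW : IsBrownianMotion P W) :
    ∃ V : TimeInt T → Ω → EuclideanSpace ℝ (Fin d), (∀ ω, Continuous fun t => V t ω) ∧
      (∀ s t, s ≤ t → Measurable[augmentedFiltration P W hW.measurable t] (V s)) ∧
      ∀ᵐ ω ∂P, ∀ t, V t ω = W t ω := by
  obtain ⟨B, hsub, hBm, hB0⟩ := exists_measurable_superset_of_null (ae_iff.1 hW.continuous)
  refine ⟨fun t => Bᶜ.indicator (W t), fun ω => ?_, fun s t hst => ?_, ?_⟩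
  · by_cases hω : ω ∈ B
    · simpa [hω] using continuous_const
    · have : Continuous fun t => W t ω := by
        by_contra h
        exact hω (hsub h)
      simpa [hω] using this
  · exact (measurable_augmentedFiltration P hW.measurable hst).indicator
      (isNullComplete_augmentedFiltration P hW.measurable t B hBm hB0).compl
  · have : ∀ᵐ ω ∂P, ω ∉ B := by
      rw [ae_iff]; simpa using hB0
    filter_upwards [this] with ω hω t
    simp [hω]

/-- Each W i splits as W (min t i) + (W (max t i) - W t). The first parts make up α t, known at time
t; the second make up β t, independent of F t. The addition formula gives the conditional
expectation cos α · E[cos β] - sin α · E[sin β], and both expectations are continuous in t by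
dominated convergence. -/
lemma hasContinuousVersion_cos [IsProbabilityMeasure P] (hT : 0 ≤ T)
    {W : TimeInt T → Ω → EuclideanSpace ℝ (Fin d)} (hW : IsBrownianMotion P W)
    (I : Finset (TimeInt T)) (L : StrongDual ℝ (I → EuclideanSpace ℝ (Fin d))) (c : ℝ) :
    HasContinuousVersion P (augmentedFiltration P W hW.measurable)
      (fun ω => Real.cos (L (fun i => W i ω) + c)) := by
  obtain ⟨V, hVc, hVm, hVW⟩ := exists_continuous_modification hW
  set F := augmentedFiltration P W hW.measurable with hF
  have hVm' : ∀ t, Measurable (V t) := fun t => (hVm t t le_rfl).mono (F.le t) le_rfl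
  set α : TimeInt T → Ω → ℝ := fun t ω => L (fun i => V (min t i) ω) + c with hα
  set β : TimeInt T → Ω → ℝ := fun t ω => L (fun i => V (max t i) ω - V t ω) with hβ
  have hαc : ∀ ω, Continuous fun t => α t ω := fun ω => by
    refine (L.continuous.comp (continuous_pi fun i => ?_)).add continuous_const
    exact (hVc ω).comp (continuous_id.min continuous_const)
  have hβc : ∀ ω, Continuous fun t => β t ω := fun ω => by
    refine L.continuous.comp (continuous_pi fun i => ?_)
    exact ((hVc ω).comp (continuous_id.max continuous_const)).sub (hVc ω)
  have hαm : ∀ t, Measurable[F t] (α t) := fun t => by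
    refine Measurable.add_const (L.continuous.measurable.comp ?_) c
    exact @measurable_pi_lambda _ _ _ (F t) _ _ fun i => hVm _ _ (min_le_left _ _)
  have hβm : ∀ t, Measurable (β t) := fun t =>
    L.continuous.measurable.comp (measurable_pi_lambda _ fun i => (hVm' _).sub (hVm' _))
  have hsplit : ∀ t, (fun ω => Real.cos (L (fun i => W i ω) + c)) =ᵐ[P]
      fun ω => Real.cos (α t ω) * Real.cos (β t ω) - Real.sin (α t ω) * Real.sin (β t ω) := by
    intro t
    filter_upwards [hVW] with ω hω
    rw [← Real.cos_add]
    congr 1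
    simp only [hα, hβ]
    rw [add_right_comm, ← map_add]
    congr 2
    funext i
    simp only [Pi.add_apply]
    rcases le_total t i with h | h
    · simp [h, ← hω]
    · simp [h, ← hω]
  have hcond : ∀ (g : ℝ → ℝ), Continuous g → ∀ t,
      P[fun ω => g (β t ω)|F t] =ᵐ[P] fun _ => ∫ ω, g (β t ω) ∂P := by
    intro g hg t
    set β' : Ω → ℝ := fun ω => L (fun i => W (max t i) ω - W t ω) with hβ'
    have hββ' : (fun ω => g (β t ω)) =ᵐ[P] fun ω => g (β' ω) := by
      filter_upwards [hVW] with ω hω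
      simp only [hβ, hβ', hω]
    have hm : Measurable[MeasurableSpace.comap (fun ω (s : Set.Ici t) => W s ω - W t ω)
        inferInstance] β' := by
      refine L.continuous.measurable.comp (@measurable_pi_lambda _ _ _
        (MeasurableSpace.comap (fun ω (s : Set.Ici t) => W s ω - W t ω) inferInstance) _ _
        fun i => ?_)
      exact measurable_comap_process (fun (s : Set.Ici t) ω => W s ω - W t ω)
        ⟨max t i, Set.mem_Ici.2 (le_max_left _ _)⟩
    have hle : MeasurableSpace.comap (fun ω (s : Set.Ici t) => W s ω - W t ω)
        inferInstance ≤ mΩ :=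
      Measurable.comap_le
        (measurable_pi_lambda _ fun s => (hW.measurable s).sub (hW.measurable t))
    have := condExp_indep_eq hle (F.le t) (hg.measurable.comp hm).stronglyMeasurable
      (indep_increments_augmentedFiltration hT hW t)
    rw [integral_congr_ae hββ']
    exact (condExp_congr_ae hββ').trans this
  have hbc : ∀ (g : ℝ → ℝ), Continuous g → (∀ x, |g x| ≤ 1) →
      Continuous fun t => ∫ ω, g (β t ω) ∂P := by
    intro g hg hb
    refine continuous_of_dominated (bound := fun _ => (1 : ℝ))
      (fun t => (hg.measurable.comp (hβm t)).aestronglyMeasurable)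
      (fun t => ae_of_all _ fun ω => hb _) (integrable_const _)
      (ae_of_all _ fun ω => hg.comp (hβc ω))
  have hint : ∀ (g : ℝ → ℝ), Continuous g → (∀ x, |g x| ≤ 1) → ∀ t,
      Integrable (fun ω => g (β t ω)) P := fun g hg hb t =>
    Integrable.of_bound (hg.measurable.comp (hβm t)).aestronglyMeasurable 1
      (ae_of_all _ fun ω => hb _)
  have hprod : ∀ (f g : ℝ → ℝ), Continuous f → (∀ x, |f x| ≤ 1) → Continuous g →
      (∀ x, |g x| ≤ 1) → ∀ t, P[fun ω => f (α t ω) * g (β t ω)|F t] =ᵐ[P]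
        fun ω => f (α t ω) * ∫ ω', g (β t ω') ∂P := by
    intro f g hf hfb hg hgb t
    have h1 := condExp_stronglyMeasurable_mul_of_bound (F.le t)
      (hf.measurable.comp (hαm t)).stronglyMeasurable (hint g hg hgb t) 1
      (ae_of_all P fun ω => hfb (α t ω))
    refine EventuallyEq.trans (by exact h1) ?_
    filter_upwards [hcond g hg t] with ω hω
    simp [hω]
  have hintp : ∀ (f g : ℝ → ℝ), Continuous f → (∀ x, |f x| ≤ 1) → Continuous g →
      (∀ x, |g x| ≤ 1) → ∀ t, Integrable (fun ω => f (α t ω) * g (β t ω)) P := by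
    intro f g hf hfb hg hgb t
    refine (hint g hg hgb t).bdd_mul (c := 1) ?_ (ae_of_all _ fun ω => hfb _)
    exact (hf.measurable.comp ((hαm t).mono (F.le t) le_rfl)).aestronglyMeasurable
  refine ⟨fun t ω => Real.cos (α t ω) * ∫ ω', Real.cos (β t ω') ∂P -
    Real.sin (α t ω) * ∫ ω', Real.sin (β t ω') ∂P, fun ω => ?_, fun t => ?_, fun t => ?_⟩
  · exact ((Real.continuous_cos.comp (hαc ω)).mul
      (hbc _ Real.continuous_cos Real.abs_cos_le_one)).sub
      ((Real.continuous_sin.comp (hαc ω)).mul (hbc _ Real.continuous_sin Real.abs_sin_le_one))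
  · exact (((Real.measurable_cos.comp (hαm t)).mul_const _).sub
      ((Real.measurable_sin.comp (hαm t)).mul_const _)).stronglyMeasurable
  · have h1 := condExp_congr_ae (m := F t) (hsplit t)
    have h2 := condExp_sub
      (hintp _ _ Real.continuous_cos Real.abs_cos_le_one Real.continuous_cos
        Real.abs_cos_le_one t)
      (hintp _ _ Real.continuous_sin Real.abs_sin_le_one Real.continuous_sin
        Real.abs_sin_le_one t) (F t)
    filter_upwards [h1, h2, hprod _ _ Real.continuous_cos Real.abs_cos_le_one
      Real.continuous_cos Real.abs_cos_le_one t, hprod _ _ Real.continuous_sin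
      Real.abs_sin_le_one Real.continuous_sin Real.abs_sin_le_one t] with ω e1 e2 e3 e4
    rw [e1]
    refine Eq.trans ?_ e2.symm
    simp [e3, e4]

/-- An integrable variable which is orthogonal to all trigonometric functions of the Brownian
path has vanishing conditional expectation given the path. -/
lemma condExp_eq_zero_of_orthogonal_cos [IsProbabilityMeasure P]
    {W : TimeInt T → Ω → EuclideanSpace ℝ (Fin d)} (hW : ∀ t, Measurable (W t))
    {q : Ω → ℝ} (hq : Integrable q P)
    (horth : ∀ (I : Finset (TimeInt T)) (L : StrongDual ℝ (I → EuclideanSpace ℝ (Fin d))) (c : ℝ),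
      ∫ ω, q ω * Real.cos (L (fun i => W i ω) + c) ∂P = 0) (t : TimeInt T) :
    P[q|augmentedFiltration P W hW t] =ᵐ[P] 0 := by
  -- With a = 1 and a = -1 the densities are the positive and the negative part of q. If both
  -- measures have the same image under the path map, then q integrates to zero over every event of
  -- the path.
  set μ : ℝ → Measure Ω := fun a => P.withDensity fun ω => ENNReal.ofReal (a * q ω) with hμ
  have hfin : ∀ a, IsFiniteMeasure (μ a) := fun a =>
    isFiniteMeasure_withDensity_ofReal (hq.const_mul a).2
  have hX : Measurable fun ω s => W s ω := measurable_pi_lambda _ hW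
  have hmap : (μ 1).map (fun ω s => W s ω) = (μ (-1)).map (fun ω s => W s ω) := by
    -- Finite measures on path space are determined by their finite-dimensional marginals, and those
    -- by their characteristic functions.
    refine IsProjectiveLimit.unique
      (P := fun I : Finset (TimeInt T) => (μ (-1)).map fun ω (i : I) => W i ω) ?_ ?_
    · intro I
      have hXI : Measurable fun ω (i : I) => W i ω := measurable_pi_lambda _ fun i => hW i
      rw [Measure.map_map (Finset.measurable_restrict I) hX]
      change (μ 1).map (fun ω (i : I) => W i ω) = _
      refine Measure.ext_of_charFunDual ?_
      funext L
      have hform : ∀ a, charFunDual ((μ a).map fun ω (i : I) => W i ω) L =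
          ∫ ω, (ENNReal.ofReal (a * q ω)).toReal •
            Complex.exp (L (fun i => W i ω) * Complex.I) ∂P := by
        intro a
        rw [charFunDual_apply, integral_map hXI.aemeasurable
          (by exact Measurable.aestronglyMeasurable (by fun_prop))]
        exact integral_withDensity_eq_integral_toReal_smul₀
          (hq.1.aemeasurable.const_mul a).ennreal_ofReal (ae_of_all _ fun _ => ENNReal.ofReal_lt_top) _
      have hLm : Measurable fun ω => L (fun i : I => W i ω) := L.continuous.measurable.comp hXI
      have hexpm : Measurable fun ω => Complex.exp (L (fun i : I => W i ω) * Complex.I) := by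
        fun_prop
      have hi : ∀ a, Integrable (fun ω => (ENNReal.ofReal (a * q ω)).toReal •
          Complex.exp (L (fun i : I => W i ω) * Complex.I)) P := by
        intro a
        have h1 : Integrable (fun ω => (ENNReal.ofReal (a * q ω)).toReal) P := by
          simp_rw [ENNReal.toReal_ofReal']
          exact (hq.const_mul a).pos_part
        refine h1.smul_bdd 1 hexpm.aestronglyMeasurable (ae_of_all _ fun ω => ?_)
        rw [Complex.norm_exp_ofReal_mul_I]
      rw [hform, hform, ← sub_eq_zero, ← integral_sub (hi _) (hi _)]
      -- The difference of the characteristic functions is the integral of q exp(iL). Its sine part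
      -- is a cosine with phase -π/2, so orthogonality to cosines with arbitrary phase covers both
      -- parts.
      have h2 : (fun ω => (ENNReal.ofReal (1 * q ω)).toReal •
            Complex.exp (L (fun i : I => W i ω) * Complex.I) -
          (ENNReal.ofReal (-1 * q ω)).toReal •
            Complex.exp (L (fun i : I => W i ω) * Complex.I)) =
          fun ω => ((q ω * Real.cos (L (fun i : I => W i ω) + 0) : ℝ) : ℂ) +
            ((q ω * Real.cos (L (fun i : I => W i ω) + (-(Real.pi / 2))) : ℝ) : ℂ) *
              Complex.I := by
        funext ω
        rw [← sub_smul, ENNReal.toReal_ofReal', ENNReal.toReal_ofReal', one_mul, neg_one_mul,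
          max_zero_sub_max_neg_zero_eq_self, add_zero, ← sub_eq_add_neg, Real.cos_sub_pi_div_two, Complex.exp_mul_I]
        simp only [Complex.real_smul]
        push_cast
        ring
      have hci : ∀ c, Integrable
          (fun ω => ((q ω * Real.cos (L (fun i : I => W i ω) + c) : ℝ) : ℂ)) P := by
        intro c
        refine Integrable.ofReal (hq.mul_bdd (c := 1) ?_ (ae_of_all _ fun ω => ?_))
        · exact Measurable.aestronglyMeasurable (by fun_prop)
        · exact Real.abs_cos_le_one _
      rw [h2, integral_add (hci _) ((hci _).mul_const _), integral_mul_const,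
        integral_complex_ofReal, integral_complex_ofReal, horth, horth]
      simp
    · intro I
      rw [Measure.map_map (Finset.measurable_restrict I) hX]
      rfl
  have hset : ∀ A, MeasurableSet[augmentedFiltration P W hW t] A → ∫ ω in A, q ω ∂P = 0 := by
    intro A hA
    obtain ⟨B, ⟨S, hS, rfl⟩, hAB⟩ := augmentedFiltration_le_eventuallyMeasurable P hW t A hA
    rw [setIntegral_congr_set hAB]
    set B := (fun ω (s : Set.Iic t) => W s ω) ⁻¹' S with hB
    have hBm : MeasurableSet B := (measurable_pi_lambda _ fun s => hW _) hS
    have hBe : B = (fun ω s => W s ω) ⁻¹'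
        ((fun (x : TimeInt T → EuclideanSpace ℝ (Fin d)) (s : Set.Iic t) => x s) ⁻¹' S) := rfl
    have hSm : MeasurableSet
        ((fun (x : TimeInt T → EuclideanSpace ℝ (Fin d)) (s : Set.Iic t) => x s) ⁻¹' S) :=
      (measurable_pi_lambda _ fun s => measurable_pi_apply _) hS
    have hμB : μ 1 B = μ (-1) B := by
      rw [hBe, ← Measure.map_apply hX hSm, hmap, Measure.map_apply hX hSm]
    rw [integral_eq_lintegral_pos_part_sub_lintegral_neg_part hq.integrableOn]
    simp only [hμ, withDensity_apply _ hBm, one_mul, neg_one_mul] at hμB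
    rw [hμB, sub_self]
  symm
  refine ae_eq_condExp_of_forall_setIntegral_eq ((augmentedFiltration P W hW).le t) hq
    (fun s _ _ => (integrable_zero Ω ℝ P).integrableOn) (fun A hA _ => ?_) ?_
  · rw [hset A hA]; simp
  · exact stronglyMeasurable_zero.aestronglyMeasurable

/-- Every square integrable martingale of the Brownian filtration has a continuous version. -/
theorem hasContinuousVersion_of_memLp_two [IsProbabilityMeasure P] (hT : 0 < T)
    {W : TimeInt T → Ω → EuclideanSpace ℝ (Fin d)} (hW : IsBrownianMotion P W)
    {η : Ω → ℝ} (hη : MemLp η 2 P) :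
    HasContinuousVersion P (augmentedFiltration P W hW.measurable) η := by
  set F := augmentedFiltration P W hW.measurable with hF
  have hi : ∀ q : Lp ℝ 2 P, Integrable q P := fun q =>
    (Lp.memLp q).integrable (by norm_num)
  let G : Submodule ℝ (Lp ℝ 2 P) :=
    { carrier := {q | HasContinuousVersion P F q}
      add_mem' := fun {a b} ha hb =>
        (HasContinuousVersion.add ha hb (hi a) (hi b)).congr (Lp.coeFn_add a b).symm
      zero_mem' := ⟨fun _ _ => 0, fun _ => continuous_const, fun _ => stronglyMeasurable_const,
        fun t => by
          refine EventuallyEq.trans ?_ (condExp_congr_ae (Lp.coeFn_zero ℝ 2 P)).symm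
          rw [condExp_zero]; rfl⟩
      smul_mem' := fun c q hq =>
        (HasContinuousVersion.smul hq c).congr (Lp.coeFn_smul c q).symm }
  have hclosed : IsClosed (G : Set (Lp ℝ 2 P)) := by
    refine isClosed_of_closure_subset fun x hx => ?_
    -- L² distance dominates L¹ distance under a probability measure, so this is the rate required
    -- by `HasContinuousVersion.of_tendsto`.
    have : ∀ n : ℕ, ∃ y ∈ (G : Set (Lp ℝ 2 P)), dist x y < (1 / 4) ^ n := fun n =>
      Metric.mem_closure_iff.1 hx _ (by positivity)
    choose y hyG hy using this
    refine HasContinuousVersion.of_tendsto hT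
      (isNullComplete_augmentedFiltration P hW.measurable) (hi x) (fun n => hi (y n)) hyG
      fun n => ?_
    have h1 : ∫ ω, |y n ω - x ω| ∂P = (eLpNorm (⇑(y n) - ⇑x) 1 P).toReal := by
      have := integral_norm_eq_lintegral_enorm ((hi (y n)).sub (hi x)).1
      rw [eLpNorm_one_eq_lintegral_enorm]
      exact this
    have h2 : eLpNorm (⇑(y n) - ⇑x) 1 P ≤ eLpNorm (⇑(y n) - ⇑x) 2 P :=
      eLpNorm_le_eLpNorm_of_exponent_le (by norm_num) ((hi (y n)).sub (hi x)).1
    rw [h1]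
    refine le_trans (ENNReal.toReal_mono ?_ h2) ?_
    · exact ((Lp.memLp (y n)).sub (Lp.memLp x)).2.ne
    · rw [← Lp.dist_def, dist_comm]
      exact (hy n).le
  have hcos : ∀ (I : Finset (TimeInt T)) (L : StrongDual ℝ (I → EuclideanSpace ℝ (Fin d))) (c : ℝ),
      MemLp (fun ω => Real.cos (L (fun i => W i ω) + c)) 2 P := fun I L c => by
    have hXI : Measurable fun ω (i : I) => W i ω := measurable_pi_lambda _ fun i => hW.measurable i
    have hLm : Measurable fun ω => L (fun i : I => W i ω) := L.continuous.measurable.comp hXI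
    refine MemLp.of_bound (Real.measurable_cos.comp (hLm.add_const c)).aestronglyMeasurable 1
      (ae_of_all _ fun ω => ?_)
    exact Real.abs_cos_le_one _
  have hbot : Gᗮ = ⊥ := by
    rw [eq_bot_iff]
    intro q hq
    have horth : ∀ (I : Finset (TimeInt T)) (L : StrongDual ℝ (I → EuclideanSpace ℝ (Fin d)))
        (c : ℝ), ∫ ω, q ω * Real.cos (L (fun i => W i ω) + c) ∂P = 0 := by
      intro I L c
      have hmem : (hcos I L c).toLp _ ∈ G :=
        (hasContinuousVersion_cos hT.le hW I L c).congr (MemLp.coeFn_toLp _).symm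
      have h0 := (Submodule.mem_orthogonal G q).1 hq _ hmem
      rw [L2.inner_def] at h0
      rw [← h0]
      refine integral_congr_ae ?_
      filter_upwards [(hcos I L c).coeFn_toLp] with ω hω
      rw [hω]
      simp
    -- All conditional expectations of q vanish, so the zero process is a continuous version. Thus q
    -- lies in G as well as in its orthogonal complement, even though q need not be a function of
    -- the Brownian path.
    have hqG : q ∈ G := ⟨fun _ _ => 0, fun _ => continuous_const,
      fun _ => stronglyMeasurable_const,
      fun t => (condExp_eq_zero_of_orthogonal_cos hW.measurable (hi q) horth t).symm⟩
    have := Submodule.inner_left_of_mem_orthogonal hqG hq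
    rw [Submodule.mem_bot]
    exact inner_self_eq_zero.1 this
  have hcomplete : CompleteSpace G := hclosed.completeSpace_coe
  have htop : G = ⊤ := (Submodule.orthogonal_eq_bot_iff).1 hbot
  have : hη.toLp η ∈ G := htop ▸ Submodule.mem_top
  exact HasContinuousVersion.congr this hη.coeFn_toLp

/-- The conditional expectations of a bounded variable have a version which is continuous and
bounded everywhere. -/
theorem exists_bounded_continuous_version [IsProbabilityMeasure P] (hT : 0 < T)
    {W : TimeInt T → Ω → EuclideanSpace ℝ (Fin d)} (hW : IsBrownianMotion P W)
    {η : Ω → ℝ} (hη : Measurable η) {C : ℝ} (hC : ∀ ω, |η ω| ≤ C) :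
    ∃ N : TimeInt T → Ω → ℝ, (∀ ω, Continuous fun t => N t ω) ∧ (∀ t ω, |N t ω| ≤ C) ∧
      (∀ t, Measurable[augmentedFiltration P W hW.measurable t] (N t)) ∧
      ∀ t, N t =ᵐ[P] P[η|augmentedFiltration P W hW.measurable t] := by
  have hmem : MemLp η 2 P := MemLp.of_bound hη.aestronglyMeasurable C (ae_of_all _ hC)
  obtain ⟨N, h1, h2, h3⟩ := hasContinuousVersion_of_memLp_two hT hW hmem
  have hne : Nonempty Ω := nonempty_of_isProbabilityMeasure P
  have hC0 : 0 ≤ C := (abs_nonneg _).trans (hC hne.some)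
  -- Truncation at ±C makes the bound hold everywhere; it changes nothing almost surely, because
  -- conditional expectations inherit the bound C.
  refine ⟨fun t ω => max (-C) (min (N t ω) C), fun ω => ?_, fun t ω => ?_, fun t => ?_,
    fun t => ?_⟩
  · exact continuous_const.max ((h1 ω).min continuous_const)
  · rw [abs_le]
    exact ⟨le_max_left _ _, max_le (by linarith) (min_le_right _ _)⟩
  · exact measurable_const.max ((h2 t).measurable.min measurable_const)
  · have h4 := ae_bdd_abs_condExp_of_ae_bdd_abs
      (m := augmentedFiltration P W hW.measurable t) (ae_of_all P hC)
    filter_upwards [h3 t, h4] with ω e1 e2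
    rw [e1]
    have := abs_le.1 e2
    rw [min_eq_left this.2, max_eq_right this.1]

end BrownianMotion

/-! ### Lebesgue measure on the time interval -/

lemma map_val_leb (T : ℝ) :
    (leb T).map (Subtype.val : TimeInt T → ℝ) = volume.restrict (Set.Icc 0 T) :=
  map_comap_subtype_coe measurableSet_Icc _

instance isFiniteMeasure_leb (T : ℝ) : IsFiniteMeasure (leb T) := by
  constructor
  have h : leb T Set.univ = (leb T).map (Subtype.val : TimeInt T → ℝ) Set.univ := by
    rw [Measure.map_apply measurable_subtype_coe MeasurableSet.univ, Set.preimage_univ]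
  rw [h, map_val_leb]
  simp

/-- The bridge to calculus on ℝ: a path on [0, T] is extended by its end values through
`Set.projIcc`. -/
lemma setIntegral_leb {E : Type*} [NormedAddCommGroup E] [NormedSpace ℝ E] (hT : 0 ≤ T)
    (f : TimeInt T → E) {s t : TimeInt T} (hst : s ≤ t) :
    ∫ u in Set.Ioc s t, f u ∂(leb T) = ∫ u in (s : ℝ)..t, f (Set.projIcc 0 T hT u) := by
  have hpre : Set.Ioc s t = (Subtype.val : TimeInt T → ℝ) ⁻¹' Set.Ioc (s : ℝ) t := by
    ext u; simp
  have h := (MeasurableEmbedding.subtype_coe (measurableSet_Icc (a := (0 : ℝ)) (b := T))).setIntegral_map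
    (μ := leb T) (fun u => f (Set.projIcc 0 T hT u)) (Set.Ioc (s : ℝ) t)
  have hint : Set.Ioc (s : ℝ) t ∩ Set.Icc 0 T = Set.Ioc (s : ℝ) t :=
    Set.inter_eq_left.2 fun u hu => ⟨s.2.1.trans hu.1.le, hu.2.trans t.2.2⟩
  rw [map_val_leb, Measure.restrict_restrict measurableSet_Ioc,
    hint] at h
  rw [intervalIntegral.integral_of_le hst, h, hpre]
  simp only [Set.projIcc_val]

/-! ### The optional σ-algebra -/

lemma measurable_optionalSigma_of_continuous {F : Filtration (TimeInt T) mΩ}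
    {X : TimeInt T → Ω → ℝ} (hc : ∀ ω, Continuous fun t => X t ω)
    (hm : ∀ t, Measurable[F t] (X t)) :
    Measurable[optionalSigma F] fun p : TimeInt T × Ω => X p.1 p.2 := by
  have hcad : IsCadlag X := fun ω t => ⟨(hc ω).continuousWithinAt, X t ω,
    ((hc ω).tendsto t).mono_left nhdsWithin_le_nhds⟩
  rw [measurable_iff_comap_le]
  exact le_iSup (fun X : {X : TimeInt T → Ω → ℝ // Adapted F X ∧ IsCadlag X} =>
    MeasurableSpace.comap (fun p : TimeInt T × Ω => X.1 p.1 p.2) inferInstance) ⟨X, hm, hcad⟩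

lemma measurable_prodMk_optionalSigma (F : Filtration (TimeInt T) mΩ) (t : TimeInt T) :
    Measurable[F t, optionalSigma F] fun ω => (t, ω) := by
  rw [measurable_iff_le_map]
  refine iSup_le fun X => ?_
  rintro _ ⟨S, hS, rfl⟩
  exact X.2.1 t hS

/-- A right-continuous path is the limit of its values at grid points approaching from the right.
Capping these points at t keeps every approximation measurable with respect to F t in ω, and each
takes its times from a countable set. -/
lemma measurable_min_of_cadlag (hT : 0 ≤ T) {F : Filtration (TimeInt T) mΩ}
    {X : TimeInt T → Ω → ℝ} (hX : Adapted F X) (hc : IsCadlag X) (t : TimeInt T) :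
    Measurable[Prod.instMeasurableSpace (m₂ := F t)]
      fun p : TimeInt T × Ω => X (min p.1 t) p.2 := by
  let _ : MeasurableSpace Ω := F t
  set ρ : ℕ → ℕ → TimeInt T := fun n k =>
    min (Set.projIcc 0 T hT (((k : ℝ) + 1) / ((n : ℝ) + 1))) t with hρ
  -- The +1 after the floor places the grid point to the right of s, so right-continuity alone
  -- suffices.
  have hlim : ∀ s : TimeInt T,
      Tendsto (fun n : ℕ => ρ n ⌊(s : ℝ) * ((n : ℝ) + 1)⌋₊) atTop (𝓝[≥] (min s t)) := by
    intro s
    have hn : Tendsto (fun n : ℕ => (n : ℝ) + 1) atTop atTop :=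
      tendsto_atTop_add_const_right _ _ tendsto_natCast_atTop_atTop
    have h1 : Tendsto (fun n : ℕ => ((⌊(s : ℝ) * ((n : ℝ) + 1)⌋₊ : ℝ) + 1) / ((n : ℝ) + 1))
        atTop (𝓝 (s : ℝ)) := by
      have := ((tendsto_nat_floor_mul_div_atTop s.2.1).comp hn).add
        (tendsto_inv_atTop_zero.comp hn)
      simpa [add_div, Function.comp_def] using this
    refine tendsto_nhdsWithin_of_tendsto_nhds_of_eventually_within _ ?_
      (Eventually.of_forall fun n => ?_)
    · have h2 := ((continuous_projIcc (h := hT)).tendsto (s : ℝ)).comp h1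
      rw [Set.projIcc_val] at h2
      exact h2.min tendsto_const_nhds
    · refine Set.mem_Ici.2 (min_le_min ?_ le_rfl)
      have : s = Set.projIcc 0 T hT s := (Set.projIcc_val hT s).symm
      conv_lhs => rw [this]
      refine Set.monotone_projIcc hT ?_
      rw [le_div_iff₀ (by positivity)]
      exact (Nat.lt_floor_add_one _).le
  have hle : ∀ n k, ρ n k ≤ t := fun n k => min_le_right _ _
  clear_value ρ
  refine measurable_of_tendsto_metrizable
    (f := fun (n : ℕ) (p : TimeInt T × Ω) => X (ρ n ⌊(p.1 : ℝ) * ((n : ℝ) + 1)⌋₊) p.2)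
    (fun n => ?_) (tendsto_pi_nhds.2 fun p => ?_)
  · have h1 : Measurable fun q : ℕ × Ω => X (ρ n q.1) q.2 :=
      measurable_from_prod_countable_right fun k =>
        Measurable.mono (hX (ρ n k)) (F.mono (hle n k)) le_rfl
    have h2 : Measurable fun s : TimeInt T => ⌊(s : ℝ) * ((n : ℝ) + 1)⌋₊ :=
      Nat.measurable_floor.comp (measurable_subtype_coe.mul_const _)
    have h3 : Measurable fun p : TimeInt T × Ω => (⌊(p.1 : ℝ) * ((n : ℝ) + 1)⌋₊, p.2) :=
      (h2.comp measurable_fst).prodMk measurable_snd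
    have h4 := h1.comp h3
    simpa only [Function.comp_def] using h4
  · exact ((hc p.2 (min p.1 t)).1.tendsto).comp (hlim p.1)

/-- Optional processes are progressively measurable. -/
lemma measurable_min_optionalSigma (hT : 0 ≤ T) (F : Filtration (TimeInt T) mΩ) (t : TimeInt T) :
    Measurable[Prod.instMeasurableSpace (m₂ := F t), optionalSigma F]
      fun p : TimeInt T × Ω => (min p.1 t, p.2) := by
  rw [measurable_iff_le_map]
  refine iSup_le fun X => ?_
  rintro _ ⟨S, hS, rfl⟩
  exact measurable_min_of_cadlag hT X.2.1 X.2.2 t hS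

lemma optionalSigma_le_prod (hT : 0 ≤ T) (F : Filtration (TimeInt T) mΩ) :
    optionalSigma F ≤ Prod.instMeasurableSpace := by
  intro S hS
  have h := measurable_min_optionalSigma hT F ⟨T, hT, le_rfl⟩ hS
  have he : (fun p : TimeInt T × Ω => (min p.1 ⟨T, hT, le_rfl⟩, p.2)) = id := by
    funext p
    exact Prod.ext (min_eq_left p.1.2.2) rfl
  rw [he] at h
  exact (sup_le_sup_left (MeasurableSpace.comap_mono (F.le _)) _ :
    Prod.instMeasurableSpace (m₂ := F ⟨T, hT, le_rfl⟩) ≤ Prod.instMeasurableSpace) _ h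

/-- On (s, t] the process may be stopped at t. By progressive measurability the stopped integrand is
jointly measurable for F t, and the integral inherits this. -/
lemma measurable_setIntegral_of_optional (hT : 0 ≤ T) {F : Filtration (TimeInt T) mΩ}
    {X : TimeInt T → Ω → ℝ} (hX : Measurable[optionalSigma F] fun p : TimeInt T × Ω => X p.1 p.2)
    (s t : TimeInt T) : Measurable[F t] fun ω => ∫ u in Set.Ioc s t, X u ω ∂(leb T) := by
  let _ : MeasurableSpace Ω := F t
  have h1 : Measurable fun p : TimeInt T × Ω => X (min p.1 t) p.2 :=
    hX.comp (measurable_min_optionalSigma hT F t)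
  have h2 : StronglyMeasurable fun ω => ∫ u in Set.Ioc s t, X (min u t) ω ∂(leb T) :=
    StronglyMeasurable.integral_prod_right (f := fun ω u => X (min u t) ω)
      (h1.comp measurable_swap).stronglyMeasurable
  refine (congrArg Measurable (funext fun ω => ?_)).mpr h2.measurable
  refine setIntegral_congr_fun measurableSet_Ioc fun u hu => ?_
  simp only [min_eq_left hu.2]

/-! ### Vector-valued processes -/

section Vector

variable {ι κ : Type*} [Fintype ι] [Fintype κ]

lemma isOptional_iff {F : Filtration (TimeInt T) mΩ}
    {X : TimeInt T → Ω → EuclideanSpace ℝ ι} :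
    IsOptional F X ↔ ∀ i, Measurable[optionalSigma F] fun p : TimeInt T × Ω => X p.1 p.2 i := by
  let _ : MeasurableSpace (TimeInt T × Ω) := optionalSigma F
  constructor
  · intro h i
    exact (EuclideanSpace.proj i : EuclideanSpace ℝ ι →L[ℝ] ℝ).continuous.measurable.comp h
  · intro h
    exact (WithLp.measurable_toLp 2 _).comp (measurable_pi_iff.2 h)

lemma IsOptional.clm {F : Filtration (TimeInt T) mΩ}
    {X : TimeInt T → Ω → EuclideanSpace ℝ ι} (hX : IsOptional F X)
    (A : EuclideanSpace ℝ ι →L[ℝ] EuclideanSpace ℝ κ) :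
    IsOptional F fun t ω => A (X t ω) :=
  A.continuous.measurable.comp hX

lemma IsOptional.add {F : Filtration (TimeInt T) mΩ}
    {X Y : TimeInt T → Ω → EuclideanSpace ℝ ι} (hX : IsOptional F X) (hY : IsOptional F Y) :
    IsOptional F fun t ω => X t ω + Y t ω :=
  Measurable.add hX hY

lemma IsOptional.measurable (hT : 0 ≤ T) {F : Filtration (TimeInt T) mΩ}
    {X : TimeInt T → Ω → EuclideanSpace ℝ ι} (hX : IsOptional F X) :
    Measurable fun p : TimeInt T × Ω => X p.1 p.2 :=
  Measurable.mono hX (optionalSigma_le_prod hT F) le_rfl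

/-- The working form of the class: a single constant replaces the nested essential suprema. -/
lemma memHInf_iff {F : Filtration (TimeInt T) mΩ} {X : TimeInt T → Ω → EuclideanSpace ℝ ι} :
    MemHInf P F X ↔ IsOptional F X ∧
      ∃ C : ℝ, 0 ≤ C ∧ ∀ᵐ ω ∂P, ∀ᵐ t ∂(leb T), ‖X t ω‖ ≤ C := by
  constructor
  · rintro ⟨h1, h2⟩
    refine ⟨h1, (essSup (fun ω => essSup (fun t => ‖X t ω‖ₑ) (leb T)) P).toReal,
      ENNReal.toReal_nonneg, ?_⟩
    filter_upwards [ENNReal.ae_le_essSup fun ω => essSup (fun t => ‖X t ω‖ₑ) (leb T)] with ω hω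
    filter_upwards [ENNReal.ae_le_essSup fun t => ‖X t ω‖ₑ] with t ht
    have := ENNReal.toReal_mono h2.ne (ht.trans hω)
    simpa using this
  · rintro ⟨h1, C, -, h2⟩
    refine ⟨h1, lt_of_le_of_lt (essSup_le_of_ae_le (ENNReal.ofReal C) ?_) ENNReal.ofReal_lt_top⟩
    filter_upwards [h2] with ω hω
    refine essSup_le_of_ae_le (ENNReal.ofReal C) ?_
    filter_upwards [hω] with t ht
    rw [← ofReal_norm]
    exact ENNReal.ofReal_le_ofReal ht

lemma MemHInf.clm {F : Filtration (TimeInt T) mΩ} {X : TimeInt T → Ω → EuclideanSpace ℝ ι}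
    (hX : MemHInf P F X) (A : EuclideanSpace ℝ ι →L[ℝ] EuclideanSpace ℝ κ) :
    MemHInf P F fun t ω => A (X t ω) := by
  obtain ⟨h1, C, hC, h2⟩ := memHInf_iff.1 hX
  refine memHInf_iff.2 ⟨h1.clm A, ‖A‖ * C, by positivity, ?_⟩
  filter_upwards [h2] with ω hω
  filter_upwards [hω] with t ht
  exact (A.le_opNorm _).trans (by gcongr)

lemma MemHInf.lin {F : Filtration (TimeInt T) mΩ} {X : TimeInt T → Ω → EuclideanSpace ℝ ι}
    (hX : MemHInf P F X) (A : EuclideanSpace ℝ ι →ₗ[ℝ] EuclideanSpace ℝ κ) :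
    MemHInf P F fun t ω => A (X t ω) :=
  hX.clm (LinearMap.toContinuousLinearMap A)

lemma MemHInf.add {F : Filtration (TimeInt T) mΩ} {X Y : TimeInt T → Ω → EuclideanSpace ℝ ι}
    (hX : MemHInf P F X) (hY : MemHInf P F Y) : MemHInf P F fun t ω => X t ω + Y t ω := by
  obtain ⟨h1, C, hC, h2⟩ := memHInf_iff.1 hX
  obtain ⟨h1', C', hC', h2'⟩ := memHInf_iff.1 hY
  refine memHInf_iff.2 ⟨h1.add h1', C + C', by positivity, ?_⟩
  filter_upwards [h2, h2'] with ω hω hω'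
  filter_upwards [hω, hω'] with t ht ht'
  exact (norm_add_le _ _).trans (add_le_add ht ht')

lemma MemHInf.smul {F : Filtration (TimeInt T) mΩ} {X : TimeInt T → Ω → EuclideanSpace ℝ ι}
    (hX : MemHInf P F X) (c : ℝ) : MemHInf P F fun t ω => c • X t ω :=
  hX.clm (c • ContinuousLinearMap.id ℝ _)

lemma MemHInf.sub {F : Filtration (TimeInt T) mΩ} {X Y : TimeInt T → Ω → EuclideanSpace ℝ ι}
    (hX : MemHInf P F X) (hY : MemHInf P F Y) : MemHInf P F fun t ω => X t ω - Y t ω := by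
  simpa [sub_eq_add_neg] using hX.add (hY.smul (-1))

lemma memHInf_zero (F : Filtration (TimeInt T) mΩ) :
    MemHInf P F fun _ _ => (0 : EuclideanSpace ℝ ι) :=
  memHInf_iff.2 ⟨measurable_const, 0, le_rfl, by simp⟩

lemma MemHInf.sum {α : Type*} {F : Filtration (TimeInt T) mΩ} (s : Finset α)
    {X : α → TimeInt T → Ω → EuclideanSpace ℝ ι} (hX : ∀ i ∈ s, MemHInf P F (X i)) :
    MemHInf P F fun t ω => ∑ i ∈ s, X i t ω := by
  classical
  induction s using Finset.induction_on with
  | empty => simpa using memHInf_zero F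
  | insert a s ha ih =>
    simp only [Finset.sum_insert ha]
    exact (hX a (by simp)).add (ih fun i hi => hX i (by simp [hi]))

lemma MemHInf.memH2 [IsProbabilityMeasure P] {F : Filtration (TimeInt T) mΩ}
    {X : TimeInt T → Ω → EuclideanSpace ℝ ι} (hX : MemHInf P F X) : MemH2 P F X := by
  obtain ⟨h1, C, hC, h2⟩ := memHInf_iff.1 hX
  refine ⟨h1, ?_⟩
  have hb : ∀ᵐ ω ∂P, ∫⁻ t, ‖X t ω‖ₑ ^ 2 ∂(leb T) ≤ ENNReal.ofReal C ^ 2 * leb T Set.univ := by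
    filter_upwards [h2] with ω hω
    calc ∫⁻ t, ‖X t ω‖ₑ ^ 2 ∂(leb T) ≤ ∫⁻ _, ENNReal.ofReal C ^ 2 ∂(leb T) := by
          refine lintegral_mono_ae ?_
          filter_upwards [hω] with t ht
          gcongr
          rw [← ofReal_norm]
          exact ENNReal.ofReal_le_ofReal ht
      _ = _ := by rw [lintegral_const]
  refine lt_of_le_of_lt (lintegral_mono_ae hb) ?_
  rw [lintegral_const, measure_univ (μ := P), mul_one]
  exact ENNReal.mul_lt_top (by simp) (measure_lt_top _ _)

lemma MemHInf.ae_integrable (hT : 0 ≤ T) {F : Filtration (TimeInt T) mΩ}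
    {X : TimeInt T → Ω → EuclideanSpace ℝ ι} (hX : MemHInf P F X) :
    ∀ᵐ ω ∂P, Integrable (fun t => X t ω) (leb T) := by
  obtain ⟨h1, C, hC, h2⟩ := memHInf_iff.1 hX
  filter_upwards [h2] with ω hω
  exact Integrable.of_bound
    ((h1.measurable hT).comp measurable_prodMk_right).aestronglyMeasurable C hω

lemma MemH2.memLp_prod (hT : 0 ≤ T) {F : Filtration (TimeInt T) mΩ}
    {X : TimeInt T → Ω → EuclideanSpace ℝ ι} (hX : MemH2 P F X) :
    MemLp (fun p : Ω × TimeInt T => X p.2 p.1) 2 (P.prod (leb T)) := by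
  have hm : Measurable fun p : Ω × TimeInt T => X p.2 p.1 :=
    (hX.optional.measurable hT).comp measurable_swap
  refine ⟨hm.aestronglyMeasurable, ?_⟩
  rw [eLpNorm_lt_top_iff_lintegral_rpow_enorm_lt_top two_ne_zero ENNReal.ofNat_ne_top]
  rw [lintegral_prod _ (hm.enorm.pow_const _).aemeasurable]
  simpa using hX.finite

lemma MemH2.integrable_prod [IsProbabilityMeasure P] (hT : 0 ≤ T) {F : Filtration (TimeInt T) mΩ}
    {X : TimeInt T → Ω → EuclideanSpace ℝ ι} (hX : MemH2 P F X) :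
    Integrable (fun p : Ω × TimeInt T => X p.2 p.1) (P.prod (leb T)) :=
  (hX.memLp_prod hT).integrable (by norm_num)

lemma MemH2.ae_integrable [IsProbabilityMeasure P] (hT : 0 ≤ T) {F : Filtration (TimeInt T) mΩ}
    {X : TimeInt T → Ω → EuclideanSpace ℝ ι} (hX : MemH2 P F X) :
    ∀ᵐ ω ∂P, Integrable (fun t => X t ω) (leb T) :=
  (hX.integrable_prod hT).prod_right_ae

/-- Processes with bounded rates are bounded. -/
lemma HasRate.memHInf (hT : 0 ≤ T) {F : Filtration (TimeInt T) mΩ}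
    {X V : TimeInt T → Ω → EuclideanSpace ℝ ι} (hX : IsOptional F X) (h : HasRate P X V)
    (hV : MemHInf P F V) : MemHInf P F X := by
  obtain ⟨h1, C, hC, h2⟩ := memHInf_iff.1 hV
  refine memHInf_iff.2 ⟨hX, C * (leb T).real Set.univ, by positivity, ?_⟩
  filter_upwards [h2, h.dynamics, h.init] with ω hω hd hi
  refine Eventually.of_forall fun t => ?_
  have h3 := hd ⟨0, le_rfl, hT⟩ t t.2.1
  rw [hi ⟨0, le_rfl, hT⟩ rfl, sub_zero] at h3
  rw [h3]
  calc ‖∫ u in Set.Ioc _ t, V u ω ∂(leb T)‖ ≤ C * (leb T).real (Set.Ioc ⟨0, le_rfl, hT⟩ t) :=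
        norm_setIntegral_le_of_norm_le_const_ae (measure_lt_top _ _) (ae_restrict_of_ae hω)
    _ ≤ _ := by gcongr; exact measure_ne_top _ _; exact Set.subset_univ _

end Vector

/-! ### The scalar linear system along a path -/

/-- A positive solution of `h'' = r h' + k h` with `h'(T) = 0`. -/
lemma exists_pos_solution (r T : ℝ) {k : ℝ} (hk : 0 < k) :
    ∃ h h' : ℝ → ℝ, (∀ t, HasDerivAt h (h' t) t) ∧
      (∀ t, HasDerivAt h' (r * h' t + k * h t) t) ∧ (∀ t, 0 < h t) ∧ h' T = 0 := by
  set s := Real.sqrt (r ^ 2 + 4 * k) with hs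
  have hs2 : s ^ 2 = r ^ 2 + 4 * k := Real.sq_sqrt (by positivity)
  have hsr : |r| < s := by
    rw [← Real.sqrt_sq_eq_abs]
    exact Real.sqrt_lt_sqrt (sq_nonneg r) (by linarith)
  obtain ⟨hr1, hr2⟩ := abs_lt.1 hsr
  set a := (r + s) / 2 with ha
  set b := (r - s) / 2 with hb
  have ha0 : 0 < a := by rw [ha]; linarith
  have hb0 : b < 0 := by rw [hb]; linarith
  have ha2 : a * a = r * a + k := by rw [ha]; nlinarith
  have hb2 : b * b = r * b + k := by rw [hb]; nlinarith
  have hexp : ∀ c t : ℝ, HasDerivAt (fun t => Real.exp (c * (t - T)))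
      (c * Real.exp (c * (t - T))) t := by
    intro c t
    have : HasDerivAt (fun t => c * (t - T)) (c * 1) t :=
      ((hasDerivAt_id t).sub_const T).const_mul c
    simpa [mul_comm] using this.exp
  -- The roots of z² = r z + k satisfy b < 0 < a because k > 0. The weights a and -b are positive,
  -- and they make the derivative at T equal to ab - ba = 0.
  refine ⟨fun t => a * Real.exp (b * (t - T)) - b * Real.exp (a * (t - T)),
    fun t => a * (b * Real.exp (b * (t - T))) - b * (a * Real.exp (a * (t - T))),
    fun t => ((hexp b t).const_mul a).sub ((hexp a t).const_mul b), fun t => ?_, fun t => ?_, ?_⟩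
  · have := (((hexp b t).const_mul b).const_mul a).sub (((hexp a t).const_mul a).const_mul b)
    convert! this using 1
    linear_combination (-a * Real.exp (b * (t - T))) * hb2 + b * Real.exp (a * (t - T)) * ha2
  · have h1 := Real.exp_pos (b * (t - T))
    have h2 := Real.exp_pos (a * (t - T))
    nlinarith
  · simp; ring

section Path

variable {r k : ℝ} {h h' : ℝ → ℝ}

lemma hasDerivAt_exp_div (hh : ∀ t, HasDerivAt h (h' t) t) (hpos : ∀ t, 0 < h t) (t : ℝ) :
    HasDerivAt (fun t => Real.exp (r * t) / h t)
      (r * (Real.exp (r * t) / h t) - Real.exp (r * t) / h t * (h' t / h t)) t := by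
  have h1 : HasDerivAt (fun t => Real.exp (r * t)) (Real.exp (r * t) * (r * 1)) t :=
    ((hasDerivAt_id t).const_mul r).exp
  convert! h1.div (hh t) (hpos t).ne' using 1
  have := (hpos t).ne'
  field_simp

/-- Integration by parts when g is merely integrable: its primitive is absolutely continuous with
derivative g almost everywhere. -/
lemma mul_primitive_sub_mul_primitive {p p' g : ℝ → ℝ} (hp : ∀ t, HasDerivAt p (p' t) t)
    (hp' : Continuous p') (hg : ∀ a b, IntervalIntegrable g volume a b) (s t : ℝ) :
    p t * (∫ u in (0 : ℝ)..t, g u) - p s * (∫ u in (0 : ℝ)..s, g u) =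
      ∫ u in s..t, (p' u * (∫ v in (0 : ℝ)..u, g v) + p u * g u) := by
  have hpd : deriv p = p' := funext fun t => (hp t).deriv
  have hC1 : ContDiff ℝ 1 p :=
    contDiff_one_iff_deriv.2 ⟨fun t => (hp t).differentiableAt, hpd ▸ hp'⟩
  have hpac : AbsolutelyContinuousOnInterval p s t :=
    hC1.contDiffOn.absolutelyContinuousOnInterval
  have hGac : AbsolutelyContinuousOnInterval (fun u => ∫ v in (0 : ℝ)..u, g v) s t := by
    have h1 : AbsolutelyContinuousOnInterval (fun u => ∫ v in s..u, g v) s t :=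
      (hg s t).absolutelyContinuousOnInterval_intervalIntegral (by simp)
    have h2 : AbsolutelyContinuousOnInterval (fun _ : ℝ => ∫ v in (0 : ℝ)..s, g v) s t :=
      (contDiff_const (n := 1)).contDiffOn.absolutelyContinuousOnInterval
    have h3 := h2.add h1
    convert! h3 using 1
    funext u
    exact (intervalIntegral.integral_add_adjacent_intervals (hg 0 s) (hg s u)).symm
  rw [← hpac.integral_deriv_mul_eq_sub hGac]
  refine intervalIntegral.integral_congr_ae ?_
  have h1 := (hg s t).ae_hasDerivAt_integral
  filter_upwards [h1] with u hu hu'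
  have h2 := hu (Set.uIoc_subset_uIcc hu') s (by simp)
  have h3 : HasDerivAt (fun u => ∫ v in (0 : ℝ)..u, g v) (g u) u := by
    have h4 := h2.const_add (∫ v in (0 : ℝ)..s, g v)
    convert! h4 using 1
    funext u
    exact (intervalIntegral.integral_add_adjacent_intervals (hg 0 s) (hg s u)).symm
  rw [hpd, h3.deriv]

/-- The explicit solution of the scalar system along a path `n` of the driving martingale. -/
lemma path_solution (hh : ∀ t, HasDerivAt h (h' t) t)
    (hh' : ∀ t, HasDerivAt h' (r * h' t + k * h t) t) (hpos : ∀ t, 0 < h t)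
    {n ξ I c y : ℝ → ℝ} (hn : Continuous n) (hξ : ∀ a b, IntervalIntegrable ξ volume a b)
    (hI : ∀ t, I t = ∫ u in (0 : ℝ)..t, (k * Real.exp (-(r * u)) * h u) * ξ u)
    (hc : ∀ t, c t = Real.exp (r * t) / h t * (n t - I t))
    (hy : ∀ t, y t = ∫ u in (0 : ℝ)..t, c u / h u) :
    (∀ s t, h t * y t - h s * y s = ∫ u in s..t, (h' u * y u + c u)) ∧
    ∀ s t, (h' t * y t + c t) - (h' s * y s + c s) =
      (Real.exp (r * t) / h t * n t - Real.exp (r * s) / h s * n s -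
        ∫ u in s..t, (r * (Real.exp (r * u) / h u) -
          Real.exp (r * u) / h u * (h' u / h u)) * n u) +
      ∫ u in s..t, (k * (h u * y u - ξ u) + r * (h' u * y u + c u)) := by
  have hhc : Continuous h := continuous_iff_continuousAt.2 fun t => (hh t).continuousAt
  have hhc' : Continuous h' := continuous_iff_continuousAt.2 fun t => (hh' t).continuousAt
  have hne : ∀ t, h t ≠ 0 := fun t => (hpos t).ne'
  have hgξ : ∀ a b, IntervalIntegrable (fun u => (k * Real.exp (-(r * u)) * h u) * ξ u)
      volume a b := fun a b => (hξ a b).continuousOn_mul (by fun_prop)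
  have hIc : Continuous I := by
    have : I = fun t => ∫ u in (0 : ℝ)..t, (k * Real.exp (-(r * u)) * h u) * ξ u := funext hI
    rw [this]
    exact intervalIntegral.continuous_primitive hgξ 0
  set p : ℝ → ℝ := fun t => Real.exp (r * t) / h t with hp
  set p' : ℝ → ℝ := fun t => r * p t - p t * (h' t / h t) with hp'
  have hpd : ∀ t, HasDerivAt p (p' t) t := hasDerivAt_exp_div hh hpos
  have hpc : Continuous p := continuous_iff_continuousAt.2 fun t => (hpd t).continuousAt
  have hpc' : Continuous p' := by
    simp only [hp']
    exact (continuous_const.mul hpc).sub (hpc.mul (hhc'.div hhc hne))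
  have hcc : Continuous c := by
    have : c = fun t => p t * (n t - I t) := funext hc
    rw [this]
    exact hpc.mul (hn.sub hIc)
  have hch : Continuous fun u => c u / h u := hcc.div hhc hne
  have hyd : ∀ t, HasDerivAt y (c t / h t) t := fun t => by
    have : y = fun t => ∫ u in (0 : ℝ)..t, c u / h u := funext hy
    rw [this]
    exact hch.integral_hasStrictDerivAt 0 t |>.hasDerivAt
  have hyc : Continuous y := continuous_iff_continuousAt.2 fun t => (hyd t).continuousAt
  refine ⟨fun s t => ?_, fun s t => ?_⟩
  · rw [intervalIntegral.integral_eq_sub_of_hasDerivAt (f := fun u => h u * y u)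
      (f' := fun u => h' u * y u + c u)
      (fun u _ => ?_) (((hhc'.mul hyc).add hcc).intervalIntegrable _ _)]
    convert! (hh u).mul (hyd u) using 1
    have := hne u
    field_simp
  -- The second-order equation for h produces the terms k h y + r h' y of the required drift.
  · have e1 : h' t * y t - h' s * y s =
        ∫ u in s..t, ((r * h' u + k * h u) * y u + h' u * (c u / h u)) := by
      rw [intervalIntegral.integral_eq_sub_of_hasDerivAt (f := fun u => h' u * y u)
        (fun u _ => (hh' u).mul (hyd u)) (Continuous.intervalIntegrable (by fun_prop) _ _)]
    have e2 := mul_primitive_sub_mul_primitive hpd hpc' hgξ s t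
    simp only [← hI] at e2
    have i1 : IntervalIntegrable (fun u => (r * h' u + k * h u) * y u + h' u * (c u / h u))
        volume s t := Continuous.intervalIntegrable (by fun_prop) _ _
    have i2 : IntervalIntegrable (fun u => p' u * n u) volume s t :=
      Continuous.intervalIntegrable (by fun_prop) _ _
    have i3 : IntervalIntegrable (fun u => p' u * I u + p u *
        ((k * Real.exp (-(r * u)) * h u) * ξ u)) volume s t :=
      (Continuous.intervalIntegrable (by fun_prop) _ _).add
        ((hgξ s t).continuousOn_mul hpc.continuousOn)
    -- The pointwise identity rests on p' (n - I) = r c - c h'/h, which cancels the extra term h'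
    -- c/h, and on p · k e^(-ru) h = k, which restores the undiscounted target.
    have e3 : (∫ u in s..t, (k * (h u * y u - ξ u) + r * (h' u * y u + c u))) =
        (∫ u in s..t, ((r * h' u + k * h u) * y u + h' u * (c u / h u))) +
        (∫ u in s..t, p' u * n u) -
        ∫ u in s..t, (p' u * I u + p u * ((k * Real.exp (-(r * u)) * h u) * ξ u)) := by
      rw [← intervalIntegral.integral_add i1 i2, ← intervalIntegral.integral_sub (i1.add i2) i3]
      refine intervalIntegral.integral_congr fun u _ => ?_
      simp only [hc u, hp', hp]
      have := hne u
      rw [Real.exp_neg]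
      have := Real.exp_ne_zero (r * u)
      field_simp
      ring
    rw [e3, ← e1, ← e2, hc t, hc s]
    ring

end Path

/-! ### Regular processes -/

/-- Adapted processes which are continuous and bounded everywhere. -/
structure IsRegular (F : Filtration (TimeInt T) mΩ) (X : TimeInt T → Ω → ℝ) : Prop where
  continuous : ∀ ω, Continuous fun t => X t ω
  measurable : ∀ t, Measurable[F t] (X t)
  bounded : ∃ C, ∀ t ω, |X t ω| ≤ C

namespace IsRegular

variable {F : Filtration (TimeInt T) mΩ} {X Y : TimeInt T → Ω → ℝ}

lemma optional (hX : IsRegular F X) :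
    Measurable[optionalSigma F] fun p : TimeInt T × Ω => X p.1 p.2 :=
  measurable_optionalSigma_of_continuous hX.continuous hX.measurable

lemma add (hX : IsRegular F X) (hY : IsRegular F Y) : IsRegular F fun t ω => X t ω + Y t ω := by
  obtain ⟨C, hC⟩ := hX.bounded
  obtain ⟨D, hD⟩ := hY.bounded
  exact ⟨fun ω => (hX.continuous ω).add (hY.continuous ω),
    fun t => (hX.measurable t).add (hY.measurable t),
    C + D, fun t ω => (abs_add_le _ _).trans (add_le_add (hC t ω) (hD t ω))⟩

lemma mul (hX : IsRegular F X) (hY : IsRegular F Y) : IsRegular F fun t ω => X t ω * Y t ω := by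
  obtain ⟨C, hC⟩ := hX.bounded
  obtain ⟨D, hD⟩ := hY.bounded
  refine ⟨fun ω => (hX.continuous ω).mul (hY.continuous ω),
    fun t => (hX.measurable t).mul (hY.measurable t), C * D, fun t ω => ?_⟩
  rw [abs_mul]
  exact mul_le_mul (hC t ω) (hD t ω) (abs_nonneg _) ((abs_nonneg _).trans (hC t ω))

lemma deterministic (F : Filtration (TimeInt T) mΩ) {f : ℝ → ℝ} (hf : Continuous f) :
    IsRegular F fun t _ => f t := by
  have hc : Continuous fun t : TimeInt T => f t := hf.comp continuous_subtype_val
  obtain ⟨C, hC⟩ := isCompact_univ.exists_bound_of_continuousOn hc.continuousOn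
  exact ⟨fun _ => hc, fun _ => measurable_const, C, fun t _ => hC t (Set.mem_univ t)⟩

lemma sub (hX : IsRegular F X) (hY : IsRegular F Y) : IsRegular F fun t ω => X t ω - Y t ω := by
  have := hX.add ((deterministic F (continuous_const (y := (-1 : ℝ)))).mul hY)
  simpa [sub_eq_add_neg] using this

end IsRegular

lemma intervalIntegrable_path (hT : 0 ≤ T) {F : Filtration (TimeInt T) mΩ}
    {X : TimeInt T → Ω → ℝ} (hX : Measurable[optionalSigma F] fun p : TimeInt T × Ω => X p.1 p.2)
    {C : ℝ} (hC : ∀ t ω, |X t ω| ≤ C) (ω : Ω) (a b : ℝ) :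
    IntervalIntegrable (fun u => X (Set.projIcc 0 T hT u) ω) volume a b := by
  have hm : Measurable fun u => X (Set.projIcc 0 T hT u) ω :=
    ((hX.mono (optionalSigma_le_prod hT F) le_rfl).comp measurable_prodMk_right).comp
      (continuous_projIcc (h := hT)).measurable
  exact (intervalIntegrable_const (c := C)).mono_fun hm.aestronglyMeasurable
    (ae_of_all _ fun u => (hC _ ω).trans (le_abs_self C))

lemma isRegular_primitive (hT : 0 ≤ T) {F : Filtration (TimeInt T) mΩ}
    {X : TimeInt T → Ω → ℝ} (hX : Measurable[optionalSigma F] fun p : TimeInt T × Ω => X p.1 p.2)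
    {C : ℝ} (hC : ∀ t ω, |X t ω| ≤ C) :
    IsRegular F fun t ω => ∫ u in (0 : ℝ)..t, X (Set.projIcc 0 T hT u) ω := by
  refine ⟨fun ω => ?_, fun t => ?_, C * T, fun t ω => ?_⟩
  · exact (intervalIntegral.continuous_primitive
      (fun a b => intervalIntegrable_path hT hX hC ω a b) 0).comp continuous_subtype_val
  · have h := measurable_setIntegral_of_optional hT hX ⟨0, le_rfl, hT⟩ t
    refine (congrArg (Measurable[F t]) (funext fun ω => ?_)).mpr h
    exact (setIntegral_leb hT (fun u => X u ω) (s := ⟨0, le_rfl, hT⟩) t.2.1).symm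
  · have h1 := intervalIntegral.norm_integral_le_of_norm_le_const (a := (0 : ℝ)) (b := t)
      (f := fun u => X (Set.projIcc 0 T hT u) ω) (C := C) fun u _ => hC _ ω
    rw [sub_zero, abs_of_nonneg t.2.1] at h1
    refine h1.trans ?_
    have hC0 : 0 ≤ C := (abs_nonneg _).trans (hC t ω)
    exact mul_le_mul_of_nonneg_left t.2.2 hC0

lemma IsRegular.primitive (hT : 0 ≤ T) {F : Filtration (TimeInt T) mΩ} {X : TimeInt T → Ω → ℝ}
    (hX : IsRegular F X) : IsRegular F fun t ω => ∫ u in (0 : ℝ)..t, X (Set.projIcc 0 T hT u) ω :=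
  let ⟨_, hC⟩ := hX.bounded
  isRegular_primitive hT hX.optional hC

lemma IsRegular.integrable_prod [IsFiniteMeasure P] (hT : 0 ≤ T) {F : Filtration (TimeInt T) mΩ}
    {X : TimeInt T → Ω → ℝ} (hX : IsRegular F X) :
    Integrable (fun p : Ω × TimeInt T => X p.2 p.1) (P.prod (leb T)) := by
  obtain ⟨C, hC⟩ := hX.bounded
  have hm : Measurable fun p : Ω × TimeInt T => X p.2 p.1 :=
    (hX.optional.mono (optionalSigma_le_prod hT F) le_rfl).comp measurable_swap
  exact Integrable.of_bound hm.aestronglyMeasurable C (ae_of_all _ fun p => hC _ _)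

lemma IsRegular.integrable [IsFiniteMeasure P] {F : Filtration (TimeInt T) mΩ}
    {X : TimeInt T → Ω → ℝ} (hX : IsRegular F X) (t : TimeInt T) : Integrable (X t) P := by
  obtain ⟨C, hC⟩ := hX.bounded
  exact Integrable.of_bound ((hX.measurable t).mono (F.le t) le_rfl).aestronglyMeasurable C
    (ae_of_all _ fun ω => hC t ω)

lemma martingale_of_setIntegral_sub [IsProbabilityMeasure P] {F : Filtration (TimeInt T) mΩ}
    {M : TimeInt T → Ω → ℝ} (hm : ∀ t, Measurable[F t] (M t)) (hi : ∀ t, Integrable (M t) P)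
    (h : ∀ s t, s ≤ t → ∀ A, MeasurableSet[F s] A → ∫ ω in A, (M t ω - M s ω) ∂P = 0) :
    Martingale M F P := by
  refine ⟨fun t => (hm t).stronglyMeasurable, fun s t hst => ?_⟩
  symm
  refine ae_eq_condExp_of_forall_setIntegral_eq (F.le s) (hi t)
    (fun A _ _ => (hi s).integrableOn) (fun A hA _ => ?_)
    (hm s).stronglyMeasurable.aestronglyMeasurable
  have := h s t hst A hA
  rw [integral_sub (hi t).integrableOn (hi s).integrableOn] at this
  linarith

/-- The integral of a deterministic function of class `C¹` against a regular martingale, defined by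
integration by parts, is a martingale. -/
lemma martingale_mul_sub_primitive [IsProbabilityMeasure P] (hT : 0 ≤ T)
    {F : Filtration (TimeInt T) mΩ} {N : TimeInt T → Ω → ℝ} (hN : IsRegular F N)
    (hmart : Martingale N F P) {p p' : ℝ → ℝ} (hp : ∀ t, HasDerivAt p (p' t) t)
    (hp' : Continuous p') :
    Martingale (fun (t : TimeInt T) ω => p t * N t ω -
      ∫ u in (0 : ℝ)..t, p' (Set.projIcc 0 T hT u) * N (Set.projIcc 0 T hT u) ω) F P := by
  have hpc : Continuous p := continuous_iff_continuousAt.2 fun t => (hp t).continuousAt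
  have hpN := (IsRegular.deterministic F hpc).mul hN
  have hpN' := (IsRegular.deterministic F hp').mul hN
  have hM := hpN.sub (hpN'.primitive hT)
  refine martingale_of_setIntegral_sub hM.measurable hM.integrable fun s t hst A hA => ?_
  have hAm : MeasurableSet A := F.le s A hA
  have hNA : ∀ u, s ≤ u → ∫ ω in A, N u ω ∂P = ∫ ω in A, N s ω ∂P := fun u hu =>
    (hmart.setIntegral_eq hu hA).symm
  obtain ⟨C, hC⟩ := hpN'.bounded
  have hd : ∀ ω, (p t * N t ω -
        ∫ u in (0 : ℝ)..t, p' (Set.projIcc 0 T hT u) * N (Set.projIcc 0 T hT u) ω) -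
      (p s * N s ω -
        ∫ u in (0 : ℝ)..s, p' (Set.projIcc 0 T hT u) * N (Set.projIcc 0 T hT u) ω) =
      (p t * N t ω - p s * N s ω) - ∫ u in Set.Ioc s t, p' u * N u ω ∂(leb T) := by
    intro ω
    rw [setIntegral_leb hT (fun u : TimeInt T => p' u * N u ω) hst,
      ← intervalIntegral.integral_interval_sub_left
        (intervalIntegrable_path hT hpN'.optional hC ω 0 t)
        (intervalIntegrable_path hT hpN'.optional hC ω 0 s)]
    ring
  simp only [hd]
  have hprod : Integrable (fun q : Ω × TimeInt T => p' q.2 * N q.2 q.1)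
      ((P.restrict A).prod ((leb T).restrict (Set.Ioc s t))) := by
    rw [Measure.prod_restrict]
    exact (hpN'.integrable_prod (P := P) hT).integrableOn
  have i1 : Integrable (fun ω => p t * N t ω) (P.restrict A) := (hpN.integrable t).integrableOn
  have i2 : Integrable (fun ω => p s * N s ω) (P.restrict A) := (hpN.integrable s).integrableOn
  have i12 : Integrable (fun ω => p t * N t ω - p s * N s ω) (P.restrict A) := i1.sub i2
  have i3 : Integrable (fun ω => ∫ u in Set.Ioc s t, p' u * N u ω ∂(leb T)) (P.restrict A) :=
    hprod.integral_prod_left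
  rw [integral_sub i12 i3, integral_sub i1 i2,
    integral_integral_swap (f := fun ω (u : TimeInt T) => p' u * N u ω) hprod]
  simp only [integral_const_mul]
  -- By the martingale property N u may be replaced by N s under the integral over A. The correction
  -- then integrates to (p t - p s) ∫_A N s and cancels the increment of p N.
  have e1 : ∫ u in Set.Ioc s t, p' u * ∫ ω in A, N u ω ∂P ∂(leb T) =
      ∫ u in Set.Ioc s t, p' u * ∫ ω in A, N s ω ∂P ∂(leb T) :=
    setIntegral_congr_fun measurableSet_Ioc fun u hu => by simp only [hNA u hu.1.le]
  have e2 : ∫ u in Set.Ioc s t, p' u ∂(leb T) = p t - p s := by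
    rw [setIntegral_leb hT (fun u : TimeInt T => p' u) hst,
      ← intervalIntegral.integral_eq_sub_of_hasDerivAt (fun u _ => hp u)
        (hp'.intervalIntegrable _ _)]
    refine intervalIntegral.integral_congr fun u hu => ?_
    rw [Set.uIcc_of_le (show (s : ℝ) ≤ t from hst)] at hu
    simp only [Set.projIcc_of_mem hT ⟨s.2.1.trans hu.1, hu.2.trans t.2.2⟩]
  rw [e1, integral_mul_const, e2, hNA t hst]
  ring

/-- The scalar linear forward-backward system with bounded target has a regular solution. -/
theorem exists_scalar_solution [IsProbabilityMeasure P] (hT : 0 < T) {d : ℕ}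
    {W : TimeInt T → Ω → EuclideanSpace ℝ (Fin d)} (hW : IsBrownianMotion P W)
    (r : ℝ) {k : ℝ} (hk : 0 < k) {F : Filtration (TimeInt T) mΩ}
    (hF : F = augmentedFiltration P W hW.measurable) {ξ : TimeInt T → Ω → ℝ}
    (hξ : Measurable[optionalSigma F] fun p : TimeInt T × Ω => ξ p.1 p.2)
    {C : ℝ} (hC : ∀ t ω, |ξ t ω| ≤ C) :
    ∃ x v m : TimeInt T → Ω → ℝ, IsRegular F x ∧ IsRegular F v ∧ IsRegular F m ∧
      Martingale m F P ∧
      (∀ ω s t, s ≤ t → x t ω - x s ω = ∫ u in Set.Ioc s t, v u ω ∂(leb T)) ∧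
      (∀ ω (t : TimeInt T), (t : ℝ) = 0 → x t ω = 0) ∧
      (∀ ω s t, s ≤ t → v t ω - v s ω = (m t ω - m s ω) +
        ∫ u in Set.Ioc s t, (k * (x u ω - ξ u ω) + r * v u ω) ∂(leb T)) ∧
      ∀ᵐ ω ∂P, ∀ t : TimeInt T, (t : ℝ) = T → v t ω = 0 := by
  obtain ⟨h, h', hh, hh', hpos, hhT⟩ := exists_pos_solution r T hk
  have hhc : Continuous h := continuous_iff_continuousAt.2 fun t => (hh t).continuousAt
  have hhc' : Continuous h' := continuous_iff_continuousAt.2 fun t => (hh' t).continuousAt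
  have hne : ∀ t, h t ≠ 0 := fun t => (hpos t).ne'
  set π : ℝ → TimeInt T := Set.projIcc 0 T hT.le with hπ
  have hπe : ∀ {u : ℝ}, u ∈ Set.Icc 0 T → (π u : ℝ) = u := fun hu => by
    rw [hπ, Set.projIcc_of_mem hT.le hu]
  have hπv : ∀ u : TimeInt T, π u = u := fun u => Set.projIcc_val hT.le u
  set g : ℝ → ℝ := fun u => k * Real.exp (-(r * u)) * h u with hg
  have hgc : Continuous g := by fun_prop
  -- the accumulated discounted target
  have hgreg := IsRegular.deterministic F hgc
  obtain ⟨D, hD⟩ := hgreg.bounded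
  set I : TimeInt T → Ω → ℝ := fun t ω => ∫ u in (0 : ℝ)..t, g (π u) * ξ (π u) ω with hI
  have hIreg : IsRegular F I := by
    refine isRegular_primitive hT.le (X := fun u ω => g u * ξ u ω) (C := D * C)
      (hgreg.optional.mul hξ) fun t ω => ?_
    rw [abs_mul]
    exact mul_le_mul (hD t ω) (hC t ω) (abs_nonneg _) ((abs_nonneg _).trans (hD t ω))
  set top : TimeInt T := ⟨T, hT.le, le_rfl⟩ with htop
  obtain ⟨CI, hCI⟩ := hIreg.bounded
  -- This is the only use of the Brownian filtration: a continuous version of E[I(T) | F(t)],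
  -- bounded for every ω.
  obtain ⟨N, hNc, hNb, hNm, hNe⟩ := exists_bounded_continuous_version hT hW
    ((hIreg.measurable top).mono (F.le _) le_rfl) (fun ω => hCI top ω)
  rw [← hF] at hNm hNe
  have hNreg : IsRegular F N := ⟨hNc, hNm, CI, hNb⟩
  have hNmart : Martingale N F P :=
    martingale_of_ae_eq_condExp (fun t => (hNm t).stronglyMeasurable) hNe
  set p : ℝ → ℝ := fun t => Real.exp (r * t) / h t with hp
  set p' : ℝ → ℝ := fun t => r * p t - p t * (h' t / h t) with hp'
  have hpd : ∀ t, HasDerivAt p (p' t) t := hasDerivAt_exp_div hh hpos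
  have hpc : Continuous p := continuous_iff_continuousAt.2 fun t => (hpd t).continuousAt
  have hpc' : Continuous p' := by
    simp only [hp']
    exact (continuous_const.mul hpc).sub (hpc.mul (hhc'.div hhc hne))
  -- The part of the rate left after the feedback (h'/h) x: the discounted expected remaining
  -- target, which vanishes at T.
  set c : TimeInt T → Ω → ℝ := fun t ω => p t * (N t ω - I t ω) with hc
  have hcreg : IsRegular F c := (IsRegular.deterministic F hpc).mul (hNreg.sub hIreg)
  set y : TimeInt T → Ω → ℝ := fun t ω => ∫ u in (0 : ℝ)..t, (h (π u))⁻¹ * c (π u) ω with hy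
  have hyreg : IsRegular F y :=
    ((IsRegular.deterministic F (hhc.inv₀ hne)).mul hcreg).primitive hT.le
  set x : TimeInt T → Ω → ℝ := fun t ω => h t * y t ω with hx
  set v : TimeInt T → Ω → ℝ := fun t ω => h' t * y t ω + c t ω with hv
  -- The stochastic integral of p against N, written by parts up to an additive constant at time 0.
  set m : TimeInt T → Ω → ℝ := fun t ω => p t * N t ω -
    ∫ u in (0 : ℝ)..t, p' (π u) * N (π u) ω with hm
  have hmreg : IsRegular F m := ((IsRegular.deterministic F hpc).mul hNreg).sub
    (((IsRegular.deterministic F hpc').mul hNreg).primitive hT.le)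
  -- the paths solve the deterministic system
  have hpath := fun ω => path_solution (r := r) (k := k) hh hh' hpos (n := fun u => N (π u) ω)
    (ξ := fun u => ξ (π u) ω)
    (I := fun t => ∫ u in (0 : ℝ)..t, (k * Real.exp (-(r * u)) * h u) * ξ (π u) ω)
    (c := fun t => Real.exp (r * t) / h t *
      (N (π t) ω - ∫ u in (0 : ℝ)..t, (k * Real.exp (-(r * u)) * h u) * ξ (π u) ω))
    (y := fun t => ∫ s in (0 : ℝ)..t, (Real.exp (r * s) / h s *
      (N (π s) ω - ∫ u in (0 : ℝ)..s, (k * Real.exp (-(r * u)) * h u) * ξ (π u) ω)) / h s)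
    ((hNc ω).comp continuous_projIcc) (fun a b => intervalIntegrable_path hT.le hξ hC ω a b)
    (fun _ => rfl) (fun _ => rfl) (fun _ => rfl)
  -- `path_solution` works on all of ℝ with unclamped coefficients, whereas the processes live on
  -- [0, T]; these identities match the two on [0, T].
  have hIe : ∀ ω, ∀ t ∈ Set.Icc 0 T,
      I (π t) ω = ∫ u in (0 : ℝ)..t, (k * Real.exp (-(r * u)) * h u) * ξ (π u) ω := by
    intro ω t ht
    simp only [hI]
    rw [hπe ht]
    refine intervalIntegral.integral_congr fun u hu => ?_
    rw [Set.uIcc_of_le ht.1] at hu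
    simp only [hg, hπe ⟨hu.1, hu.2.trans ht.2⟩]
  have hce : ∀ ω, ∀ t ∈ Set.Icc 0 T, c (π t) ω = Real.exp (r * t) / h t *
      (N (π t) ω - ∫ u in (0 : ℝ)..t, (k * Real.exp (-(r * u)) * h u) * ξ (π u) ω) := by
    intro ω t ht
    simp only [hc, hp]
    rw [hIe ω t ht, hπe ht]
  have hye : ∀ ω, ∀ t ∈ Set.Icc 0 T, y (π t) ω = ∫ s in (0 : ℝ)..t, (Real.exp (r * s) / h s *
      (N (π s) ω - ∫ u in (0 : ℝ)..s, (k * Real.exp (-(r * u)) * h u) * ξ (π u) ω)) / h s := by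
    intro ω t ht
    simp only [hy]
    rw [hπe ht]
    refine intervalIntegral.integral_congr fun u hu => ?_
    rw [Set.uIcc_of_le ht.1] at hu
    have hu' : u ∈ Set.Icc 0 T := ⟨hu.1, hu.2.trans ht.2⟩
    rw [hce ω u hu', hπe hu', inv_mul_eq_div]
  have hsub : ∀ {s t : TimeInt T}, s ≤ t → ∀ u ∈ Set.uIcc (s : ℝ) t, u ∈ Set.Icc 0 T := by
    intro s t hst u hu
    rw [Set.uIcc_of_le (show (s : ℝ) ≤ t from hst)] at hu
    exact ⟨s.2.1.trans hu.1, hu.2.trans t.2.2⟩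
  refine ⟨x, v, m, (IsRegular.deterministic F hhc).mul hyreg,
    ((IsRegular.deterministic F hhc').mul hyreg).add hcreg, hmreg,
    martingale_mul_sub_primitive hT.le hNreg hNmart hpd hpc', fun ω s t hst => ?_,
    fun ω t ht => ?_, fun ω s t hst => ?_, ?_⟩
  · have h1 := (hpath ω).1 s t
    rw [setIntegral_leb hT.le _ hst]
    simp only [hx, hv]
    rw [← hye ω t t.2, ← hye ω s s.2, hπv, hπv] at h1
    rw [h1]
    refine intervalIntegral.integral_congr fun u hu => ?_
    have hu' := hsub hst u hu
    change _ = h' (π u) * y (π u) ω + c (π u) ω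
    rw [hye ω u hu', hce ω u hu', hπe hu']
  · simp only [hx, hy, ht, intervalIntegral.integral_same, mul_zero]
  · have h1 := (hpath ω).2 s t
    have e1 := hye ω t t.2
    have e2 := hye ω s s.2
    have e3 := hce ω t t.2
    have e4 := hce ω s s.2
    rw [← e1, ← e2, ← e3, ← e4, hπv, hπv] at h1
    have hpN' := (IsRegular.deterministic F hpc').mul hNreg
    obtain ⟨B, hB⟩ := hpN'.bounded
    have e5 : m t ω - m s ω = p t * N t ω - p s * N s ω -
        ∫ u in (s : ℝ)..t, p' u * N (π u) ω := by
      have e6 : ∫ u in (s : ℝ)..t, p' u * N (π u) ω =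
          ∫ u in (s : ℝ)..t, p' (π u) * N (π u) ω :=
        intervalIntegral.integral_congr fun u hu => by simp only [hπe (hsub hst u hu)]
      rw [e6, ← intervalIntegral.integral_interval_sub_left
        (intervalIntegrable_path hT.le hpN'.optional hB ω 0 t)
        (intervalIntegrable_path hT.le hpN'.optional hB ω 0 s)]
      simp only [hm]
      ring
    rw [e5, setIntegral_leb hT.le _ hst]
    refine h1.trans ?_
    congr 1
    refine intervalIntegral.integral_congr fun u hu => ?_
    have hu' := hsub hst u hu
    change _ = k * (h (π u) * y (π u) ω - ξ (π u) ω) + r * (h' (π u) * y (π u) ω + c (π u) ω)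
    rw [hye ω u hu', hce ω u hu', hπe hu']
  -- I(T) is known at time T, so N(T) = I(T) and c(T) = 0 almost surely; the other summand of v(T)
  -- vanishes because h'(T) = 0.
  · have e1 : P[I top|F top] = I top :=
      condExp_of_stronglyMeasurable (F.le top) (hIreg.measurable top).stronglyMeasurable
        (hIreg.integrable top)
    filter_upwards [hNe top] with ω hω t ht
    have : t = top := Subtype.ext ht
    subst this
    rw [e1] at hω
    simp only [hv, hc, hω, sub_self, mul_zero, add_zero]
    rw [ht, hhT, zero_mul]

/-! ### Uniqueness for the scalar linear system -/

lemma integrableOn_projIcc_of_integrable_leb {E : Type*} [NormedAddCommGroup E] (hT : 0 ≤ T)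
    {f : TimeInt T → E} (hf : Integrable f (leb T)) :
    IntegrableOn (fun u => f (Set.projIcc 0 T hT u)) (Set.Icc 0 T) := by
  rw [IntegrableOn, ← map_val_leb,
    (MeasurableEmbedding.subtype_coe measurableSet_Icc).integrable_map_iff]
  simpa [Function.comp_def] using hf

lemma ae_leb_iff (hT : 0 ≤ T) {p : TimeInt T → Prop} :
    (∀ᵐ t ∂(leb T), p t) ↔
      ∀ᵐ u ∂(volume.restrict (Set.Icc 0 T)), p (Set.projIcc 0 T hT u) := by
  rw [← map_val_leb, (MeasurableEmbedding.subtype_coe measurableSet_Icc).ae_map_iff]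
  simp

/-- Since g and h solve the same second-order equation, their Wronskian h f - h' g grows exactly
like e^(ru). It vanishes at b, where f and h' do, hence also at a. Initially f is only integrable;
the integral equations make first g and then f continuous. -/
lemma backward_ode {r k a b : ℝ} {h h' f g : ℝ → ℝ} (hh : ∀ t, HasDerivAt h (h' t) t)
    (hh' : ∀ t, HasDerivAt h' (r * h' t + k * h t) t) (hb : h' b = 0) (hab : a ≤ b)
    (hf : IntervalIntegrable f volume a b)
    (hg1 : ∀ u ∈ Set.Icc a b, g u - g a = ∫ w in a..u, f w)
    (hf1 : ∀ u ∈ Set.Icc a b, f u - f a = ∫ w in a..u, (k * g w + r * f w))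
    (hfb : f b = 0) : h a * f a = h' a * g a := by
  have hfI : IntegrableOn f (Set.uIcc a b) := by
    rw [Set.uIcc_of_le hab]
    exact (intervalIntegrable_iff_integrableOn_Icc_of_le hab).1 hf
  have hgc : ContinuousOn g (Set.Icc a b) := by
    have h1 := intervalIntegral.continuousOn_primitive_interval hfI
    rw [Set.uIcc_of_le hab] at h1
    refine (continuousOn_const.add h1 : ContinuousOn (fun u => g a + ∫ w in a..u, f w) _).congr
      fun u hu => ?_
    simp only [Pi.add_apply, ← hg1 u hu]; ring
  have hkI : IntegrableOn (fun w => k * g w + r * f w) (Set.uIcc a b) := by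
    rw [Set.uIcc_of_le hab] at hfI ⊢
    exact ((hgc.integrableOn_Icc).const_mul k).add (hfI.const_mul r)
  have hfc : ContinuousOn f (Set.Icc a b) := by
    have h1 := intervalIntegral.continuousOn_primitive_interval hkI
    rw [Set.uIcc_of_le hab] at h1
    refine (continuousOn_const.add h1 :
      ContinuousOn (fun u => f a + ∫ w in a..u, (k * g w + r * f w)) _).congr fun u hu => ?_
    simp only [Pi.add_apply, ← hf1 u hu]; ring
  have hderiv : ∀ (φ : ℝ → ℝ), ContinuousOn φ (Set.Icc a b) → ∀ u ∈ Set.Ico a b,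
      HasDerivWithinAt (fun u => ∫ w in a..u, φ w) (φ u) (Set.Ici u) u := by
    intro φ hφ u hu
    have h1 : IntervalIntegrable φ volume a u :=
      (hφ.mono (Set.Icc_subset_Icc_right hu.2.le)).intervalIntegrable_of_Icc hu.1
    have hnhds : Set.Icc a b ∈ 𝓝[>] u :=
      mem_of_superset (Ioc_mem_nhdsGT hu.2) fun w hw => ⟨hu.1.trans hw.1.le, hw.2⟩
    have hnhds' : Set.Icc a b ∈ 𝓝[≥] u :=
      mem_of_superset (Icc_mem_nhdsGE hu.2) fun w hw => ⟨hu.1.trans hw.1, hw.2⟩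
    refine intervalIntegral.integral_hasDerivWithinAt_right h1 (t := Set.Ioi u) ?_ ?_
    · exact ⟨Set.Icc a b, hnhds, hφ.aestronglyMeasurable measurableSet_Icc⟩
    · exact ((hφ u ⟨hu.1, hu.2.le⟩).mono_of_mem_nhdsWithin hnhds)
  have hcong : ∀ (φ ψ : ℝ → ℝ) (c : ℝ), (∀ u ∈ Set.Icc a b, ψ u - ψ a = ∫ w in a..u, φ w) →
      ContinuousOn φ (Set.Icc a b) → ∀ u ∈ Set.Ico a b,
      HasDerivWithinAt ψ (φ u) (Set.Ici u) u := by
    intro φ ψ c hψ hφ u hu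
    have h1 := (hderiv φ hφ u hu).const_add (ψ a)
    refine h1.congr_of_eventuallyEq ?_ ?_
    · filter_upwards [Icc_mem_nhdsGE hu.2] with w hw
      rw [← hψ w ⟨hu.1.trans hw.1, hw.2⟩]; ring
    · rw [← hψ u ⟨hu.1, hu.2.le⟩]; ring
  have hkc : ContinuousOn (fun w => k * g w + r * f w) (Set.Icc a b) :=
    (continuousOn_const.mul hgc).add (continuousOn_const.mul hfc)
  set Q : ℝ → ℝ := fun u => Real.exp (-(r * u)) * (h u * f u - h' u * g u) with hQ
  have hhc : Continuous h := continuous_iff_continuousAt.2 fun t => (hh t).continuousAt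
  have hhc' : Continuous h' := continuous_iff_continuousAt.2 fun t => (hh' t).continuousAt
  have hQc : ContinuousOn Q (Set.Icc a b) := by
    have : Continuous fun u => Real.exp (-(r * u)) := by fun_prop
    exact this.continuousOn.mul ((hhc.continuousOn.mul hfc).sub (hhc'.continuousOn.mul hgc))
  have hQd : ∀ u ∈ Set.Ico a b, HasDerivWithinAt Q 0 (Set.Ici u) u := by
    intro u hu
    have e1 : HasDerivAt (fun u => Real.exp (-(r * u))) (Real.exp (-(r * u)) * (-(r * 1))) u :=
      (((hasDerivAt_id u).const_mul r).neg).exp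
    have e2 := ((hh u).hasDerivWithinAt (s := Set.Ici u)).mul (hcong _ f 0 hf1 hkc u hu)
    have e3 := ((hh' u).hasDerivWithinAt (s := Set.Ici u)).mul (hcong _ g 0 hg1 hfc u hu)
    have e4 := (e1.hasDerivWithinAt (s := Set.Ici u)).mul (e2.sub e3)
    convert! e4 using 1
    simp only [Pi.sub_apply, Pi.mul_apply]
    ring
  have h1 := constant_of_has_deriv_right_zero hQc hQd b ⟨hab, le_rfl⟩
  simp only [hQ, hfb, hb, mul_zero, zero_mul, sub_zero] at h1
  have h2 := mul_eq_zero.1 h1.symm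
  have h3 : h a * f a - h' a * g a = 0 := h2.resolve_left (Real.exp_ne_zero _)
  linarith

/-- The homogeneous scalar system has only the trivial solution. -/
theorem scalar_solution_unique [IsProbabilityMeasure P] (hT : 0 < T)
    {F : Filtration (TimeInt T) mΩ} {r k : ℝ} (hk : 0 < k) {x v m : TimeInt T → Ω → ℝ}
    (hx : Measurable[optionalSigma F] fun p : TimeInt T × Ω => x p.1 p.2)
    (hv : Measurable[optionalSigma F] fun p : TimeInt T × Ω => v p.1 p.2)
    (hxi : Integrable (fun p : Ω × TimeInt T => x p.2 p.1) (P.prod (leb T)))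
    (hvi : Integrable (fun p : Ω × TimeInt T => v p.2 p.1) (P.prod (leb T)))
    (hm : Martingale m F P) (hmc : ∀ᵐ ω ∂P, Continuous fun t => m t ω)
    (hfwd : ∀ᵐ ω ∂P, ∀ s t : TimeInt T, s ≤ t →
      x t ω - x s ω = ∫ u in Set.Ioc s t, v u ω ∂(leb T))
    (hinit : ∀ᵐ ω ∂P, ∀ t : TimeInt T, (t : ℝ) = 0 → x t ω = 0)
    (hbwd : ∀ᵐ ω ∂P, ∀ s t : TimeInt T, s ≤ t → v t ω - v s ω = (m t ω - m s ω) +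
      ∫ u in Set.Ioc s t, (k * x u ω + r * v u ω) ∂(leb T))
    (hterm : ∀ᵐ ω ∂P, ∀ t : TimeInt T, (t : ℝ) = T → v t ω = 0) :
    ∀ᵐ ω ∂P, ∀ t, x t ω = 0 ∧ v t ω = 0 := by
  obtain ⟨h, h', hh, hh', hpos, hhT⟩ := exists_pos_solution r T hk
  set top : TimeInt T := ⟨T, hT.le, le_rfl⟩ with htop
  set bot : TimeInt T := ⟨0, le_rfl, hT.le⟩ with hbot
  have hwi : Integrable (fun p : Ω × TimeInt T => k * x p.2 p.1 + r * v p.2 p.1)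
      (P.prod (leb T)) := (hxi.const_mul k).add (hvi.const_mul r)
  have hset : ∀ {w : TimeInt T → Ω → ℝ},
      Integrable (fun p : Ω × TimeInt T => w p.2 p.1) (P.prod (leb T)) → ∀ (A : Set Ω) s t,
      Integrable (fun p : Ω × TimeInt T => w p.2 p.1)
        ((P.restrict A).prod ((leb T).restrict (Set.Ioc s t))) := by
    intro w hw A s t
    rw [Measure.prod_restrict]
    exact hw.integrableOn
  have hsetΩ : ∀ {w : TimeInt T → Ω → ℝ},
      Integrable (fun p : Ω × TimeInt T => w p.2 p.1) (P.prod (leb T)) → ∀ (A : Set Ω) s t,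
      Integrable (fun ω => ∫ u in Set.Ioc s t, w u ω ∂(leb T)) (P.restrict A) :=
    fun hw A s t => (hset hw A s t).integral_prod_left
  -- Membership in H² controls only almost every time. The integral equations give integrability at
  -- every fixed time: from time 0 for x, from the terminal condition for v.
  have hx1 : ∀ u, Integrable (x u) P := by
    intro u
    have h1 := hsetΩ hvi Set.univ bot u
    rw [Measure.restrict_univ] at h1
    refine h1.congr ?_
    filter_upwards [hfwd, hinit] with ω e1 e2
    rw [← e1 bot u u.2.1, e2 bot rfl, sub_zero]
  have hv1 : ∀ u, Integrable (v u) P := by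
    intro u
    have h1 := hsetΩ (w := fun z ω => k * x z ω + r * v z ω) hwi Set.univ u top
    rw [Measure.restrict_univ] at h1
    refine (((hm.integrable u).sub (hm.integrable top)).sub h1).congr ?_
    filter_upwards [hbwd, hterm] with ω e1 e2
    have e3 := e1 u top u.2.2
    rw [e2 top rfl] at e3
    simp only [Pi.sub_apply]
    linarith
  have hxm : ∀ t, Measurable[F t] (x t) := fun t => hx.comp (measurable_prodMk_optionalSigma F t)
  have hvm : ∀ t, Measurable[F t] (v t) := fun t => hv.comp (measurable_prodMk_optionalSigma F t)
  -- at every time the state is almost surely proportional to the rate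
  have hprop : ∀ t : TimeInt T, ∀ᵐ ω ∂P, h t * v t ω = h' t * x t ω := by
    intro t
    -- Over an event of F t the martingale increments after t integrate to zero, so the expectations
    -- of x and v on A solve the deterministic backward system on [t, T].
    have hsets : ∀ A, MeasurableSet[F t] A →
        h t * ∫ ω in A, v t ω ∂P = h' t * ∫ ω in A, x t ω ∂P := by
      intro A hA
      set f : TimeInt T → ℝ := fun u => ∫ ω in A, v u ω ∂P with hf
      set g : TimeInt T → ℝ := fun u => ∫ ω in A, x u ω ∂P with hg
      have hswap : ∀ {w : TimeInt T → Ω → ℝ},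
          Integrable (fun p : Ω × TimeInt T => w p.2 p.1) (P.prod (leb T)) → ∀ u,
          ∫ ω in A, ∫ z in Set.Ioc t u, w z ω ∂(leb T) ∂P =
            ∫ z in Set.Ioc t u, ∫ ω in A, w z ω ∂P ∂(leb T) := fun {w} hw u =>
        integral_integral_swap (f := fun ω z => w z ω) (hset hw A t u)
      have hg1 : ∀ u, t ≤ u → g u - g t = ∫ z in Set.Ioc t u, f z ∂(leb T) := by
        intro u hu
        rw [← hswap hvi u, hg]
        simp only
        rw [← integral_sub (hx1 u).integrableOn (hx1 t).integrableOn]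
        refine integral_congr_ae (ae_restrict_of_ae ?_)
        filter_upwards [hfwd] with ω e1
        exact e1 t u hu
      have hf1 : ∀ u, t ≤ u → f u - f t = ∫ z in Set.Ioc t u, (k * g z + r * f z) ∂(leb T) := by
        intro u hu
        have e0 : ∀ z, k * g z + r * f z = ∫ ω in A, (k * x z ω + r * v z ω) ∂P := by
          intro z
          rw [integral_add ((hx1 z).integrableOn.const_mul k) ((hv1 z).integrableOn.const_mul r),
            integral_const_mul, integral_const_mul]
        simp only [e0]
        rw [← hswap (w := fun z ω => k * x z ω + r * v z ω) hwi u, hf]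
        simp only
        rw [← integral_sub (hv1 u).integrableOn (hv1 t).integrableOn]
        have e1 : ∫ ω in A, (v u ω - v t ω) ∂P = ∫ ω in A, ((m u ω - m t ω) +
            ∫ z in Set.Ioc t u, (k * x z ω + r * v z ω) ∂(leb T)) ∂P := by
          refine integral_congr_ae (ae_restrict_of_ae ?_)
          filter_upwards [hbwd] with ω e1
          exact e1 t u hu
        have i1 : Integrable (fun ω => m u ω - m t ω) (P.restrict A) :=
          ((hm.integrable u).sub (hm.integrable t)).integrableOn
        rw [e1, integral_add i1
          (hsetΩ (w := fun z ω => k * x z ω + r * v z ω) hwi A t u),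
          integral_sub (hm.integrable u).integrableOn (hm.integrable t).integrableOn,
          hm.setIntegral_eq hu hA, sub_self, zero_add]
      have hfi : Integrable f (leb T) := by
        have h1 : Integrable (fun p : Ω × TimeInt T => v p.2 p.1)
            ((P.restrict A).prod (leb T)) := by
          have h2 := Measure.prod_restrict (μ := P) (ν := leb T) A Set.univ
          rw [Measure.restrict_univ] at h2
          rw [h2]
          exact hvi.integrableOn
        exact h1.integral_prod_right
      have hft : f top = 0 := by
        have : ∫ ω in A, v top ω ∂P = ∫ ω in A, (0 : ℝ) ∂P := by
          refine integral_congr_ae (ae_restrict_of_ae ?_)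
          filter_upwards [hterm] with ω e1
          exact e1 top rfl
        rw [hf]
        simp only [this, integral_zero]
      have hode := backward_ode (a := t) (b := T) (f := fun u => f (Set.projIcc 0 T hT.le u))
        (g := fun u => g (Set.projIcc 0 T hT.le u)) hh hh' hhT t.2.2
        ((intervalIntegrable_iff_integrableOn_Icc_of_le t.2.2).2
          ((integrableOn_projIcc_of_integrable_leb hT.le hfi).mono_set
            (Set.Icc_subset_Icc_left t.2.1)))
        (fun u hu => by
          have hu' : u ∈ Set.Icc 0 T := ⟨t.2.1.trans hu.1, hu.2⟩
          have e1 := hg1 ⟨u, hu'⟩ hu.1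
          rw [setIntegral_leb hT.le _ (show t ≤ ⟨u, hu'⟩ from hu.1)] at e1
          rw [Set.projIcc_of_mem hT.le hu', Set.projIcc_val hT.le t]
          exact e1)
        (fun u hu => by
          have hu' : u ∈ Set.Icc 0 T := ⟨t.2.1.trans hu.1, hu.2⟩
          have e1 := hf1 ⟨u, hu'⟩ hu.1
          rw [setIntegral_leb hT.le _ (show t ≤ ⟨u, hu'⟩ from hu.1)] at e1
          rw [Set.projIcc_of_mem hT.le hu', Set.projIcc_val hT.le t]
          exact e1)
        (by rw [Set.projIcc_right]; exact hft)
      rwa [Set.projIcc_val hT.le t] at hode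
    refine ae_eq_of_forall_setIntegral_eq_of_sigmaFinite' (F.le t)
      (f := fun ω => h t * v t ω) (g := fun ω => h' t * x t ω)
      (fun A _ _ => ((hv1 t).const_mul _).integrableOn)
      (fun A _ _ => ((hx1 t).const_mul _).integrableOn) (fun A hA _ => ?_)
      ((hvm t).const_mul _).stronglyMeasurable.aestronglyMeasurable
      ((hxm t).const_mul _).stronglyMeasurable.aestronglyMeasurable
    rw [integral_const_mul, integral_const_mul]
    exact hsets A hA
  -- The exceptional event in `hprop` depends on t; Fubini turns this into one event off which the
  -- relation holds for almost every t.
  have hpropae : ∀ᵐ ω ∂P, ∀ᵐ t : TimeInt T ∂(leb T), h t * v t ω = h' t * x t ω := by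
    have hxm' : Measurable fun p : Ω × TimeInt T => x p.2 p.1 :=
      (hx.mono (optionalSigma_le_prod hT.le F) le_rfl).comp measurable_swap
    have hvm' : Measurable fun p : Ω × TimeInt T => v p.2 p.1 :=
      (hv.mono (optionalSigma_le_prod hT.le F) le_rfl).comp measurable_swap
    have hhm : Measurable h :=
      (continuous_iff_continuousAt.2 fun t => (hh t).continuousAt).measurable
    have hhm' : Measurable h' :=
      (continuous_iff_continuousAt.2 fun t => (hh' t).continuousAt).measurable
    have hcoe : Measurable fun p : Ω × TimeInt T => (p.2 : ℝ) :=
      measurable_subtype_coe.comp measurable_snd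
    refine (Measure.ae_ae_comm ?_).1 (Eventually.of_forall hprop)
    exact (measurableSet_eq_fun ((hhm.comp hcoe).mul hvm')
      ((hhm'.comp hcoe).mul hxm')).preimage measurable_swap
  -- hence the state vanishes
  have hx0 : ∀ᵐ ω ∂P, ∀ t, x t ω = 0 := by
    filter_upwards [hpropae, hfwd, hinit, hvi.prod_right_ae] with ω e1 e2 e3 e4 t
    have hV : IntegrableOn (fun u => v (Set.projIcc 0 T hT.le u) ω) (Set.Icc 0 T) :=
      integrableOn_projIcc_of_integrable_leb (f := fun t => v t ω) hT.le e4
    -- Extending the rate by zero outside [0, T] makes it integrable on every interval.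
    set G : ℝ → ℝ := (Set.Icc 0 T).indicator fun u => v (Set.projIcc 0 T hT.le u) ω with hG
    have hGi : Integrable G := (integrable_indicator_iff measurableSet_Icc).2 hV
    have hxG : ∀ u ∈ Set.Icc (0 : ℝ) T,
        x (Set.projIcc 0 T hT.le u) ω = ∫ w in (0 : ℝ)..u, G w := by
      intro u hu
      have e5 := e2 bot ⟨u, hu⟩ hu.1
      rw [e3 bot rfl, sub_zero, setIntegral_leb hT.le _ (show bot ≤ ⟨u, hu⟩ from hu.1)] at e5
      rw [Set.projIcc_of_mem hT.le hu, e5]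
      refine intervalIntegral.integral_congr fun w hw => ?_
      rw [show ((bot : TimeInt T) : ℝ) = 0 from rfl, Set.uIcc_of_le hu.1] at hw
      rw [hG, Set.indicator_of_mem (show w ∈ Set.Icc 0 T from ⟨hw.1, hw.2.trans hu.2⟩)]
    have hpd : ∀ u, HasDerivAt (fun u => (h u)⁻¹) (-h' u / h u ^ 2) u := fun u =>
      (hh u).inv (hpos u).ne'
    have hhc : Continuous h := continuous_iff_continuousAt.2 fun t => (hh t).continuousAt
    have hhc' : Continuous h' := continuous_iff_continuousAt.2 fun t => (hh' t).continuousAt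
    -- Applied to x/h, whose derivative (h v - h' x)/h² vanishes almost everywhere.
    have hprod := mul_primitive_sub_mul_primitive hpd
      (hhc'.neg.div (hhc.pow 2) fun u => (pow_pos (hpos u) 2).ne')
      (fun a b => hGi.intervalIntegrable) 0 t
    rw [intervalIntegral.integral_same, mul_zero, sub_zero] at hprod
    have hzero : ∫ u in (0 : ℝ)..t, (-h' u / h u ^ 2 * (∫ w in (0 : ℝ)..u, G w) +
        (h u)⁻¹ * G u) = 0 := by
      rw [intervalIntegral.integral_of_le t.2.1]
      refine integral_eq_zero_of_ae ?_
      have e6 := (ae_leb_iff hT.le).1 e1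
      have e7 := ae_restrict_of_ae_restrict_of_subset
        (show Set.Ioc (0 : ℝ) t ⊆ Set.Icc 0 T from fun u hu => ⟨hu.1.le, hu.2.trans t.2.2⟩) e6
      filter_upwards [e7, ae_restrict_mem measurableSet_Ioc] with u hu hu'
      have hu2 : u ∈ Set.Icc 0 T := ⟨hu'.1.le, hu'.2.trans t.2.2⟩
      rw [← hxG u hu2, hG, Set.indicator_of_mem hu2]
      rw [Set.projIcc_of_mem hT.le hu2] at hu ⊢
      have hne := (hpos u).ne'
      simp only at hu
      simp only [Pi.zero_apply]
      field_simp
      linarith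
    rw [hzero] at hprod
    have e8 := (mul_eq_zero.1 hprod).resolve_left (inv_ne_zero (hpos t).ne')
    rw [← hxG t t.2, Set.projIcc_val] at e8
    exact e8
  -- and so does the rate
  have hne : Nonempty (TimeInt T) := ⟨bot⟩
  have hv0 : ∀ᵐ ω ∂P, ∀ n, v (TopologicalSpace.denseSeq (TimeInt T) n) ω = 0 := by
    refine ae_all_iff.2 fun n => ?_
    filter_upwards [hprop (TopologicalSpace.denseSeq (TimeInt T) n), hx0] with ω e1 e2
    rw [e2, mul_zero] at e1
    exact (mul_eq_zero.1 e1).resolve_left (hpos _).ne'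
  filter_upwards [hx0, hv0, hbwd, hmc, hpropae] with ω e1 e2 e3 e4 e5
  -- With zero drift v moves only with the martingale, so it is continuous, and its zeros on a dense
  -- set of times determine it.
  have e6 : ∀ t, v t ω = v bot ω + (m t ω - m bot ω) := by
    intro t
    have e7 := e3 bot t t.2.1
    have e8 : ∫ u in Set.Ioc bot t, (k * x u ω + r * v u ω) ∂(leb T) = 0 := by
      refine integral_eq_zero_of_ae (ae_restrict_of_ae ?_)
      filter_upwards [e5] with u hu
      rw [e1, mul_zero] at hu
      rw [e1, (mul_eq_zero.1 hu).resolve_left (hpos _).ne']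
      simp
    rw [e8] at e7
    linarith
  have hvc : Continuous fun t => v t ω := by
    rw [funext e6]
    exact continuous_const.add (e4.sub continuous_const)
  have hv00 : (fun t => v t ω) = fun _ => 0 :=
    Continuous.ext_on (TopologicalSpace.denseRange_denseSeq (TimeInt T)) hvc continuous_const
      (by rintro _ ⟨n, rfl⟩; exact e2 n)
  exact fun t => ⟨e1 t, congrFun hv00 t⟩

/-! ### The coefficient matrix -/

section Matrices

variable {ι : Type*} [Fintype ι] [DecidableEq ι]

/-- C = N/(N+1) · 1 + 1/(N+1) · eeᵀ with e the all-ones vector. -/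
lemma posDef_matC (N : ℕ) : (matC N).PosDef := by
  have h : matC N = ((N : ℝ) / ((N : ℝ) + 1)) • (1 : Matrix (Fin N) (Fin N) ℝ) +
      ((1 : ℝ) / ((N : ℝ) + 1)) • Matrix.vecMulVec (fun _ => 1) (star fun _ => 1) := by
    ext i j
    have hN : (N : ℝ) + 1 ≠ 0 := by positivity
    by_cases hij : i = j
    · subst hij
      simp [matC, Matrix.vecMulVec_apply]
      field_simp
    · simp [matC, Matrix.vecMulVec_apply, hij]
  -- For N = 0 the coefficient N/(N+1) is zero, so the empty matrix is handled apart.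
  rcases Nat.eq_zero_or_pos N with rfl | hN
  · rw [Subsingleton.elim (matC 0) 1]
    exact Matrix.PosDef.one
  · rw [h]
    refine Matrix.PosDef.add_posSemidef (Matrix.PosDef.smul Matrix.PosDef.one ?_)
      (Matrix.PosSemidef.smul (Matrix.posSemidef_vecMulVec_self_star _) ?_)
    · have : (0 : ℝ) < N := by exact_mod_cast hN
      positivity
    · positivity

/-- A symmetric positive definite matrix multiplied from the left by a positive diagonal matrix
is similar to a positive diagonal matrix. -/
lemma exists_diagonalization {e : ι → ℝ} (he : ∀ i, 0 < e i) {S : Matrix ι ι ℝ} (hS : S.PosDef) :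
    ∃ (R R' : Matrix ι ι ℝ) (κ : ι → ℝ), R * R' = 1 ∧ R' * R = 1 ∧ (∀ i, 0 < κ i) ∧
      R * (Matrix.diagonal e * S) = Matrix.diagonal κ * R := by
  set q : ι → ℝ := fun i => Real.sqrt (e i) with hq
  have hq0 : ∀ i, q i ≠ 0 := fun i => (Real.sqrt_pos.2 (he i)).ne'
  set D := Matrix.diagonal q with hD
  set D' := Matrix.diagonal fun i => (q i)⁻¹ with hD'
  have hDD' : D * D' = 1 := by simp [hD, hD', Matrix.diagonal_mul_diagonal, hq0]
  have hD'D : D' * D = 1 := by simp [hD, hD', Matrix.diagonal_mul_diagonal, hq0]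
  have hee : Matrix.diagonal e = D * D := by
    simp only [hD, Matrix.diagonal_mul_diagonal]
    congr 1; funext i; exact (Real.mul_self_sqrt (he i).le).symm
  -- With D the square root of `Matrix.diagonal e`, conjugation by D carries D² S to D S D, to which
  -- the spectral theorem applies.
  have hA : (D * S * D).PosDef := by
    have hinj : Function.Injective D.mulVec := by
      intro x y hxy
      have := congrArg (D' *ᵥ ·) hxy
      simpa [Matrix.mulVec_mulVec, hD'D] using this
    have h := hS.conjTranspose_mul_mul_same hinj
    have hstar : Dᴴ = D := by simp [hD]
    rwa [hstar] at h
  set U : Matrix ι ι ℝ := (hA.1.eigenvectorUnitary : Matrix ι ι ℝ) with hU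
  have hUU : U * star U = 1 := Unitary.mul_star_self_of_mem hA.1.eigenvectorUnitary.2
  have hUU' : star U * U = 1 := Unitary.star_mul_self_of_mem hA.1.eigenvectorUnitary.2
  have hspec : D * S * D = U * Matrix.diagonal hA.1.eigenvalues * star U := by
    have := hA.1.spectral_theorem
    rw [Unitary.conjStarAlgAut_apply] at this
    exact this
  refine ⟨star U * D', D * U, hA.1.eigenvalues, ?_, ?_, hA.eigenvalues_pos, ?_⟩
  · rw [Matrix.mul_assoc, ← Matrix.mul_assoc D', hD'D, Matrix.one_mul, hUU']
  · rw [Matrix.mul_assoc, ← Matrix.mul_assoc U, hUU, Matrix.one_mul, hDD']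
  · calc star U * D' * (Matrix.diagonal e * S)
        = star U * (D' * D) * (D * S * (D * D')) := by
          rw [hDD', hee]; simp only [Matrix.mul_assoc, Matrix.mul_one]
      _ = star U * (D * S * D) * D' := by rw [hD'D]; simp only [Matrix.mul_assoc, Matrix.one_mul]
      _ = (star U * U) * Matrix.diagonal hA.1.eigenvalues * star U * D' := by
          refine (congrArg (fun A => star U * A * D') hspec).trans ?_
          simp only [Matrix.mul_assoc]
      _ = _ := by rw [hUU', Matrix.one_mul, Matrix.mul_assoc]

/-- As Λ⁻¹ is diagonal, it can be pulled out: C ⊗ B = (1 ⊗ (2δΛ)⁻¹)(C ⊗ Σ), and a Kronecker product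
of positive definite matrices is positive definite. -/
lemma exists_diagonalization_kronecker {d N : ℕ} {δ : ℝ} (hδ : 0 < δ)
    {Sig Lam : Matrix (Fin d) (Fin d) ℝ} (hSig : Sig.PosDef) (hLam : Lam.IsDiag)
    (hLamPos : Lam.PosDef) :
    ∃ (R R' : Matrix (Fin N × Fin d) (Fin N × Fin d) ℝ) (κ : Fin N × Fin d → ℝ),
      R * R' = 1 ∧ R' * R = 1 ∧ (∀ i, 0 < κ i) ∧
      R * (matC N ⊗ₖ matB δ Sig Lam) = Matrix.diagonal κ * R := by
  have hl : ∀ i, 0 < Lam i i := fun i => hLamPos.diag_pos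
  have hinv : Lam⁻¹ = Matrix.diagonal fun i => (Lam i i)⁻¹ := by
    refine Matrix.inv_eq_right_inv ?_
    conv_lhs => rw [← hLam.diagonal_diag]
    rw [Matrix.diagonal_mul_diagonal, ← Matrix.diagonal_one]
    congr 1; funext i
    simp [(hl i).ne']
  have hK : matC N ⊗ₖ matB δ Sig Lam =
      Matrix.diagonal (fun p : Fin N × Fin d => (2 * δ)⁻¹ * (Lam p.2 p.2)⁻¹) *
        (matC N ⊗ₖ Sig) := by
    ext p q
    simp only [Matrix.diagonal_mul, Matrix.kroneckerMap_apply, matB, hinv, Matrix.smul_apply,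
      smul_eq_mul]
    ring
  rw [hK]
  have he : ∀ p : Fin N × Fin d, 0 < (2 * δ)⁻¹ * (Lam p.2 p.2)⁻¹ :=
    fun p => mul_pos (by positivity) (inv_pos.2 (hl p.2))
  have hS : (matC N ⊗ₖ Sig).PosDef := (posDef_matC N).kronecker hSig
  exact exists_diagonalization he hS

/-- Ensures that `K⁻¹` is a genuine inverse and not the default value for singular matrices; R'
diag(κ⁻¹) R is an explicit right inverse. -/
lemma mul_inv_of_diagonalization {R R' K : Matrix ι ι ℝ} {κ : ι → ℝ} (hRR' : R * R' = 1)
    (hR'R : R' * R = 1) (hκ : ∀ i, 0 < κ i) (hK : R * K = Matrix.diagonal κ * R) :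
    K * K⁻¹ = 1 := by
  refine Matrix.mul_nonsing_inv _ ?_
  have h : K * (R' * Matrix.diagonal (fun i => (κ i)⁻¹) * R) = 1 := by
    have h1 : K = R' * Matrix.diagonal κ * R := by
      rw [Matrix.mul_assoc, ← hK, ← Matrix.mul_assoc, hR'R, Matrix.one_mul]
    calc K * (R' * Matrix.diagonal (fun i => (κ i)⁻¹) * R)
        = R' * (Matrix.diagonal κ * (R * R') * Matrix.diagonal fun i => (κ i)⁻¹) * R := by
          rw [h1]; simp only [Matrix.mul_assoc]
      _ = 1 := by
          simp [hRR', Matrix.diagonal_mul_diagonal, (hκ _).ne', hR'R]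
  exact Matrix.isUnit_det_of_right_inverse h

/-- For an eigenvector v, the vector R v is nonzero and is an eigenvector of diag(κ). A nonzero
coordinate of it shows that z is one of the κ i. -/
lemma eigenvalue_pos_of_diagonalization {R R' K : Matrix ι ι ℝ} {κ : ι → ℝ}
    (hR'R : R' * R = 1) (hκ : ∀ i, 0 < κ i) (hK : R * K = Matrix.diagonal κ * R) {z : ℂ}
    (hz : Module.End.HasEigenvalue (Matrix.toLin' (K.map Complex.ofReal)) z) :
    0 < z.re ∧ z.im = 0 := by
  obtain ⟨v, hv⟩ := hz.exists_hasEigenvector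
  have hv1 : K.map Complex.ofReal *ᵥ v = z • v := by
    simpa [Matrix.toLin'_apply] using hv.apply_eq_smul
  have hKc : R.map Complex.ofReal * K.map Complex.ofReal =
      (Matrix.diagonal κ).map Complex.ofReal * R.map Complex.ofReal := by
    have := congrArg (fun M : Matrix ι ι ℝ => M.map Complex.ofRealHom) hK
    rwa [Matrix.map_mul, Matrix.map_mul] at this
  have hRc : R'.map Complex.ofReal * R.map Complex.ofReal = 1 := by
    have := congrArg (fun M : Matrix ι ι ℝ => M.map Complex.ofRealHom) hR'R
    rwa [Matrix.map_mul, Matrix.map_one _ (map_zero _) (map_one _)] at this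
  set w := R.map Complex.ofReal *ᵥ v with hw
  have hw0 : w ≠ 0 := by
    intro h0
    refine hv.2 ?_
    have : R'.map Complex.ofReal *ᵥ w = v := by
      rw [hw, Matrix.mulVec_mulVec, hRc, Matrix.one_mulVec]
    rw [← this, h0, Matrix.mulVec_zero]
  have hw1 : (Matrix.diagonal κ).map Complex.ofReal *ᵥ w = z • w := by
    rw [hw, Matrix.mulVec_mulVec, ← hKc, ← Matrix.mulVec_mulVec, hv1, Matrix.mulVec_smul]
  obtain ⟨i, hi⟩ := Function.ne_iff.1 hw0
  have h2 := congrFun hw1 i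
  rw [Matrix.diagonal_map Complex.ofReal_zero, Matrix.mulVec_diagonal] at h2
  have h3 : z = κ i := (mul_right_cancel₀ hi h2).symm
  rw [h3]
  exact ⟨by simpa using hκ i, Complex.ofReal_im _⟩

end Matrices

/-! ### Linear images of processes -/

section Transfer

variable {ι κ : Type*} [Fintype ι] [Fintype κ] {F : Filtration (TimeInt T) mΩ}

lemma martingale_clm {E G : Type*} [NormedAddCommGroup E] [NormedSpace ℝ E] [CompleteSpace E]
    [NormedAddCommGroup G] [NormedSpace ℝ G] [CompleteSpace G] {M : TimeInt T → Ω → E}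
    (hM : Martingale M F P) (A : E →L[ℝ] G) : Martingale (fun t ω => A (M t ω)) F P := by
  refine ⟨fun t => A.continuous.comp_stronglyMeasurable (hM.1 t), fun s t hst => ?_⟩
  filter_upwards [A.comp_condExp_comm (m := F s) (hM.integrable t), hM.2 s t hst] with ω h1 h2
  rw [show (fun ω => A (M t ω)) = A ∘ M t from rfl, ← h1, Function.comp_apply, h2]

lemma memH2_iff [IsProbabilityMeasure P] (hT : 0 ≤ T) {X : TimeInt T → Ω → EuclideanSpace ℝ ι} :
    MemH2 P F X ↔ IsOptional F X ∧
      MemLp (fun p : Ω × TimeInt T => X p.2 p.1) 2 (P.prod (leb T)) := by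
  refine ⟨fun h => ⟨h.optional, h.memLp_prod hT⟩, fun ⟨h1, h2⟩ => ⟨h1, ?_⟩⟩
  have hm : Measurable fun p : Ω × TimeInt T => X p.2 p.1 :=
    (h1.measurable hT).comp measurable_swap
  have h3 := h2.2
  rw [eLpNorm_lt_top_iff_lintegral_rpow_enorm_lt_top two_ne_zero ENNReal.ofNat_ne_top,
    lintegral_prod _ (hm.enorm.pow_const _).aemeasurable] at h3
  simpa using h3

lemma MemH2.clm [IsProbabilityMeasure P] (hT : 0 ≤ T) {X : TimeInt T → Ω → EuclideanSpace ℝ ι}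
    (hX : MemH2 P F X) (A : EuclideanSpace ℝ ι →L[ℝ] EuclideanSpace ℝ κ) :
    MemH2 P F fun t ω => A (X t ω) :=
  (memH2_iff hT).2 ⟨hX.optional.clm A, (hX.memLp_prod hT).continuousLinearMap_comp A⟩

lemma MemH2.add [IsProbabilityMeasure P] (hT : 0 ≤ T) {X Y : TimeInt T → Ω → EuclideanSpace ℝ ι}
    (hX : MemH2 P F X) (hY : MemH2 P F Y) : MemH2 P F fun t ω => X t ω + Y t ω :=
  (memH2_iff hT).2 ⟨hX.optional.add hY.optional, (hX.memLp_prod hT).add (hY.memLp_prod hT)⟩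

lemma MemH2.smul [IsProbabilityMeasure P] (hT : 0 ≤ T) {X : TimeInt T → Ω → EuclideanSpace ℝ ι}
    (hX : MemH2 P F X) (c : ℝ) : MemH2 P F fun t ω => c • X t ω :=
  hX.clm hT (c • ContinuousLinearMap.id ℝ _)

lemma MemH2.sub [IsProbabilityMeasure P] (hT : 0 ≤ T) {X Y : TimeInt T → Ω → EuclideanSpace ℝ ι}
    (hX : MemH2 P F X) (hY : MemH2 P F Y) : MemH2 P F fun t ω => X t ω - Y t ω := by
  simpa [sub_eq_add_neg] using hX.add hT (hY.smul hT (-1))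

lemma MemH2.sum [IsProbabilityMeasure P] (hT : 0 ≤ T) {α : Type*} (s : Finset α)
    {X : α → TimeInt T → Ω → EuclideanSpace ℝ ι} (hX : ∀ i ∈ s, MemH2 P F (X i)) :
    MemH2 P F fun t ω => ∑ i ∈ s, X i t ω := by
  classical
  induction s using Finset.induction_on with
  | empty => simpa using (memHInf_zero F).memH2
  | insert a s ha ih =>
    simp only [Finset.sum_insert ha]
    exact (hX a (by simp)).add hT (ih fun i hi => hX i (by simp [hi]))

/-! ### Forward-backward systems with a given drift -/

/-- `dX = V dt`, `X(0) = 0`, `dV = dM + G dt`, `V(T) = 0`, with `X, V, G ∈ H²` and `M` a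
continuous square integrable martingale. -/
structure IsDriftSolution (P : Measure Ω) (F : Filtration (TimeInt T) mΩ)
    (X V M G : TimeInt T → Ω → EuclideanSpace ℝ ι) : Prop where
  memX : MemH2 P F X
  memV : MemH2 P F V
  memG : MemH2 P F G
  martingale : Martingale M F P
  sq_integrable : ∀ t, MemLp (M t) 2 P
  continuous : ∀ᵐ ω ∂P, Continuous fun t => M t ω
  forward : HasRate P X V
  backward : ∀ᵐ ω ∂P, ∀ s t : TimeInt T, s ≤ t →
    V t ω - V s ω = (M t ω - M s ω) + ∫ u in Set.Ioc s t, G u ω ∂(leb T)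
  terminal : ∀ᵐ ω ∂P, ∀ t : TimeInt T, (t : ℝ) = T → V t ω = 0

namespace IsDriftSolution

variable {X V M G X' V' M' G' : TimeInt T → Ω → EuclideanSpace ℝ ι}

/-- The drift being in H² makes it integrable along almost every path, which allows A to pass under
the time integral. -/
lemma clm [IsProbabilityMeasure P] (hT : 0 ≤ T) (h : IsDriftSolution P F X V M G)
    (A : EuclideanSpace ℝ ι →L[ℝ] EuclideanSpace ℝ κ) :
    IsDriftSolution P F (fun t ω => A (X t ω)) (fun t ω => A (V t ω)) (fun t ω => A (M t ω))
      (fun t ω => A (G t ω)) where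
  memX := h.memX.clm hT A
  memV := h.memV.clm hT A
  memG := h.memG.clm hT A
  martingale := martingale_clm h.martingale A
  sq_integrable t := (h.sq_integrable t).continuousLinearMap_comp A
  continuous := by
    filter_upwards [h.continuous] with ω hω
    exact A.continuous.comp hω
  forward := by
    refine ⟨?_, ?_⟩
    · filter_upwards [h.forward.dynamics, h.memV.ae_integrable hT] with ω hω hi s t hst
      rw [← map_sub, hω s t hst, A.integral_comp_comm hi.integrableOn]
    · filter_upwards [h.forward.init] with ω hω t ht
      rw [hω t ht, map_zero]
  backward := by
    filter_upwards [h.backward, h.memG.ae_integrable hT] with ω hω hi s t hst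
    rw [← map_sub, hω s t hst, A.integral_comp_comm hi.integrableOn, map_add, map_sub]
  terminal := by
    filter_upwards [h.terminal] with ω hω t ht
    rw [hω t ht, map_zero]

lemma add [IsProbabilityMeasure P] (hT : 0 ≤ T) (h : IsDriftSolution P F X V M G)
    (h' : IsDriftSolution P F X' V' M' G') :
    IsDriftSolution P F (fun t ω => X t ω + X' t ω) (fun t ω => V t ω + V' t ω)
      (fun t ω => M t ω + M' t ω) (fun t ω => G t ω + G' t ω) where
  memX := h.memX.add hT h'.memX
  memV := h.memV.add hT h'.memV
  memG := h.memG.add hT h'.memG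
  martingale := h.martingale.add h'.martingale
  sq_integrable t := (h.sq_integrable t).add (h'.sq_integrable t)
  continuous := by
    filter_upwards [h.continuous, h'.continuous] with ω hω hω'
    exact hω.add hω'
  forward := by
    refine ⟨?_, ?_⟩
    · filter_upwards [h.forward.dynamics, h.memV.ae_integrable hT, h'.forward.dynamics,
        h'.memV.ae_integrable hT] with ω hω hi hω' hi' s t hst
      rw [integral_add hi.integrableOn hi'.integrableOn, ← hω s t hst, ← hω' s t hst]
      abel
    · filter_upwards [h.forward.init, h'.forward.init] with ω hω hω' t ht
      rw [hω t ht, hω' t ht, add_zero]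
  backward := by
    filter_upwards [h.backward, h.memG.ae_integrable hT, h'.backward,
      h'.memG.ae_integrable hT] with ω hω hi hω' hi' s t hst
    rw [integral_add hi.integrableOn hi'.integrableOn, add_sub_add_comm, hω s t hst, hω' s t hst]
    abel
  terminal := by
    filter_upwards [h.terminal, h'.terminal] with ω hω hω' t ht
    rw [hω t ht, hω' t ht, add_zero]

lemma sub [IsProbabilityMeasure P] (hT : 0 ≤ T) (h : IsDriftSolution P F X V M G)
    (h' : IsDriftSolution P F X' V' M' G') :
    IsDriftSolution P F (fun t ω => X t ω - X' t ω) (fun t ω => V t ω - V' t ω)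
      (fun t ω => M t ω - M' t ω) (fun t ω => G t ω - G' t ω) := by
  simpa [sub_eq_add_neg] using h.add hT (h'.clm hT (-ContinuousLinearMap.id ℝ _))

lemma zero [IsProbabilityMeasure P] (F : Filtration (TimeInt T) mΩ) :
    IsDriftSolution P F (fun _ _ => (0 : EuclideanSpace ℝ ι)) (fun _ _ => 0) (fun _ _ => 0)
      (fun _ _ => 0) where
  memX := (memHInf_zero F).memH2
  memV := (memHInf_zero F).memH2
  memG := (memHInf_zero F).memH2
  martingale := martingale_zero _ _ _
  sq_integrable _ := MemLp.zero
  continuous := by simpa using continuous_const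
  forward := ⟨by simp, by simp⟩
  backward := by simp
  terminal := by simp

lemma sum [IsProbabilityMeasure P] (hT : 0 ≤ T) {α : Type*} (s : Finset α)
    {X V M G : α → TimeInt T → Ω → EuclideanSpace ℝ ι}
    (h : ∀ i ∈ s, IsDriftSolution P F (X i) (V i) (M i) (G i)) :
    IsDriftSolution P F (fun t ω => ∑ i ∈ s, X i t ω) (fun t ω => ∑ i ∈ s, V i t ω)
      (fun t ω => ∑ i ∈ s, M i t ω) (fun t ω => ∑ i ∈ s, G i t ω) := by
  classical
  induction s using Finset.induction_on with
  | empty => simpa using zero F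
  | insert a s ha ih =>
    simp only [Finset.sum_insert ha]
    exact (h a (by simp)).add hT (ih fun i hi => h i (by simp [hi]))

lemma isFBSDESolution [DecidableEq ι] {r : ℝ} {B : Matrix ι ι ℝ}
    {ξ : TimeInt T → Ω → EuclideanSpace ℝ ι} (h : IsDriftSolution P F X V M G)
    (hG : ∀ t ω, G t ω = Matrix.toEuclideanLin B (X t ω - ξ t ω) + r • V t ω) :
    IsFBSDESolution P F r B ξ X V M where
  memX := h.memX
  memXdot := h.memV
  martingale := h.martingale
  sq_integrable := h.sq_integrable
  continuous := h.continuous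
  forward := h.forward
  backward := by simpa only [hG] using h.backward
  terminal := h.terminal

end IsDriftSolution

lemma IsFBSDESolution.isDriftSolution [IsProbabilityMeasure P] (hT : 0 ≤ T)
    [DecidableEq ι] {r : ℝ}
    {B : Matrix ι ι ℝ} {ξ X V M : TimeInt T → Ω → EuclideanSpace ℝ ι}
    (h : IsFBSDESolution P F r B ξ X V M) (hξ : MemH2 P F ξ) :
    IsDriftSolution P F X V M
      (fun t ω => Matrix.toEuclideanLin B (X t ω - ξ t ω) + r • V t ω) where
  memX := h.memX
  memV := h.memXdot
  memG := ((h.memX.sub hT hξ).clm hT (LinearMap.toContinuousLinearMap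
    (Matrix.toEuclideanLin B))).add hT (h.memXdot.smul hT r)
  martingale := h.martingale
  sq_integrable := h.sq_integrable
  continuous := h.continuous
  forward := h.forward
  backward := h.backward
  terminal := h.terminal

/-! ### The vector-valued linear system -/

variable [DecidableEq ι]

lemma toEuclideanLin_mul_apply (A B : Matrix ι ι ℝ) (v : EuclideanSpace ℝ ι) :
    Matrix.toEuclideanLin (A * B) v = Matrix.toEuclideanLin A (Matrix.toEuclideanLin B v) := by
  ext i
  simp [Matrix.mulVec_mulVec]

lemma toEuclideanLin_one_apply (v : EuclideanSpace ℝ ι) :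
    Matrix.toEuclideanLin (1 : Matrix ι ι ℝ) v = v := by
  ext i
  simp

lemma toEuclideanLin_diagonal_apply (κ : ι → ℝ) (v : EuclideanSpace ℝ ι) (i : ι) :
    Matrix.toEuclideanLin (Matrix.diagonal κ) v i = κ i * v i := by
  simp [Matrix.mulVec_diagonal]

/-- The target cancels in the difference of two solutions, and each coordinate of its image under R
solves the homogeneous scalar system with k = κ i. As R is injective, the difference vanishes. The
equation then identifies the increments of M, the initial value of M being free. -/
lemma IsFBSDESolution.unique [IsProbabilityMeasure P] (hT : 0 < T) {r : ℝ}
    {R R' K : Matrix ι ι ℝ} {κ : ι → ℝ} (hR'R : R' * R = 1) (hκ : ∀ i, 0 < κ i)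
    (hK : R * K = Matrix.diagonal κ * R)
    {ξ X V M X' V' M' : TimeInt T → Ω → EuclideanSpace ℝ ι} (hξ : MemH2 P F ξ)
    (h : IsFBSDESolution P F r K ξ X V M) (h' : IsFBSDESolution P F r K ξ X' V' M') :
    ∀ᵐ ω ∂P, ∀ t, X t ω = X' t ω ∧ V t ω = V' t ω ∧
      ∀ s, M t ω - M s ω = M' t ω - M' s ω := by
  have hd := (h.isDriftSolution hT.le hξ).sub hT.le (h'.isDriftSolution hT.le hξ)
  have hdR := hd.clm hT.le (LinearMap.toContinuousLinearMap (Matrix.toEuclideanLin R))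
  simp only [LinearMap.coe_toContinuousLinearMap'] at hdR
  have hdrift : ∀ (i : ι) (u : TimeInt T) (ω : Ω),
      Matrix.toEuclideanLin R ((Matrix.toEuclideanLin K (X u ω - ξ u ω) + r • V u ω) -
        (Matrix.toEuclideanLin K (X' u ω - ξ u ω) + r • V' u ω)) i =
      κ i * Matrix.toEuclideanLin R (X u ω - X' u ω) i +
        r * Matrix.toEuclideanLin R (V u ω - V' u ω) i := by
    intro i u ω
    have h1 : (Matrix.toEuclideanLin K (X u ω - ξ u ω) + r • V u ω) -
        (Matrix.toEuclideanLin K (X' u ω - ξ u ω) + r • V' u ω) =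
        Matrix.toEuclideanLin K (X u ω - X' u ω) + r • (V u ω - V' u ω) := by
      simp only [map_sub, smul_sub]; abel
    rw [h1, map_add, map_smul, ← toEuclideanLin_mul_apply, hK, toEuclideanLin_mul_apply,
      PiLp.add_apply, PiLp.smul_apply, toEuclideanLin_diagonal_apply, smul_eq_mul]
  have hcomp : ∀ i, ∀ᵐ ω ∂P, ∀ t, Matrix.toEuclideanLin R (X t ω - X' t ω) i = 0 ∧
      Matrix.toEuclideanLin R (V t ω - V' t ω) i = 0 := by
    intro i
    let π : EuclideanSpace ℝ ι →L[ℝ] ℝ := EuclideanSpace.proj i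
    refine scalar_solution_unique hT (F := F) (r := r) (k := κ i)
      (m := fun t ω => Matrix.toEuclideanLin R (M t ω - M' t ω) i) (hκ i)
      (isOptional_iff.1 hdR.memX.optional i) (isOptional_iff.1 hdR.memV.optional i)
      (π.integrable_comp (hdR.memX.integrable_prod hT.le))
      (π.integrable_comp (hdR.memV.integrable_prod hT.le))
      (martingale_clm hdR.martingale π) ?_ ?_ ?_ ?_ ?_
    · filter_upwards [hdR.continuous] with ω hω
      exact π.continuous.comp hω
    · filter_upwards [hdR.forward.dynamics, hdR.memV.ae_integrable hT.le] with ω hω hi s t hst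
      have := congrArg π (hω s t hst)
      rwa [map_sub, ← π.integral_comp_comm hi.integrableOn] at this
    · filter_upwards [hdR.forward.init] with ω hω t ht
      have := congrArg π (hω t ht)
      rwa [map_zero] at this
    · filter_upwards [hdR.backward, hdR.memG.ae_integrable hT.le] with ω hω hi s t hst
      have := congrArg π (hω s t hst)
      rw [map_sub π, map_add π, map_sub π, ← π.integral_comp_comm hi.integrableOn] at this
      simpa only [← hdrift] using! this
    · filter_upwards [hdR.terminal] with ω hω t ht
      have := congrArg π (hω t ht)
      rwa [map_zero] at this
  have hinj : ∀ v : EuclideanSpace ℝ ι, (∀ i, Matrix.toEuclideanLin R v i = 0) → v = 0 := by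
    intro v hv
    have h0 : Matrix.toEuclideanLin R v = 0 := PiLp.ext hv
    rw [← toEuclideanLin_one_apply v, ← hR'R, toEuclideanLin_mul_apply, h0, map_zero]
  filter_upwards [ae_all_iff.2 hcomp, hd.backward] with ω hω hb
  have hX : ∀ t, X t ω = X' t ω := fun t => sub_eq_zero.1 (hinj _ fun i => (hω i t).1)
  have hV : ∀ t, V t ω = V' t ω := fun t => sub_eq_zero.1 (hinj _ fun i => (hω i t).2)
  have hM : ∀ s t, s ≤ t → M t ω - M s ω = M' t ω - M' s ω := by
    intro s t hst
    have h1 := hb s t hst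
    simp only [hX, hV, sub_self, integral_zero, add_zero] at h1
    have h2 : (M t ω - M s ω) - (M' t ω - M' s ω) = 0 := by rw [h1]; abel
    exact sub_eq_zero.1 h2
  refine fun t => ⟨hX t, hV t, fun s => ?_⟩
  rcases le_total s t with hst | hst
  · exact hM s t hst
  · rw [← neg_sub, hM t s hst, neg_sub]

end Transfer

/-! ### Existence for the vector-valued system with bounded target -/

section Existence

variable {ι : Type*} [Fintype ι] {F : Filtration (TimeInt T) mΩ}

lemma norm_le_sqrt_sum_sq {v : EuclideanSpace ℝ ι} {C : ι → ℝ} (h : ∀ i, |v i| ≤ C i) :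
    ‖v‖ ≤ Real.sqrt (∑ i, C i ^ 2) := by
  rw [EuclideanSpace.norm_eq]
  refine Real.sqrt_le_sqrt (Finset.sum_le_sum fun i _ => ?_)
  rw [Real.norm_eq_abs]
  exact pow_le_pow_left₀ (abs_nonneg _) (h i) 2

lemma memHInf_of_abs_le {X : TimeInt T → Ω → EuclideanSpace ℝ ι} (hX : IsOptional F X) {C : ι → ℝ}
    (hC : ∀ t ω i, |X t ω i| ≤ C i) : MemHInf P F X :=
  memHInf_iff.2 ⟨hX, Real.sqrt (∑ i, C i ^ 2), Real.sqrt_nonneg _,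
    Eventually.of_forall fun ω => Eventually.of_forall fun t => norm_le_sqrt_sum_sq (hC t ω)⟩

lemma memHInf_of_isRegular {x : ι → TimeInt T → Ω → ℝ} (hx : ∀ i, IsRegular F (x i)) :
    MemHInf P F fun t ω => WithLp.toLp 2 fun i => x i t ω := by
  choose C hC using fun i => (hx i).bounded
  exact memHInf_of_abs_le (isOptional_iff.2 fun i => (hx i).optional) fun t ω i => hC i t ω

lemma martingale_finsetSum {E α : Type*} [NormedAddCommGroup E] [NormedSpace ℝ E]
    [CompleteSpace E] (s : Finset α) {M : α → TimeInt T → Ω → E}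
    (hM : ∀ i ∈ s, Martingale (M i) F P) : Martingale (fun t ω => ∑ i ∈ s, M i t ω) F P := by
  classical
  induction s using Finset.induction_on with
  | empty => simpa using! martingale_zero E F P
  | insert a s ha ih =>
    simp only [Finset.sum_insert ha]
    exact (hM a (by simp)).add (ih fun i hi => hM i (by simp [hi]))

lemma martingale_toLp [DecidableEq ι] {m : ι → TimeInt T → Ω → ℝ}
    (hm : ∀ i, Martingale (m i) F P) :
    Martingale (fun t ω => (WithLp.toLp 2 fun i => m i t ω : EuclideanSpace ℝ ι)) F P := by
  have h := martingale_finsetSum Finset.univ fun i _ => martingale_clm (hm i)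
    ((ContinuousLinearMap.id ℝ ℝ).smulRight (EuclideanSpace.single i (1 : ℝ)))
  refine (congrArg (fun M => Martingale M F P) (funext fun t => funext fun ω => ?_)).mpr h
  ext j
  simp [Finset.sum_apply, Pi.single_apply]

variable [DecidableEq ι]

lemma exists_drift_solution [IsProbabilityMeasure P] (hT : 0 < T) {d : ℕ}
    {W : TimeInt T → Ω → EuclideanSpace ℝ (Fin d)} (hW : IsBrownianMotion P W)
    (r : ℝ) (hF : F = augmentedFiltration P W hW.measurable) {κ : ι → ℝ} (hκ : ∀ i, 0 < κ i)
    {η : TimeInt T → Ω → EuclideanSpace ℝ ι} (hη : IsOptional F η) {C : ℝ}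
    (hC : ∀ t ω i, |η t ω i| ≤ C) :
    ∃ X V M : TimeInt T → Ω → EuclideanSpace ℝ ι,
      MemHInf P F X ∧ MemHInf P F V ∧ MemHInf P F M ∧
      IsDriftSolution P F X V M
        (fun t ω => Matrix.toEuclideanLin (Matrix.diagonal κ) (X t ω - η t ω) + r • V t ω) := by
  choose x v m hx hv hm hmart hfwd hinit hbwd hterm using fun i =>
    exists_scalar_solution hT hW r (hκ i) hF (isOptional_iff.1 hη i) fun t ω => hC t ω i
  have hX := memHInf_of_isRegular (P := P) hx
  have hV := memHInf_of_isRegular (P := P) hv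
  have hM := memHInf_of_isRegular (P := P) hm
  have hη' : MemHInf P F η := memHInf_of_abs_le hη hC
  have hG := ((hX.sub hη').lin (Matrix.toEuclideanLin (Matrix.diagonal κ))).add (hV.smul r)
  refine ⟨_, _, _, hX, hV, hM, hX.memH2, hV.memH2, hG.memH2, martingale_toLp hmart, fun t => ?_,
    ?_, ⟨?_, ?_⟩, ?_, ?_⟩
  · choose D hD using fun i => (hm i).bounded
    exact MemLp.of_bound ((martingale_toLp hmart).1 t |>.mono (F.le t)).aestronglyMeasurable _
      (Eventually.of_forall fun ω => norm_le_sqrt_sum_sq fun i => hD i t ω)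
  · refine Eventually.of_forall fun ω => ?_
    exact (PiLp.continuous_toLp 2 _).comp (continuous_pi fun i => (hm i).continuous ω)
  · filter_upwards [hV.ae_integrable hT.le] with ω hi s t hst
    ext i
    have h1 := (EuclideanSpace.proj i : EuclideanSpace ℝ ι →L[ℝ] ℝ).integral_comp_comm
      (hi.integrableOn (s := Set.Ioc s t))
    exact (hfwd i ω s t hst).trans h1
  · refine Eventually.of_forall fun ω t ht => ?_
    ext i
    exact hinit i ω t ht
  · filter_upwards [hG.ae_integrable hT.le] with ω hi s t hst
    ext i
    have h1 := (EuclideanSpace.proj i : EuclideanSpace ℝ ι →L[ℝ] ℝ).integral_comp_comm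
      (hi.integrableOn (s := Set.Ioc s t))
    have h2 := hbwd i ω s t hst
    rw [PiLp.add_apply, PiLp.sub_apply, PiLp.sub_apply]
    refine h2.trans (congrArg _ (Eq.trans ?_ h1))
    simp [Matrix.mulVec_diagonal, mul_sub]
  · filter_upwards [ae_all_iff.2 hterm] with ω hω t ht
    ext i
    exact hω i t ht

/-- The target enters only under the time integral. -/
lemma IsFBSDESolution.congr_target {r : ℝ} {K : Matrix ι ι ℝ}
    {ξ ξ' X V M : TimeInt T → Ω → EuclideanSpace ℝ ι} (h : IsFBSDESolution P F r K ξ X V M)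
    (hξ : ∀ᵐ ω ∂P, ∀ᵐ t ∂(leb T), ξ t ω = ξ' t ω) : IsFBSDESolution P F r K ξ' X V M where
  memX := h.memX
  memXdot := h.memXdot
  martingale := h.martingale
  sq_integrable := h.sq_integrable
  continuous := h.continuous
  forward := h.forward
  backward := by
    filter_upwards [h.backward, hξ] with ω hω hω' s t hst
    rw [hω s t hst]
    congr 1
    refine integral_congr_ae (ae_restrict_of_ae ?_)
    filter_upwards [hω'] with u hu
    rw [hu]
  terminal := h.terminal

/-- The system is solved in the eigencoordinates given by R, where it decouples, and the solution is
carried back by R'; boundedness survives both linear maps. -/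
lemma exists_isFBSDESolution [IsProbabilityMeasure P] (hT : 0 < T) {d : ℕ}
    {W : TimeInt T → Ω → EuclideanSpace ℝ (Fin d)} (hW : IsBrownianMotion P W)
    (r : ℝ) (hF : F = augmentedFiltration P W hW.measurable)
    {R R' K : Matrix ι ι ℝ} {κ : ι → ℝ} (hRR' : R * R' = 1) (hR'R : R' * R = 1)
    (hκ : ∀ i, 0 < κ i) (hK : R * K = Matrix.diagonal κ * R)
    {ξ : TimeInt T → Ω → EuclideanSpace ℝ ι} (hξ : MemHInf P F ξ) :
    ∃ X V M : TimeInt T → Ω → EuclideanSpace ℝ ι, MemHInf P F X ∧ MemHInf P F V ∧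
      MemHInf P F M ∧ IsFBSDESolution P F r K ξ X V M := by
  obtain ⟨hopt, C, hC0, hC⟩ := memHInf_iff.1 (hξ.lin (Matrix.toEuclideanLin R))
  -- The scalar theorem needs a bound for all t and ω, while H^∞ gives one only almost everywhere.
  -- The truncated target agrees with R ξ almost everywhere, which `IsFBSDESolution.congr_target`
  -- absorbs.
  set η : TimeInt T → Ω → EuclideanSpace ℝ ι := fun t ω =>
    WithLp.toLp 2 fun i => max (-C) (min C (Matrix.toEuclideanLin R (ξ t ω) i)) with hη
  have hηopt : IsOptional F η := isOptional_iff.2 fun i =>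
    measurable_const.max (measurable_const.min (isOptional_iff.1 hopt i))
  have hηC : ∀ t ω i, |η t ω i| ≤ C := fun t ω i =>
    abs_le.2 ⟨le_max_left _ _, max_le (by linarith) (min_le_left _ _)⟩
  obtain ⟨X, V, M, hX, hV, hM, hsol⟩ := exists_drift_solution hT hW r hF hκ hηopt hηC
  refine ⟨_, _, _, hX.lin (Matrix.toEuclideanLin R'), hV.lin (Matrix.toEuclideanLin R'),
    hM.lin (Matrix.toEuclideanLin R'), ?_⟩
  have hKR' : K * R' = R' * Matrix.diagonal κ := by
    calc K * R' = R' * (R * K) * R' := by rw [← Matrix.mul_assoc, hR'R, Matrix.one_mul]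
      _ = _ := by rw [hK, Matrix.mul_assoc, Matrix.mul_assoc, hRR', Matrix.mul_one]
  have h1 := (hsol.clm hT.le (LinearMap.toContinuousLinearMap
    (Matrix.toEuclideanLin R'))).isFBSDESolution (r := r) (B := K)
      (ξ := fun t ω => Matrix.toEuclideanLin R' (η t ω)) fun t ω => by
    simp only [LinearMap.coe_toContinuousLinearMap']
    rw [← map_sub, ← toEuclideanLin_mul_apply, hKR', toEuclideanLin_mul_apply, map_add, map_smul]
  refine h1.congr_target ?_
  filter_upwards [hC] with ω hω
  filter_upwards [hω] with t ht
  have h2 : η t ω = Matrix.toEuclideanLin R (ξ t ω) := by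
    ext i
    have h3 := abs_le.1 ((PiLp.norm_apply_le (Matrix.toEuclideanLin R (ξ t ω)) i).trans ht)
    change max (-C) (min C _) = _
    rw [min_eq_right h3.2, max_eq_right h3.1]
  rw [h2, ← toEuclideanLin_mul_apply, hR'R, toEuclideanLin_one_apply]

end Existence

/-! ### Stacking -/

section Stack

variable {d N : ℕ} {F : Filtration (TimeInt T) mΩ}

/-- The vector in `ℝ^{dN}` with given blocks. -/
def stackVec (v : Fin N → EuclideanSpace ℝ (Fin d)) : EuclideanSpace ℝ (Fin N × Fin d) :=
  WithLp.toLp 2 fun p => v p.1 p.2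

/-- The `m`-th block of a vector in `ℝ^{dN}`. -/
def blockProj (m : Fin N) : EuclideanSpace ℝ (Fin N × Fin d) →L[ℝ] EuclideanSpace ℝ (Fin d) :=
  LinearMap.toContinuousLinearMap
    { toFun := fun v => WithLp.toLp 2 fun i => v (m, i)
      map_add' := fun _ _ => rfl
      map_smul' := fun _ _ => rfl }

/-- The vector in `ℝ^{dN}` whose only nonzero block is the `m`-th one. -/
def blockIncl (m : Fin N) : EuclideanSpace ℝ (Fin d) →L[ℝ] EuclideanSpace ℝ (Fin N × Fin d) :=
  LinearMap.toContinuousLinearMap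
    { toFun := fun v => WithLp.toLp 2 fun p => if m = p.1 then v p.2 else 0
      map_add' := fun _ _ => by ext p; simp only [PiLp.add_apply]; split_ifs <;> simp
      map_smul' := fun _ _ => by ext p; simp }

lemma blockProj_stackVec (v : Fin N → EuclideanSpace ℝ (Fin d)) (m : Fin N) :
    blockProj m (stackVec v) = v m := rfl

lemma sum_blockIncl (v : Fin N → EuclideanSpace ℝ (Fin d)) :
    ∑ m, blockIncl m (v m) = stackVec v := by
  ext p
  simp [blockIncl, stackVec]

lemma toEuclideanLin_kronecker_stackVec (C : Matrix (Fin N) (Fin N) ℝ)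
    (B : Matrix (Fin d) (Fin d) ℝ) (v : Fin N → EuclideanSpace ℝ (Fin d)) :
    Matrix.toEuclideanLin (C ⊗ₖ B) (stackVec v) =
      stackVec fun m => Matrix.toEuclideanLin B (∑ i, C m i • v i) := by
  ext p
  simp only [stackVec, map_sum, map_smul, Matrix.toLpLin_apply, Matrix.mulVec, dotProduct,
    Matrix.kroneckerMap_apply, Fintype.sum_prod_type, WithLp.ofLp_sum, WithLp.ofLp_smul,
    Finset.sum_apply, Pi.smul_apply, smul_eq_mul, Finset.mul_sum, mul_assoc]

lemma sum_matC_smul {E : Type*} [AddCommGroup E] [Module ℝ E] (v : Fin N → E) (m : Fin N) :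
    ∑ i, matC N m i • v i = v m + ((N : ℝ) + 1)⁻¹ • ∑ i ∈ Finset.univ.erase m, v i := by
  rw [← Finset.add_sum_erase _ _ (Finset.mem_univ m), Finset.smul_sum]
  congr 1
  · simp [matC]
  · refine Finset.sum_congr rfl fun i hi => ?_
    simp [matC, (Finset.ne_of_mem_erase hi).symm]

/-- The bounded exogenous part of the target of investor `m`. -/
def exoTarget (r δ : ℝ) (Sig Lam : Matrix (Fin d) (Fin d) ℝ)
    (ν ψ ψdot a : TimeInt T → Ω → EuclideanSpace ℝ (Fin d))
    (ζ : Fin N → TimeInt T → Ω → EuclideanSpace ℝ (Fin d)) (m : Fin N) :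
    TimeInt T → Ω → EuclideanSpace ℝ (Fin d) := fun t ω =>
  ((N : ℝ) + 1)⁻¹ • ((((N : ℝ) - 1) * δ) • Matrix.toEuclideanLin Sig⁻¹ (ν t ω) - ψ t ω
      - ((N : ℝ) - 1) • ζ m t ω
      + (2 * δ) • Matrix.toEuclideanLin (Sig⁻¹ * Lam) (a t ω - r • ψdot t ω))

variable {r δ : ℝ} {Sig Lam : Matrix (Fin d) (Fin d) ℝ}
  {ν ψ ψdot a : TimeInt T → Ω → EuclideanSpace ℝ (Fin d)}
  {ζ : Fin N → TimeInt T → Ω → EuclideanSpace ℝ (Fin d)}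

lemma target_eq (φ : Fin N → TimeInt T → Ω → EuclideanSpace ℝ (Fin d)) (m : Fin N)
    (t : TimeInt T) (ω : Ω) :
    target r δ Sig Lam ν ψ ψdot a ζ φ m t ω = exoTarget r δ Sig Lam ν ψ ψdot a ζ m t ω -
      ((N : ℝ) + 1)⁻¹ • ∑ i ∈ Finset.univ.erase m, φ i t ω := by
  -- The natural subtraction N - 1 is the real one because the existence of m forces N ≥ 1.
  have hcard : ((Finset.univ.erase m).card : ℝ) = (N : ℝ) - 1 := by
    rw [Finset.card_erase_of_mem (Finset.mem_univ m), Finset.card_univ, Fintype.card_fin,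
      Nat.cast_sub (Nat.one_le_of_lt m.2), Nat.cast_one]
  rw [target, exoTarget, Finset.sum_sub_distrib, Finset.sum_const, ← Nat.cast_smul_eq_nsmul ℝ,
    hcard, div_eq_inv_mul]
  module

lemma memHInf_exoTarget (hν : MemHInf P F ν) (hψ : MemHInf P F ψ) (hψdot : MemHInf P F ψdot)
    (ha : MemHInf P F a) (hζ : ∀ m, MemHInf P F (ζ m)) (m : Fin N) :
    MemHInf P F (exoTarget r δ Sig Lam ν ψ ψdot a ζ m) :=
  (((((hν.lin _).smul _).sub hψ).sub ((hζ m).smul _)).add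
    (((ha.sub (hψdot.smul r)).lin _).smul _)).smul _

lemma memHInf_stack {X : Fin N → TimeInt T → Ω → EuclideanSpace ℝ (Fin d)}
    (hX : ∀ m, MemHInf P F (X m)) : MemHInf P F (stack X) := by
  have h := MemHInf.sum Finset.univ fun m _ => (hX m).clm (blockIncl m)
  simpa only [sum_blockIncl] using! h

/-- In φ_m - TP_m the own demand has weight 1 and every other demand weight 1/(N+1), which is row m
of C. The matrix cancels its inverse in front of Z, leaving B applied to the exogenous target. -/
lemma toEuclideanLin_sub_target (hK : (matC N ⊗ₖ matB δ Sig Lam) *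
      (matC N ⊗ₖ matB δ Sig Lam)⁻¹ = 1)
    (φ φdot : Fin N → TimeInt T → Ω → EuclideanSpace ℝ (Fin d)) (t : TimeInt T) (ω : Ω) :
    Matrix.toEuclideanLin (matC N ⊗ₖ matB δ Sig Lam)
        (stack φ t ω - Matrix.toEuclideanLin (matC N ⊗ₖ matB δ Sig Lam)⁻¹
          (exoZ r δ Sig Lam ν ψ ψdot a ζ t ω)) + r • stack φdot t ω =
      stackVec fun m => Matrix.toEuclideanLin (matB δ Sig Lam)
        (φ m t ω - target r δ Sig Lam ν ψ ψdot a ζ φ m t ω) + r • φdot m t ω := by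
  have h1 : ∀ X : Fin N → TimeInt T → Ω → EuclideanSpace ℝ (Fin d),
    stack X t ω = stackVec fun m => X m t ω := fun _ => rfl
  have h2 : exoZ r δ Sig Lam ν ψ ψdot a ζ t ω = stackVec fun m =>
    Matrix.toEuclideanLin (matB δ Sig Lam) (exoTarget r δ Sig Lam ν ψ ψdot a ζ m t ω) := rfl
  have h3 : ∀ v w u : Fin N → EuclideanSpace ℝ (Fin d), stackVec v - stackVec w + r • stackVec u =
    stackVec fun m => v m - w m + r • u m := fun _ _ _ => rfl
  rw [map_sub, ← toEuclideanLin_mul_apply, hK, toEuclideanLin_one_apply, h1, h1,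
    toEuclideanLin_kronecker_stackVec, h2]
  refine (h3 _ _ _).trans (congrArg stackVec (funext fun m => ?_))
  rw [sum_matC_smul, target_eq, ← map_sub]
  congr 2
  abel

/-- The stacked triple is the sum of the block inclusions of the individual ones, and these are its
block projections, so both directions are linear images. For stacking, each target must lie in H²,
which follows from the demands being in H². -/
lemma isNashSystemSolution_iff [IsProbabilityMeasure P] (hT : 0 ≤ T)
    (hK : (matC N ⊗ₖ matB δ Sig Lam) * (matC N ⊗ₖ matB δ Sig Lam)⁻¹ = 1)
    (hν : MemHInf P F ν) (hψ : MemHInf P F ψ) (hψdot : MemHInf P F ψdot)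
    (ha : MemHInf P F a) (hζ : ∀ m, MemHInf P F (ζ m))
    {ξ : TimeInt T → Ω → EuclideanSpace ℝ (Fin N × Fin d)} (hξ : MemHInf P F ξ)
    (hξ' : ∀ t ω, ξ t ω = Matrix.toEuclideanLin (matC N ⊗ₖ matB δ Sig Lam)⁻¹
      (exoZ r δ Sig Lam ν ψ ψdot a ζ t ω))
    (φ φdot M : Fin N → TimeInt T → Ω → EuclideanSpace ℝ (Fin d)) :
    IsNashSystemSolution P F r δ Sig Lam ν ψ ψdot a ζ φ φdot M ↔
      IsFBSDESolution P F r (matC N ⊗ₖ matB δ Sig Lam) ξ (stack φ) (stack φdot) (stack M) := by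
  constructor
  · intro h
    have htar : ∀ m, MemH2 P F (target r δ Sig Lam ν ψ ψdot a ζ φ m) := by
      intro m
      have h1 := (memHInf_exoTarget (r := r) (δ := δ) (Sig := Sig) (Lam := Lam)
        hν hψ hψdot ha hζ m).memH2.sub hT
          ((MemH2.sum hT (Finset.univ.erase m) fun i _ => (h i).memX).smul hT ((N : ℝ) + 1)⁻¹)
      simpa only [← target_eq] using! h1
    have hsum := IsDriftSolution.sum hT Finset.univ fun m _ =>
      ((h m).isDriftSolution hT (htar m)).clm hT (blockIncl m)
    simp only [sum_blockIncl] at hsum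
    refine hsum.isFBSDESolution fun t ω => ?_
    rw [hξ' t ω]
    exact (toEuclideanLin_sub_target hK φ φdot t ω).symm
  · intro h m
    have hd := (h.isDriftSolution hT hξ.memH2).clm hT (blockProj m)
    refine hd.isFBSDESolution fun t ω => ?_
    rw [hξ' t ω, toEuclideanLin_sub_target hK, blockProj_stackVec]
    rfl

end Stack

end FrictionalNash

end

/-! ### The lemma on the frictional Nash system -/

open FrictionalNash in
theorem lemma4p5 {Ω : Type*} {mΩ : MeasurableSpace Ω} (P : Measure Ω) [IsProbabilityMeasure P]
    {T : ℝ} (hT : 0 < T) {d N : ℕ}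
    (W : TimeInt T → Ω → EuclideanSpace ℝ (Fin d)) (hW : IsBrownianMotion P W)
    (F : Filtration (TimeInt T) mΩ) (hF : F = augmentedFiltration P W hW.measurable)
    (r : ℝ) (hr : 0 ≤ r) (δ : ℝ) (hδ : 0 < δ)
    (σ Lam : Matrix (Fin d) (Fin d) ℝ)
    (Sig : Matrix (Fin d) (Fin d) ℝ) (hSig : Sig = σ * σᵀ) (hSigPos : Sig.PosDef)
    (hLamDiag : Lam.IsDiag) (hLamPos : Lam.PosDef)
    (ν : TimeInt T → Ω → EuclideanSpace ℝ (Fin d)) (hν : MemHInf P F ν)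
    (ζ : Fin N → TimeInt T → Ω → EuclideanSpace ℝ (Fin d)) (hζ : ∀ m, MemHInf P F (ζ m))
    (ψ ψdot a Mψ : TimeInt T → Ω → EuclideanSpace ℝ (Fin d))
    (hψ : IsOptional F ψ) (hψrate : HasRate P ψ ψdot)
    (hψdot : IsADecomposition P F ψdot a Mψ) :
    -- existence in the admissible class, and uniqueness up to indistinguishability
    (∃ φ φdot M : Fin N → TimeInt T → Ω → EuclideanSpace ℝ (Fin d),
      IsNashSystemSolution P F r δ Sig Lam ν ψ ψdot a ζ φ φdot M ∧
      (∀ m, MemWA P F (φ m) ∧ MemA P F (φdot m) ∧ MemHInf P F (M m)) ∧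
      ∀ φ' φdot' M' : Fin N → TimeInt T → Ω → EuclideanSpace ℝ (Fin d),
        IsNashSystemSolution P F r δ Sig Lam ν ψ ψdot a ζ φ' φdot' M' →
        ∀ᵐ ω ∂P, ∀ m t, φ' m t ω = φ m t ω ∧ φdot' m t ω = φdot m t ω ∧
          ∀ s, M' m t ω - M' m s ω = M m t ω - M m s ω) ∧
    -- the coefficient matrix `C ⊗ B` has only positive eigenvalues
    (∀ z : ℂ, Module.End.HasEigenvalue
        (Matrix.toLin' ((matC N ⊗ₖ matB δ Sig Lam).map Complex.ofReal)) z →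
      0 < z.re ∧ z.im = 0) ∧
    -- the system is the single linear FBSDE with matrix `C ⊗ B` and a bounded target
    (∃ ξ : TimeInt T → Ω → EuclideanSpace ℝ (Fin N × Fin d),
      MemHInf P F ξ ∧
      (∀ t ω, ξ t ω = Matrix.toEuclideanLin (matC N ⊗ₖ matB δ Sig Lam)⁻¹
        (exoZ r δ Sig Lam ν ψ ψdot a ζ t ω)) ∧
      ∀ φ φdot M : Fin N → TimeInt T → Ω → EuclideanSpace ℝ (Fin d),
        IsNashSystemSolution P F r δ Sig Lam ν ψ ψdot a ζ φ φdot M ↔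
        IsFBSDESolution P F r (matC N ⊗ₖ matB δ Sig Lam) ξ
          (stack φ) (stack φdot) (stack M)) := by
  obtain ⟨R, R', κ, hRR', hR'R, hκ, hRK⟩ :=
    exists_diagonalization_kronecker (N := N) hδ hSigPos hLamDiag hLamPos
  have hK := mul_inv_of_diagonalization hRR' hR'R hκ hRK
  have hψ' : MemHInf P F ψ := hψrate.memHInf hT.le hψ hψdot.memX
  have hexo := memHInf_exoTarget (r := r) (δ := δ) (Sig := Sig) (Lam := Lam) hν hψ' hψdot.memX
    hψdot.mem_drift hζ
  set ξ : TimeInt T → Ω → EuclideanSpace ℝ (Fin N × Fin d) := fun t ω =>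
    Matrix.toEuclideanLin (matC N ⊗ₖ matB δ Sig Lam)⁻¹ (exoZ r δ Sig Lam ν ψ ψdot a ζ t ω) with hξ
  have hZ : MemHInf P F (exoZ r δ Sig Lam ν ψ ψdot a ζ) :=
    memHInf_stack fun m => (hexo m).lin (Matrix.toEuclideanLin (matB δ Sig Lam))
  have hξmem : MemHInf P F ξ := hZ.lin _
  have hiff := isNashSystemSolution_iff hT.le hK hν hψ' hψdot.memX hψdot.mem_drift hζ hξmem
    fun _ _ => rfl
  refine ⟨?_, fun z hz => eigenvalue_pos_of_diagonalization hR'R hκ hRK hz,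
    ξ, hξmem, fun _ _ => rfl, hiff⟩
  obtain ⟨X, V, M, hX, hV, hM, hsol⟩ := exists_isFBSDESolution hT hW r hF hRR' hR'R hκ hRK hξmem
  have hNash := (hiff (fun m t ω => blockProj m (X t ω)) (fun m t ω => blockProj m (V t ω))
    (fun m t ω => blockProj m (M t ω))).2 hsol
  have hφ := fun m => hX.clm (blockProj m)
  have hφdot := fun m => hV.clm (blockProj m)
  have hMm := fun m => hM.clm (blockProj m)
  -- The drift B (φ_m - TP_m) + r φ̇_m is bounded because all demands, and hence the target, are
  -- bounded.
  have hA : ∀ m, MemA P F fun t ω => blockProj m (V t ω) := by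
    intro m
    have htar : MemHInf P F
        (target r δ Sig Lam ν ψ ψdot a ζ (fun m t ω => blockProj m (X t ω)) m) := by
      have h1 := (hexo m).sub
        ((MemHInf.sum (Finset.univ.erase m) fun i _ => hφ i).smul ((N : ℝ) + 1)⁻¹)
      exact (congrArg (MemHInf P F) (funext fun t => funext fun ω => target_eq _ m t ω)).mpr h1
    refine ⟨_, _, hφdot m, (((hφ m).sub htar).lin (Matrix.toEuclideanLin (matB δ Sig Lam))).add
      ((hφdot m).smul r), hMm m, (hNash m).martingale, (hNash m).continuous, ?_,
      (hNash m).terminal⟩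
    filter_upwards [(hNash m).backward] with ω hω s t hst
    rw [hω s t hst, add_comm]
  refine ⟨_, _, _, hNash, fun m => ⟨⟨(hφ m).optional, _, (hNash m).forward, hA m⟩, hA m, hMm m⟩,
    fun φ' φdot' M' h' => ?_⟩
  -- The competing solution is only known to be in H²; stacking and uniqueness for the single system
  -- need no more.
  filter_upwards [((hiff φ' φdot' M').1 h').unique hT hR'R hκ hRK hξmem.memH2 hsol] with ω hω m t
  obtain ⟨h1, h2, h3⟩ := hω t
  exact ⟨congrArg (blockProj m) h1, congrArg (blockProj m) h2, fun s =>
    (congrArg (blockProj m) (h3 s)).trans (map_sub _ _ _)⟩
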